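/- **Setting.** Let $V$ be a vertex operator algebra over $\mathbb{C}$ ($\mathbb{Z}$-graded by finite-dimensional weight spaces that vanish in sufficiently negative weight), $G$ a group of automorphisms of $V$, and $z\in\mathbb{C}^\times$. For $p\in\mathbb{Z}$ put $l_p(\zeta)=\log|\zeta|+i\arg \zeta+2\pi p i$ with $0\le\arg\zeta<2\pi$; the $p$-th branch of a formal series in complex powers of $x$ and powers of $\log x$ is obtained by substituting $x^n\mapsto e^{n l_p(\zeta)}$, $\log x\mapsto l_p(\zeta)$; if no branch is indicated, $p=0$. For $g\in G$, a *$g$-twisted $V$-module* is a $\mathbb{C}$-graded space $W=\coprod_n W_{[n]}$ with a linear map $Y_W:V\otimes W\to W\{x\}[\log x]$, $Y_W(v,x)w=\sum_{k=0}^{K}\sum_{n\in\mathbb C} Y_{n,k}(v)w\,x^{-n-1}(\log x)^k$, where $Y_{n,k}(v)$ shifts weights by $\mathrm{wt}\,v-n-1$, satisfying: equivariance $Y_W^{p+1}(gv,\zeta)=Y_W^{p}(v,\zeta)$; $Y_W(\mathbf 1,x)=1$; duality (the products $\langle w',Y_W^p(u,z_1)Y_W^p(v,z_2)w\rangle$,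 $\langle w',Y_W^p(v,z_2)Y_W^p(u,z_1)w\rangle$ and the iterate $\langle w',Y_W^p(Y_V(u,z_1-z_2)v,z_2)w\rangle$ converge absolutely for $|z_1|>|z_2|>0$, $|z_2|>|z_1|>0$, $|z_2|>|z_1-z_2|>0$ to the branch $\sum a_{ijkl}e^{m_il_p(z_1)}e^{n_jl_p(z_2)}l_p(z_1)^kl_p(z_2)^l(z_1-z_2)^{-t}$ of one function, a finite sum independent of $p$, the last equality being required where $|\arg z_1-\arg z_2|<\frac{\pi}{2}$); $L(0)-n$ is locally nilpotent on $W_{[n]}$; $\frac{d}{dx}Y_W(v,x)=Y_W(L(-1)v,x)$; and, for each $n\in\mathbb C$, $W_{[n+l]}=0$ for sufficiently negative real $l$. A *module map* is a linear map that commutes with the vertex operators. $\overline W=\prod_n W_{[n]}$ is the completion, and the contragredient $W'=\coprod_n W_{[n]}^*$ has the vertex operators $\langle Y'(v,x)w',w\rangle=\langle w',Y_W(e^{xL(1)}(-x^{-2})^{L(0)}v,x^{-1})w\rangle$. For $g_i$-twisted modules $W_i$ ($i=1,2,3$), a *twisted intertwining operator* of type $\binom{W_3}{W_1W_2}$ is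 a linear map $w_1\otimes w_2\mapsto\mathcal Y(w_1,x)w_2=\sum_{n\in\mathbb{C}}\sum_{k}\mathcal Y_{n,k}(w_1)w_2\,x^{-n-1}(\log x)^k$, in which the coefficient of each power of $x$ is a polynomial in $\log x$ and $\mathcal Y_{n,k}(w_1)w_2\in (W_3)_{[m_1+m_2-n-1]}$ for $w_i\in (W_i)_{[m_i]}$, such that: 1. $\mathcal Y_{n+l,k}(w_1)w_2=0$ for all sufficiently large $l\in\mathbb N$; 2. for $u\in V$, $w_1$, $w_2$, $w_3'\in W_3'$ there is a multivalued analytic function $f$ on $M^2=\{z_1,z_2\ne0,\ z_1\neq z_2\}$, with a preferred branch $f^e$ on $M^2$ cut along $z_1,z_2,z_1-z_2\in\mathbb R_+$ (cuts attached to the upper half planes), such that $\langle w_3',Y_{W_3}(u,z_1)\mathcal Y(w_1,z_2)w_2\rangle$, $\langle w_3',\mathcal Y(w_1,z_2)Y_{W_2}(u,z_1)w_2\rangle$, $\langle w_3',\mathcal Y(Y_{W_1}(u,z_1-z_2)w_1,z_2)w_2\rangle$ converge absolutely for $|z_1|>|z_2|>0$, $|z_2|>|z_1|>0$, $|z_2|>|z_1-z_2|>0$,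 with sum $f^e$ where moreover $|\arg(z_1-z_2)-\arg z_1|<\frac\pi2$, respectively $-\frac{3\pi}2<\arg(z_1-z_2)-\arg z_2<-\frac\pi2$, respectively $|\arg z_1-\arg z_2|<\frac\pi2$; 3. for $k\ge3$ the products $\langle w_3',Y_{W_3}(u_1,z_1)\cdots Y_{W_3}(u_{k-1},z_{k-1})\mathcal Y(w_1,z_k)w_2\rangle$ converge absolutely for $|z_1|>\dots>|z_k|>0$ and extend to a multivalued analytic function on $M^k=\{z_i\neq0,\ z_i\ne z_j\ (i\neq j)\}$ all of whose component-isolated singularities are regular. Here, for $A\in GL(k,\mathbb C)$, $\beta\in\mathbb C^k$, $\delta\in\{0,\infty\}^k$, the singularity $\zeta=(z_1,\dots,z_k)A-\beta=\delta$ is component-isolated if $M^k$ contains a punctured polydisc ($0<|\zeta_i|<r_i$ if $\delta_i=0$, $|\zeta_i|>r_i$ if $\delta_i=\infty$), and it is regular if there are $K\in\mathbb N$ and sets $D_i$ of exponents, each a finite union of sets $r+\mathbb N$ (if $\delta_i=0$) or $r-\mathbb N$ (if $\delta_i=\infty$), such that every single-valued branch near $\delta$ with cuts at $\zeta_i\in\mathbb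 R_+$ is, on some punctured polydisc, the sum of an absolutely convergent series in the monomials $\prod_i\zeta_i^{a_i}(\log\zeta_i)^{j_i}$ with $a_i\in D_i$, $0\le j_i\le K$; 4. $\frac{d}{dx}\mathcal Y(w_1,x)=\mathcal Y(L(-1)w_1,x)$. Let $\mathcal C$ be a category whose objects are either $g$-twisted $V$-modules, $g\in G$, or $g$-twisted $V$-modules, $g\in G$, with an action of $G$ (a left $G$-module structure on $W$ such that, for some $\Lambda\ge1$, each $W_{[n]}$ is the direct sum over $\alpha\in\mathbb C/\mathbb Z$ of its intersections with $\ker(g-e^{2\pi i\alpha})^\Lambda$, and $gY_W(u,x)w=Y_W(gu,x)gw$), and whose morphisms are all module maps. Let $W_1,W_2$ be $g_1$- and $g_2$-twisted modules in $\mathcal C$. A *$P(z)$-product* of $W_1,W_2$ in $\mathcal C$ is a pair $(W_3,I)$ of a $g_1g_2$-twisted module $W_3$ in $\mathcal C$ and a *twisted $P(z)$-intertwining map* $I:W_1\otimes W_2\to\overline{W_3}$, i.e. $I(w_1\otimes w_2)=\mathcal Y(w_1,z)w_2$ for a twisted intertwining operator $\mathcal Y$ of type $\binom{W_3}{W_1W_2}$.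 A *$P(z)$-tensor product* is a $P(z)$-product $(P,B)$ such that for every $P(z)$-product $(W_3,I)$ there is a unique module map $f:P\to W_3$ with $\bar f\circ B=I$, where $\bar f:\overline P\to\overline{W_3}$ is the natural extension of $f$. For a $P(z)$-product $(W_3,I)$ and $w_3'\in W_3'$ let $\lambda_{I,w_3'}(w_1\otimes w_2)=\langle w_3',I(w_1\otimes w_2)\rangle$. Let $W_1\widetilde\boxtimes_{P(z)}W_2\subset(W_1\otimes W_2)^*$ be the span of all $\lambda_{I,w_3'}$, with $Y(v,x)\lambda_{I,w_3'}=\lambda_{I,Y'(v,x)w_3'}$, its weight-$n$ subspace being spanned by the $\lambda_{I,w_3'}$ with $w_3'$ of weight $n$. **Theorem.** Assume that (1) for all $g_1,g_2\in G$ and all $g_1$-, $g_2$-twisted modules $W_1,W_2$ in $\mathcal C$, $W_1\widetilde\boxtimes_{P(z)}W_2$ is a $(g_1g_2)^{-1}$-twisted module in $\mathcal C$ (in the case with $G$-actions: with some action of $G$); (2) the contragredient of a $g$-twisted module in $\mathcal C$ is a $g^{-1}$-twisted module in $\mathcal C$ (in the case with $G$-actions: with some action of $G$); (3) every object of $\mathcal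 C$ is equivalent, as a twisted module, to its double contragredient. Then for all $g_1$- and $g_2$-twisted modules $W_1,W_2$ in $\mathcal C$, the contragredient $W_1\boxtimes_{P(z)}W_2=(W_1\widetilde\boxtimes_{P(z)}W_2)'$, with the map $\boxtimes_{P(z)}:W_1\otimes W_2\to\overline{W_1\boxtimes_{P(z)}W_2}$ determined by $\langle\lambda,\boxtimes_{P(z)}(w_1\otimes w_2)\rangle=\lambda(w_1\otimes w_2)$ for $\lambda\in W_1\widetilde\boxtimes_{P(z)}W_2$, is a $P(z)$-tensor product of $W_1$ and $W_2$ in $\mathcal C$. -/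

import Mathlib

open scoped TensorProduct DirectSum Topology

universe u w

noncomputable section

/-! ## Vertex operator algebras and their automorphisms -/

/-- A vertex operator algebra over `ℂ`. `Y v` is the vertex operator
`Y(v, x) = ∑ n, v_n x ^ (-n - 1)`, and `v_n` is `VertexOperator.ncoeff (Y v) n`.
The Jacobi identity is written in components (Borcherds' identity). -/
structure VOA (V : Type u) [AddCommGroup V] [Module ℂ V] where
  /-- the homogeneous subspace `V_(n)` -/
  wt : ℤ → Submodule ℂ V
  internal : DirectSum.IsInternal wt
  finiteDimensional : ∀ n, FiniteDimensional ℂ (wt n)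
  lower_bounded : ∃ N : ℤ, ∀ n < N, wt n = ⊥
  Y : V →ₗ[ℂ] VertexOperator ℂ V
  /-- the vacuum -/
  vac : V
  /-- the conformal element -/
  ω : V
  /-- the central charge -/
  c : ℂ
  vac_mem : vac ∈ wt 0
  ω_mem : ω ∈ wt 2
  vac_left : ∀ (v : V) (n : ℤ), (Y vac).ncoeff n v = if n = -1 then v else 0
  creation : ∀ (v : V) (n : ℤ), 0 ≤ n → (Y v).ncoeff n vac = 0
  creation' : ∀ v : V, (Y v).ncoeff (-1) vac = v
  jacobi : ∀ (a b v : V) (l m n : ℤ),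
    ∑ᶠ i : ℕ, ((Ring.choose m i : ℤ) : ℂ) •
        (Y ((Y a).ncoeff (l + i) b)).ncoeff (m + n - i) v =
      ∑ᶠ i : ℕ, ((-1 : ℂ) ^ i * ((Ring.choose l i : ℤ) : ℂ)) •
        ((Y a).ncoeff (m + l - i) ((Y b).ncoeff (n + i) v) -
          (-1 : ℂ) ^ l • (Y b).ncoeff (n + l - i) ((Y a).ncoeff (m + i) v))
  /-- the Virasoro relations for `L(n) = ω_{n+1}` -/
  virasoro : ∀ (m n : ℤ) (v : V),
    (Y ω).ncoeff (m + 1) ((Y ω).ncoeff (n + 1) v) -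
        (Y ω).ncoeff (n + 1) ((Y ω).ncoeff (m + 1) v) =
      ((m : ℂ) - n) • (Y ω).ncoeff (m + n + 1) v +
        if m + n = 0 then (((m : ℂ) ^ 3 - m) / 12 * c) • v else 0
  L_zero : ∀ (n : ℤ), ∀ v ∈ wt n, (Y ω).ncoeff 1 v = (n : ℂ) • v
  L_neg_one : ∀ (v b : V) (n : ℤ),
    (Y ((Y ω).ncoeff 0 v)).ncoeff n b = -(n : ℂ) • (Y v).ncoeff (n - 1) b

namespace VOA

variable {V : Type u} [AddCommGroup V] [Module ℂ V] (𝒱 : VOA V)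

/-- The Virasoro operator `L(n)` on `V`. -/
def L (n : ℤ) : Module.End ℂ V := (𝒱.Y 𝒱.ω).ncoeff (n + 1)

theorem bijective_coe : Function.Bijective (DirectSum.coeLinearMap 𝒱.wt) := 𝒱.internal

/-- The decomposition `V = ∐ n, V_(n)`. -/
def decomp : V ≃ₗ[ℂ] ⨁ n, 𝒱.wt n :=
  (LinearEquiv.ofBijective (DirectSum.coeLinearMap 𝒱.wt) 𝒱.bijective_coe).symm

/-- The projection `π_n : V → V_(n)`. -/
def proj (n : ℤ) : V →ₗ[ℂ] 𝒱.wt n :=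
  (DirectSum.component ℂ ℤ (fun n => 𝒱.wt n) n).comp 𝒱.decomp.toLinearMap

/-- The group of automorphisms of the vertex operator algebra. -/
def Aut : Subgroup (V ≃ₗ[ℂ] V) where
  carrier := {g | g 𝒱.vac = 𝒱.vac ∧ g 𝒱.ω = 𝒱.ω ∧
    ∀ (a b : V) (n : ℤ), g ((𝒱.Y a).ncoeff n b) = (𝒱.Y (g a)).ncoeff n (g b)}
  mul_mem' := by
    rintro g h ⟨g1, g2, g3⟩ ⟨h1, h2, h3⟩
    refine ⟨?_, ?_, fun a b n => ?_⟩
    · rw [LinearEquiv.mul_apply, h1, g1]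
    · rw [LinearEquiv.mul_apply, h2, g2]
    · simp only [LinearEquiv.mul_apply, h3, g3]
  one_mem' := ⟨rfl, rfl, fun _ _ _ => rfl⟩
  inv_mem' := by
    rintro g ⟨g1, g2, g3⟩
    have key : ∀ x, g⁻¹ (g x) = x := fun x => g.symm_apply_apply x
    have key' : ∀ x, g (g⁻¹ x) = x := fun x => g.apply_symm_apply x
    refine ⟨?_, ?_, fun a b n => ?_⟩
    · conv_lhs => rw [← g1]
      exact key _
    · conv_lhs => rw [← g2]
      exact key _
    · apply g.injective
      rw [key', g3, key', key']

/-- The component of weight `n` of `Y(a, ζ) b`. -/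
def evalComp (a b : V) (ζ : ℂ) (n : ℤ) : V :=
  ∑ᶠ m : ℤ, ζ ^ (-m - 1) • (𝒱.proj n ((𝒱.Y a).ncoeff m b) : V)

theorem decomp_coe (n : ℤ) (v : 𝒱.wt n) :
    𝒱.decomp (v : V) = DirectSum.of (fun n => 𝒱.wt n) n v := by
  rw [decomp, LinearEquiv.symm_apply_eq, LinearEquiv.ofBijective_apply]
  exact (DirectSum.coeLinearMap_of 𝒱.wt n v).symm

theorem mem_wt_of_L_zero (e : ℤ) (v : V) (hv : 𝒱.L 0 v = (e : ℂ) • v) : v ∈ 𝒱.wt e := by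
  obtain ⟨x, rfl⟩ := 𝒱.decomp.symm.surjective v
  have h1 : ∀ y : ⨁ n, 𝒱.wt n, ∀ n : ℤ,
      (𝒱.decomp (𝒱.L 0 (𝒱.decomp.symm y))) n = (n : ℂ) • y n := by
    intro y n
    induction y using DirectSum.induction_on with
    | zero => simp
    | of i a =>
      have ha : 𝒱.decomp.symm (DirectSum.of (fun n => 𝒱.wt n) i a) = (a : V) := by
        rw [LinearEquiv.symm_apply_eq, decomp_coe]
      have hL : 𝒱.L 0 (a : V) = (i : ℂ) • (a : V) := 𝒱.L_zero i a a.2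
      rw [ha, hL, map_smul, decomp_coe]
      by_cases hin : i = n
      · subst hin; rw [DirectSum.smul_apply]
      · rw [DirectSum.smul_apply, DirectSum.of_eq_of_ne _ _ _ (Ne.symm hin)]; simp
    | add a b ha hb => simp only [map_add, DirectSum.add_apply, ha, hb, smul_add]
  have h2 : ∀ n : ℤ, n ≠ e → x n = 0 := by
    intro n hn
    have h3 := h1 x n
    rw [hv, map_smul, LinearEquiv.apply_symm_apply, DirectSum.smul_apply] at h3
    have h4 : ((e : ℂ) - n) • x n = 0 := by rw [sub_smul, h3, sub_self]
    rcases smul_eq_zero.mp h4 with h5 | h5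
    · exact absurd (by exact_mod_cast (sub_eq_zero.mp h5).symm) hn
    · exact h5
  have h6 : x = DirectSum.of (fun n => 𝒱.wt n) e (x e) := by
    ext n
    by_cases hn : n = e
    · subst hn; simp
    · rw [h2 n hn, DirectSum.of_eq_of_ne _ _ _ hn]
  have h7 : 𝒱.decomp.symm x = (x e : V) := by
    conv_lhs => rw [h6]
    rw [LinearEquiv.symm_apply_eq, decomp_coe]
  rw [h7]; exact (x e).2

theorem L_one_pow_mem (h : ℤ) (v : V) (hv : v ∈ 𝒱.wt h) (j : ℕ) :
    ((𝒱.L 1) ^ j) v ∈ 𝒱.wt (h - j) := by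
  induction j with
  | zero => simpa using hv
  | succ j ih =>
    rw [pow_succ', Module.End.mul_apply]
    set x := ((𝒱.L 1) ^ j) v
    apply mem_wt_of_L_zero
    have h1 := 𝒱.virasoro 0 1 x
    have h2 : 𝒱.L 0 x = ((h - j : ℤ) : ℂ) • x := 𝒱.L_zero _ x ih
    simp only [L] at h2 ⊢
    norm_num at h1 h2 ⊢
    rw [h2, map_smul] at h1
    rw [sub_eq_iff_eq_add] at h1
    rw [h1]
    module

/-- A weight below which all `V_(n)` vanish. -/
def lowest : ℤ := Classical.choose 𝒱.lower_bounded

end VOA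

/-! ## Branches of logarithms and formal series -/

/-- The argument normalised by `0 ≤ arg z < 2π`. -/
def argPos (z : ℂ) : ℝ := if 0 ≤ z.arg then z.arg else z.arg + 2 * Real.pi

/-- `l_p(z) = log |z| + i arg z + 2π p i`. -/
def lBranch (p : ℤ) (z : ℂ) : ℂ :=
  (Real.log ‖z‖ : ℂ) + argPos z * Complex.I + 2 * Real.pi * p * Complex.I

/-- Formal series in complex powers of `x` and powers of `log x`: `f n k` is the coefficient of
`x ^ (-n - 1) (log x) ^ k`. -/
abbrev LogSeries (W : Type w) := ℂ → ℕ → W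

/-! ## Graded spaces with a vertex operator map -/

/-- A vector space with subspaces `W_[n]`, `n ∈ ℂ`, and a linear map `Y` from `V ⊗ W` to formal
series; `Y v w n k` is the coefficient of `x ^ (-n - 1) (log x) ^ k` in `Y(v, x) w`. The weights of
the coefficients are the ones that make `Y(v, z) w` an element of the algebraic completion. The
axioms of a twisted module are imposed in `IsTwistedModule`. -/
structure VData {V : Type u} [AddCommGroup V] [Module ℂ V] (𝒱 : VOA V) where
  carrier : Type w
  [addCommGroup : AddCommGroup carrier]
  [module : Module ℂ carrier]
  wt : ℂ → Submodule ℂ carrier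
  Y : V →ₗ[ℂ] carrier →ₗ[ℂ] LogSeries carrier
  homog : ∀ (h : ℤ), ∀ v ∈ 𝒱.wt h, ∀ (m : ℂ), ∀ x ∈ wt m, ∀ (n : ℂ) (k : ℕ),
    Y v x n k ∈ wt (m + h - n - 1)

namespace VData

variable {V : Type u} [AddCommGroup V] [Module ℂ V] {𝒱 : VOA V}

instance : CoeSort (VData.{u, w} 𝒱) (Type w) := ⟨VData.carrier⟩
instance (W : VData.{u, w} 𝒱) : AddCommGroup W := W.addCommGroup
instance (W : VData.{u, w} 𝒱) : Module ℂ W := W.module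

variable (W : VData.{u, w} 𝒱)

/-- The algebraic completion `∏ n, W_[n]`. -/
abbrev Completion : Type w := ∀ n : ℂ, W.wt n

open Classical in
/-- The projection `π_n : W → W_[n]` for `W = ∐ n, W_[n]` (the bijectivity says that `W` is the direct
sum of the `W_[n]`). -/
def proj (n : ℂ) : W →ₗ[ℂ] W.wt n :=
  if h : Function.Bijective (DirectSum.coeLinearMap W.wt) then
    (DirectSum.component ℂ ℂ (fun n => W.wt n) n).comp
      (LinearEquiv.ofBijective (DirectSum.coeLinearMap W.wt) h).symm.toLinearMap
  else 0

theorem proj_of_ne {m n : ℂ} (hmn : m ≠ n) (x : W) (hx : x ∈ W.wt m) : W.proj n x = 0 := by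
  unfold proj
  split_ifs with h
  · have : (LinearEquiv.ofBijective (DirectSum.coeLinearMap W.wt) h).symm x =
        DirectSum.of (fun n => W.wt n) m ⟨x, hx⟩ := by
      rw [LinearEquiv.symm_apply_eq, LinearEquiv.ofBijective_apply]
      exact (DirectSum.coeLinearMap_of W.wt m ⟨x, hx⟩).symm
    rw [LinearMap.comp_apply, LinearEquiv.coe_coe, this]
    exact DirectSum.of_eq_of_ne _ _ _ hmn.symm
  · rfl

/-- The element of the completion obtained from a formal series by substituting `exp (n ℓ)` for
`x ^ n` and `ℓ` for `log x`. For `ℓ = l_p(z)` this is the `p`-th branch at `z`. -/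
def eval (ℓ : ℂ) (f : LogSeries W) : W.Completion := fun m =>
  ∑ᶠ p : ℂ × ℕ, (Complex.exp ((-p.1 - 1) * ℓ) * ℓ ^ p.2) • W.proj m (f p.1 p.2)

/-- The Virasoro operator `L(j) = Res_x x ^ (j + 1) Y(ω, x)`. -/
def L (j : ℤ) : Module.End ℂ W where
  toFun x := W.Y 𝒱.ω x (j + 1) 0
  map_add' x y := by simp
  map_smul' a x := by simp

/-! ### Graded duals and contragredients -/

/-- `(W_[n])^*`, as the functionals on `W` that vanish on all other weight spaces. -/
def dualWt (n : ℂ) : Submodule ℂ (Module.Dual ℂ W) where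
  carrier := {φ | ∀ m, m ≠ n → ∀ x ∈ W.wt m, φ x = 0}
  add_mem' := by
    intro a b ha hb m hm x hx
    rw [LinearMap.add_apply, ha m hm x hx, hb m hm x hx, add_zero]
  zero_mem' := fun _ _ _ _ => rfl
  smul_mem' := by
    intro c a ha m hm x hx
    rw [LinearMap.smul_apply, ha m hm x hx, smul_zero]

/-- The graded dual `W' = ∐ n, (W_[n])^*`. -/
def gdual : Submodule ℂ (Module.Dual ℂ W) := ⨆ n, W.dualWt n

theorem support_finite (φ : Module.Dual ℂ W) (hφ : φ ∈ W.gdual) :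
    {n : ℂ | ∃ x ∈ W.wt n, φ x ≠ 0}.Finite := by
  unfold gdual at hφ
  induction hφ using Submodule.iSup_induction' with
  | mem i x hx =>
    refine (Set.finite_singleton i).subset ?_
    rintro n ⟨y, hy, hne⟩
    by_contra hn
    exact hne (hx n hn y hy)
  | zero =>
    refine Set.finite_empty.subset ?_
    rintro n ⟨y, _, hne⟩
    exact hne rfl
  | add x y _ _ hx hy =>
    refine (hx.union hy).subset ?_
    rintro n ⟨a, ha, hne⟩
    by_contra hn
    simp only [Set.mem_union, Set.mem_ofPred_eq, not_or, not_exists, not_and, not_not] at hn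
    exact hne (by rw [LinearMap.add_apply, hn.1 a ha, hn.2 a ha, add_zero])

theorem pairing_finite (φ : W.gdual) (y : W.Completion) :
    (Function.support fun n => (φ : Module.Dual ℂ W) (y n : W)).Finite :=
  (W.support_finite φ φ.2).subset fun n hn => ⟨y n, (y n).2, hn⟩

/-- The pairing of an element of `W'` with the algebraic completion of `W`. -/
def pairing (φ : W.gdual) : W.Completion →ₗ[ℂ] ℂ where
  toFun y := ∑ᶠ n, (φ : Module.Dual ℂ W) (y n : W)
  map_add' x y := by
    rw [← finsum_add_distrib (W.pairing_finite φ x) (W.pairing_finite φ y)]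
    simp
  map_smul' c x := by
    simp only [Pi.smul_apply, Submodule.coe_smul, map_smul, RingHom.id_apply]
    rw [smul_finsum' c (W.pairing_finite φ x)]

theorem comp_mem_dualWt (h : ℤ) (a : V) (ha : a ∈ 𝒱.wt h) (r : ℂ) (φ : Module.Dual ℂ W)
    (hφ : φ ∈ W.dualWt r) (n : ℂ) (k : ℕ) (ψ : Module.Dual ℂ W)
    (hψ : ∀ x, ψ x = φ (W.Y a x n k)) : ψ ∈ W.dualWt (r - h + n + 1) := by
  intro m hm x hx
  rw [hψ]
  refine hφ _ (fun he => hm ?_) _ (W.homog h a ha m x hx n k)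
  rw [← he]; ring

/-- The functional `w' ∘ Y_{n, k}(a)`. -/
def adjFun (a : V) (φ : Module.Dual ℂ W) (n : ℂ) (k : ℕ) : Module.Dual ℂ W where
  toFun x := φ (W.Y a x n k)
  map_add' x y := by simp
  map_smul' c x := by simp

theorem adjFun_mem (a : V) (φ : Module.Dual ℂ W) (hφ : φ ∈ W.gdual) (n : ℂ) (k : ℕ) :
    W.adjFun a φ n k ∈ W.gdual := by
  unfold gdual at hφ
  induction hφ using Submodule.iSup_induction' with
  | mem r φ hφ =>
    have ha : a ∈ ⨆ h, 𝒱.wt h := by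
      rw [𝒱.internal.submodule_iSup_eq_top]; trivial
    induction ha using Submodule.iSup_induction' with
    | mem h a ha =>
      exact Submodule.mem_iSup_of_mem _
        (W.comp_mem_dualWt h a ha r φ hφ n k _ fun _ => rfl)
    | zero =>
      have : W.adjFun 0 φ n k = 0 := by ext x; simp [adjFun]
      rw [this]; exact zero_mem _
    | add a b _ _ ha hb =>
      have : W.adjFun (a + b) φ n k = W.adjFun a φ n k + W.adjFun b φ n k := by
        ext x; simp [adjFun]
      rw [this]; exact add_mem ha hb
  | zero =>
    have : W.adjFun a 0 n k = 0 := by ext x; simp [adjFun]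
    rw [this]; exact zero_mem _
  | add φ ψ _ _ hφ hψ =>
    have : W.adjFun a (φ + ψ) n k = W.adjFun a φ n k + W.adjFun a ψ n k := by
      ext x; simp [adjFun]
    rw [this]; exact add_mem hφ hψ

/-- `w' ∘ Y_{n, k}(a)` as an element of `W'`. -/
def adj (a : V) (φ : W.gdual) (n : ℂ) (k : ℕ) : W.gdual :=
  ⟨W.adjFun a φ n k, W.adjFun_mem a φ φ.2 n k⟩

/-- For `v` of weight `h`, the coefficients of `w' ∘ Y(e^{x L(1)} (-x^{-2})^{L(0)} v, x^{-1})`.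
Here `e^{x L(1)} (-x^{-2})^{L(0)} v = ∑ j, (-1) ^ h / j! x ^ (j - 2h) L(1) ^ j v`, where
`L(1) ^ j v` has weight `h - j`, so that the sum is finite. -/
def contraAux (h : ℤ) : V →ₗ[ℂ] W.gdual →ₗ[ℂ] LogSeries W.gdual where
  toFun v :=
    { toFun := fun φ n k => ∑ j ∈ Finset.range ((h - 𝒱.lowest).toNat + 1),
        ((-1 : ℂ) ^ h * (-1 : ℂ) ^ k / (j.factorial : ℂ)) •
          W.adj (((𝒱.L 1) ^ j) v) φ (2 * h - n - 2 - j) k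
      map_add' := by
        intro φ ψ
        ext n k x
        simp [adj, adjFun, Finset.sum_add_distrib, mul_add]
      map_smul' := by
        intro c φ
        ext n k x
        simp [adj, adjFun, Finset.mul_sum, mul_left_comm] }
  map_add' := by
    intro v v'
    ext φ n k x
    simp [adj, adjFun, Finset.sum_add_distrib, mul_add]
  map_smul' := by
    intro c v
    ext φ n k x
    simp [adj, adjFun, Finset.mul_sum, mul_left_comm]

/-- The vertex operator map of the contragredient, given by
`⟨Y'(v, x) w', w⟩ = ⟨w', Y(e^{x L(1)} (-x^{-2})^{L(0)} v, x^{-1}) w⟩`. -/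
def contraY : V →ₗ[ℂ] W.gdual →ₗ[ℂ] LogSeries W.gdual :=
  (DirectSum.toModule ℂ ℤ (W.gdual →ₗ[ℂ] LogSeries W.gdual)
    fun h => (W.contraAux h).comp (𝒱.wt h).subtype).comp 𝒱.decomp.toLinearMap

theorem contraY_of_mem (h : ℤ) (v : V) (hv : v ∈ 𝒱.wt h) : W.contraY v = W.contraAux h v := by
  have h1 : 𝒱.decomp v = DirectSum.lof ℂ ℤ (fun n => 𝒱.wt n) h ⟨v, hv⟩ :=
    𝒱.decomp_coe h ⟨v, hv⟩
  rw [contraY, LinearMap.comp_apply, LinearEquiv.coe_coe, h1, DirectSum.toModule_lof]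
  rfl

/-- The contragredient `W'`. -/
def contra : VData.{u, w} 𝒱 where
  carrier := W.gdual
  wt n := (W.dualWt n).comap W.gdual.subtype
  Y := W.contraY
  homog := by
    intro h v hv r φ hφ n k
    rw [W.contraY_of_mem h v hv]
    change (∑ j ∈ Finset.range ((h - 𝒱.lowest).toNat + 1),
        ((-1 : ℂ) ^ h * (-1 : ℂ) ^ k / (j.factorial : ℂ)) •
          W.adj (((𝒱.L 1) ^ j) v) φ (2 * h - n - 2 - j) k) ∈ (W.dualWt _).comap W.gdual.subtype
    refine Submodule.sum_mem _ fun j _ => Submodule.smul_mem _ _ ?_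
    have h1 := W.comp_mem_dualWt (h - j) _ (𝒱.L_one_pow_mem h v hv j) r φ hφ
      (2 * h - n - 2 - j) k (W.adjFun (((𝒱.L 1) ^ j) v) φ (2 * h - n - 2 - j) k) fun _ => rfl
    have h2 : r - ((h - j : ℤ) : ℂ) + (2 * h - n - 2 - j) + 1 = r + h - n - 1 := by
      push_cast
      ring
    rw [h2] at h1
    exact h1

end VData

/-! ## Twisted modules -/

section TwistedModules

variable {V : Type u} [AddCommGroup V] [Module ℂ V] {𝒱 : VOA V}

/-- The function `∑ a_{ijkl} e^{m_i l_p(z₁)} e^{n_j l_p(z₂)} l_p(z₁)^k l_p(z₂)^l (z₁ - z₂)^{-t}`. -/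
def corrFun {N : ℕ} (a : Fin (N + 1) → Fin (N + 1) → Fin (N + 1) → Fin (N + 1) → ℂ)
    (m n : Fin (N + 1) → ℂ) (t : ℕ) (p : ℤ) (z₁ z₂ : ℂ) : ℂ :=
  ∑ i, ∑ j, ∑ k, ∑ l, a i j k l * Complex.exp (m i * lBranch p z₁) *
    Complex.exp (n j * lBranch p z₂) * lBranch p z₁ ^ (k : ℕ) * lBranch p z₂ ^ (l : ℕ) *
    (z₁ - z₂) ^ (-(t : ℤ))

/-- `W` is a generalized `g`-twisted `V`-module (without a `g`-action). -/
structure IsGeneralizedTwistedModule (g : V ≃ₗ[ℂ] V) (W : VData.{u, w} 𝒱) : Prop where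
  internal : DirectSum.IsInternal W.wt
  log_bounded : ∀ (v : V) (x : W), ∃ K : ℕ, ∀ (n : ℂ) (k : ℕ), K < k → W.Y v x n k = 0
  equivariance : ∀ (p : ℤ) (z : ℂ), z ≠ 0 → ∀ (v : V) (x : W),
    W.eval (lBranch (p + 1) z) (W.Y (g v) x) = W.eval (lBranch p z) (W.Y v x)
  identity : ∀ (x : W) (n : ℂ) (k : ℕ), W.Y 𝒱.vac x n k = if n = -1 ∧ k = 0 then x else 0
  duality : ∀ (a b : V) (x : W) (φ : W.gdual),
    ∃ (N : ℕ) (α : Fin (N + 1) → Fin (N + 1) → Fin (N + 1) → Fin (N + 1) → ℂ)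
      (m n : Fin (N + 1) → ℂ) (t : ℕ), 0 < t ∧ ∀ (p : ℤ) (z₁ z₂ : ℂ),
      (‖z₂‖ < ‖z₁‖ → 0 < ‖z₂‖ → HasSum (fun r : ℂ => W.pairing φ
          (W.eval (lBranch p z₁) (W.Y a (W.eval (lBranch p z₂) (W.Y b x) r))))
          (corrFun α m n t p z₁ z₂)) ∧
      (‖z₁‖ < ‖z₂‖ → 0 < ‖z₁‖ → HasSum (fun r : ℂ => W.pairing φ
          (W.eval (lBranch p z₂) (W.Y b (W.eval (lBranch p z₁) (W.Y a x) r))))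
          (corrFun α m n t p z₁ z₂)) ∧
      (‖z₁ - z₂‖ < ‖z₂‖ → 0 < ‖z₁ - z₂‖ →
        Summable (fun r : ℤ => W.pairing φ
          (W.eval (lBranch p z₂) (W.Y (𝒱.evalComp a b (z₁ - z₂) r) x))) ∧
        (|argPos z₁ - argPos z₂| < Real.pi / 2 →
          ∑' r : ℤ, W.pairing φ
            (W.eval (lBranch p z₂) (W.Y (𝒱.evalComp a b (z₁ - z₂) r) x)) =
          corrFun α m n t p z₁ z₂))
  L_zero_grading : ∀ (n : ℂ), ∀ x ∈ W.wt n, ∃ K : ℕ, 0 < K ∧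
    ((W.L 0 - n • (1 : Module.End ℂ W)) ^ K) x = 0
  L_neg_one_derivative : ∀ (v : V) (x : W) (n : ℂ) (k : ℕ),
    W.Y (𝒱.L (-1) v) x n k = -n • W.Y v x (n - 1) k + ((k : ℂ) + 1) • W.Y v x (n - 1) (k + 1)

/-- `W` is a `g`-twisted `V`-module, i.e. a lower-bounded generalized `g`-twisted `V`-module. -/
structure IsTwistedModule (g : V ≃ₗ[ℂ] V) (W : VData.{u, w} 𝒱) : Prop
    extends IsGeneralizedTwistedModule g W where
  lower_bounded : ∀ n : ℂ, ∃ R : ℝ, ∀ l : ℝ, l < R → W.wt (n + l) = ⊥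

/-- The left `G`-module structure `ρ` makes the `g`-twisted module `W` a module with a `g`-action
and a `G`-action. The `g`-grading condition is stated through the generalized eigenspaces
`ker (g - e^{2πiα}) ^ Λ`, which are independent for distinct classes `α ∈ ℂ/ℤ`; it says that
`W_[n]` is the direct sum of the spaces `W_[n]^[α] = W_[n] ⊓ ker (g - e^{2πiα}) ^ Λ`. -/
structure IsGAction {G : Subgroup (V ≃ₗ[ℂ] V)} (g : G) (W : VData.{u, w} 𝒱)
    (ρ : Representation ℂ G W) : Prop where
  g_grading : ∃ Λ : ℕ, 0 < Λ ∧ ∀ n : ℂ, W.wt n ≤ ⨆ α : ℂ, W.wt n ⊓ LinearMap.ker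
    ((ρ g - Complex.exp (2 * Real.pi * α * Complex.I) • (1 : Module.End ℂ W)) ^ Λ)
  compat : ∀ (a : V) (x : W) (n : ℂ) (k : ℕ),
    ρ g (W.Y a x n k) = W.Y ((g : V ≃ₗ[ℂ] V) a) (ρ g x) n k

/-- `f` is a module map. -/
def IsModuleMap (W W' : VData.{u, w} 𝒱) (f : W →ₗ[ℂ] W') : Prop :=
  ∀ (v : V) (x : W) (n : ℂ) (k : ℕ), f (W.Y v x n k) = W'.Y v (f x) n k

/-- Equivalence of twisted modules. -/
def IsEquivalent (W W' : VData.{u, w} 𝒱) : Prop :=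
  ∃ e : W ≃ₗ[ℂ] W', IsModuleMap W W' e.toLinearMap

end TwistedModules

/-! ## Multivalued analytic functions -/

/-- `ψ` is the result of analytic continuation of the germ `φ` along the path `γ`. -/
def IsContinuationAlong {n : ℕ} (γ : C(unitInterval, Fin n → ℂ)) (φ ψ : (Fin n → ℂ) → ℂ) : Prop :=
  ∃ Φ : unitInterval → (Fin n → ℂ) → ℂ,
    (∀ t, AnalyticAt ℂ (Φ t) (γ t)) ∧
    (∀ t, ∀ᶠ s in 𝓝 t, Φ s =ᶠ[𝓝 (γ s)] Φ t) ∧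
    Φ 0 =ᶠ[𝓝 (γ 0)] φ ∧ Φ 1 =ᶠ[𝓝 (γ 1)] ψ

/-- A (maximally extended) multivalued analytic function on `Ω`: a germ at a point of `Ω` that can
be continued analytically along every path in `Ω`. -/
structure MultiFun (n : ℕ) (Ω : Set (Fin n → ℂ)) where
  base : Fin n → ℂ
  base_mem : base ∈ Ω
  germ : (Fin n → ℂ) → ℂ
  analyticAt : AnalyticAt ℂ germ base
  continuable : ∀ γ : C(unitInterval, Fin n → ℂ), γ 0 = base → (∀ t, γ t ∈ Ω) →
    ∃ ψ, IsContinuationAlong γ germ ψ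

namespace MultiFun

variable {n : ℕ} {Ω : Set (Fin n → ℂ)} (f : MultiFun n Ω)

/-- `ψ` is one of the germs of the multivalued function `f` at the point `z`. -/
def IsGermAt (z : Fin n → ℂ) (ψ : (Fin n → ℂ) → ℂ) : Prop :=
  ∃ γ : C(unitInterval, Fin n → ℂ), γ 0 = f.base ∧ γ 1 = z ∧ (∀ t, γ t ∈ Ω) ∧
    IsContinuationAlong γ f.germ ψ

/-- `F` is a single-valued branch of `f` on the region `R` cut along `c i ∈ ℝ_+`, the cuts being
attached to the upper half `c i`-planes: near each point of `R`, the function `F` agrees with a germ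
of `f` on the points at which no `arg (c i)` has jumped. -/
def IsBranchOn {ι : Type*} (R : Set (Fin n → ℂ)) (c : ι → (Fin n → ℂ) → ℂ)
    (F : (Fin n → ℂ) → ℂ) : Prop :=
  ∀ z ∈ R, ∃ ψ, f.IsGermAt z ψ ∧
    ∀ᶠ z' in 𝓝 z, (∀ i, |argPos (c i z') - argPos (c i z)| < Real.pi) → F z' = ψ z'

/-- The new variables `ζ = z A - β`. -/
def newVar (A : GL (Fin n) ℂ) (β : Fin n → ℂ) (z : Fin n → ℂ) : Fin n → ℂ :=
  Matrix.vecMul z (A : Matrix (Fin n) (Fin n) ℂ) - β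

/-- The points `z` with `ζ = z A - β` in the punctured polydisc `Δ^×(δ, r)`; `δ i = true` stands for
`δ_i = ∞` and `δ i = false` for `δ_i = 0`. -/
def puncturedPolydisc (A : GL (Fin n) ℂ) (β : Fin n → ℂ) (δ : Fin n → Bool) (r : Fin n → ℝ) :
    Set (Fin n → ℂ) :=
  {z | ∀ i, if δ i then r i < ‖newVar A β z i‖
    else 0 < ‖newVar A β z i‖ ∧ ‖newVar A β z i‖ < r i}

/-- `ζ = z A - β = δ` is a component-isolated singularity of functions on `Ω`. -/
def IsComponentIsolated (Ω : Set (Fin n → ℂ)) (A : GL (Fin n) ℂ) (β : Fin n → ℂ)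
    (δ : Fin n → Bool) : Prop :=
  ∃ r : Fin n → ℝ, (∀ i, 0 < r i) ∧ puncturedPolydisc A β δ r ⊆ Ω

/-- The exponents `E + ℕ` (at `0`) or `E - ℕ` (at `∞`). -/
def exponents (E : Finset ℂ) (atInfty : Bool) : Set ℂ :=
  {a | ∃ e ∈ E, ∃ m : ℕ, a = if atInfty then e - m else e + m}

/-- `ζ = z A - β = δ` is a regular singularity of `f`: with a common bound `K` for the powers of
logarithms and common finitely generated sets of exponents, each single-valued branch of `f` near
`δ`, with cuts at `ζ_i ∈ ℝ_+`, is the sum of an absolutely convergent series in the powers and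
logarithms of the `ζ_i`. -/
def IsRegularSingularity (A : GL (Fin n) ℂ) (β : Fin n → ℂ) (δ : Fin n → Bool) : Prop :=
  ∃ (K : ℕ) (E : Fin n → Finset ℂ), ∀ F : (Fin n → ℂ) → ℂ,
    (∃ r : Fin n → ℝ, (∀ i, 0 < r i) ∧
      f.IsBranchOn (puncturedPolydisc A β δ r) (fun i z => newVar A β z i) F) →
    ∃ (r : Fin n → ℝ) (α : (∀ i, exponents (E i) (δ i)) × (Fin n → Fin (K + 1)) → ℂ),
      (∀ i, 0 < r i) ∧ ∀ z ∈ puncturedPolydisc A β δ r,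
        HasSum (fun q : (∀ i, exponents (E i) (δ i)) × (Fin n → Fin (K + 1)) =>
          α q * ∏ i, (Complex.exp ((q.1 i : ℂ) * lBranch 0 (newVar A β z i)) *
            lBranch 0 (newVar A β z i) ^ (q.2 i : ℕ))) (F z)

end MultiFun

/-- `M^n`: the points of `ℂ^n` with nonzero and pairwise distinct coordinates. -/
def Mspace (n : ℕ) : Set (Fin n → ℂ) :=
  {z | (∀ i, z i ≠ 0) ∧ ∀ i j, i ≠ j → z i ≠ z j}

/-- The functions `z₁`, `z₂`, `z₁ - z₂` defining the cuts of `M^2_0`. -/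
def cutsM2 : Fin 3 → (Fin 2 → ℂ) → ℂ :=
  ![fun z => z 0, fun z => z 1, fun z => z 0 - z 1]

/-! ## Twisted intertwining operators -/

section Intertwining

variable {V : Type u} [AddCommGroup V] [Module ℂ V] {𝒱 : VOA V}

/-- `Y(u₁, z₁) π_{n₁} Y(u₂, z₂) π_{n₂} ⋯ Y(u_r, z_r) π_{n_r} y` for `y` in the completion. -/
def nestedProd (W : VData.{u, w} 𝒱) : (r : ℕ) → (Fin r → V) → (Fin r → ℂ) → (Fin r → ℂ) →
    W.Completion → W.Completion
  | 0, _, _, _, y => y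
  | r + 1, a, z, n, y => W.eval (lBranch 0 (z 0)) (W.Y (a 0)
      (nestedProd W r (Fin.tail a) (Fin.tail z) (Fin.tail n) y (n 0)))

/-- `𝒴` is a twisted intertwining operator of type `(W₃; W₁ W₂)`; `𝒴 x₁ x₂ n k` is the coefficient
of `x ^ (-n - 1) (log x) ^ k` in `𝒴(x₁, x) x₂`. -/
structure IsTwistedIntertwiningOperator (W₁ W₂ W₃ : VData.{u, w} 𝒱)
    (𝒴 : W₁ →ₗ[ℂ] W₂ →ₗ[ℂ] LogSeries W₃) : Prop where
  /-- the weights of the coefficients, by which `𝒴(x₁, z) x₂` lies in the completion of `W₃` -/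
  homog : ∀ (m₁ m₂ : ℂ), ∀ x₁ ∈ W₁.wt m₁, ∀ x₂ ∈ W₂.wt m₂, ∀ (n : ℂ) (k : ℕ),
    𝒴 x₁ x₂ n k ∈ W₃.wt (m₁ + m₂ - n - 1)
  /-- the coefficient of each power of `x` is a polynomial in `log x` -/
  log_finite : ∀ (x₁ : W₁) (x₂ : W₂) (n : ℂ), ∃ K : ℕ, ∀ k : ℕ, K < k → 𝒴 x₁ x₂ n k = 0
  lower_truncation : ∀ (x₁ : W₁) (x₂ : W₂) (n : ℂ) (k : ℕ),
    ∃ N : ℕ, ∀ l : ℕ, N ≤ l → 𝒴 x₁ x₂ (n + l) k = 0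
  duality : ∀ (a : V) (x₁ : W₁) (x₂ : W₂) (φ : W₃.gdual),
    ∃ (f : MultiFun 2 (Mspace 2)) (F : (Fin 2 → ℂ) → ℂ),
      f.IsBranchOn (Mspace 2) cutsM2 F ∧ ∀ z₁ z₂ : ℂ,
      (‖z₂‖ < ‖z₁‖ → 0 < ‖z₂‖ →
        Summable (fun r : ℂ => W₃.pairing φ (W₃.eval (lBranch 0 z₁)
          (W₃.Y a (W₃.eval (lBranch 0 z₂) (𝒴 x₁ x₂) r)))) ∧
        (|argPos (z₁ - z₂) - argPos z₁| < Real.pi / 2 →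
          ∑' r : ℂ, W₃.pairing φ (W₃.eval (lBranch 0 z₁)
            (W₃.Y a (W₃.eval (lBranch 0 z₂) (𝒴 x₁ x₂) r))) = F ![z₁, z₂])) ∧
      (‖z₁‖ < ‖z₂‖ → 0 < ‖z₁‖ →
        Summable (fun r : ℂ => W₃.pairing φ (W₃.eval (lBranch 0 z₂)
          (𝒴 x₁ (W₂.eval (lBranch 0 z₁) (W₂.Y a x₂) r)))) ∧
        (-(3 * Real.pi / 2) < argPos (z₁ - z₂) - argPos z₂ →
          argPos (z₁ - z₂) - argPos z₂ < -(Real.pi / 2) →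
          ∑' r : ℂ, W₃.pairing φ (W₃.eval (lBranch 0 z₂)
            (𝒴 x₁ (W₂.eval (lBranch 0 z₁) (W₂.Y a x₂) r))) = F ![z₁, z₂])) ∧
      (‖z₁ - z₂‖ < ‖z₂‖ → 0 < ‖z₁ - z₂‖ →
        Summable (fun r : ℂ => W₃.pairing φ (W₃.eval (lBranch 0 z₂)
          (𝒴 (W₁.eval (lBranch 0 (z₁ - z₂)) (W₁.Y a x₁) r) x₂))) ∧
        (|argPos z₁ - argPos z₂| < Real.pi / 2 →
          ∑' r : ℂ, W₃.pairing φ (W₃.eval (lBranch 0 z₂)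
            (𝒴 (W₁.eval (lBranch 0 (z₁ - z₂)) (W₁.Y a x₁) r) x₂)) = F ![z₁, z₂]))
  products : ∀ (r : ℕ), 2 ≤ r → ∀ (a : Fin r → V) (x₁ : W₁) (x₂ : W₂) (φ : W₃.gdual),
    (∀ z : Fin (r + 1) → ℂ, StrictAnti (fun i => ‖z i‖) → 0 < ‖z (Fin.last r)‖ →
      Summable fun n : Fin r → ℂ => W₃.pairing φ
        (nestedProd W₃ r a (Fin.init z) n (W₃.eval (lBranch 0 (z (Fin.last r))) (𝒴 x₁ x₂)))) ∧
    ∃ f : MultiFun (r + 1) (Mspace (r + 1)),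
      f.IsBranchOn {z | StrictAnti (fun i => ‖z i‖) ∧ 0 < ‖z (Fin.last r)‖} (fun i z => z i)
        (fun z => ∑' n : Fin r → ℂ, W₃.pairing φ (nestedProd W₃ r a (Fin.init z) n
          (W₃.eval (lBranch 0 (z (Fin.last r))) (𝒴 x₁ x₂)))) ∧
      ∀ (A : GL (Fin (r + 1)) ℂ) (β : Fin (r + 1) → ℂ) (δ : Fin (r + 1) → Bool),
        MultiFun.IsComponentIsolated (Mspace (r + 1)) A β δ → f.IsRegularSingularity A β δ
  L_neg_one_derivative : ∀ (x₁ : W₁) (x₂ : W₂) (n : ℂ) (k : ℕ),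
    𝒴 (W₁.L (-1) x₁) x₂ n k =
      -n • 𝒴 x₁ x₂ (n - 1) k + ((k : ℂ) + 1) • 𝒴 x₁ x₂ (n - 1) (k + 1)

/-- `I` is a twisted `P(z)`-intertwining map of type `(W₃; W₁ W₂)`. -/
def IsPzIntertwiningMap (z : ℂ) (W₁ W₂ W₃ : VData.{u, w} 𝒱)
    (I : W₁ ⊗[ℂ] W₂ →ₗ[ℂ] W₃.Completion) : Prop :=
  ∃ 𝒴 : W₁ →ₗ[ℂ] W₂ →ₗ[ℂ] LogSeries W₃, IsTwistedIntertwiningOperator W₁ W₂ W₃ 𝒴 ∧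
    ∀ (x₁ : W₁) (x₂ : W₂), I (x₁ ⊗ₜ[ℂ] x₂) = W₃.eval (lBranch 0 z) (𝒴 x₁ x₂)

end Intertwining

/-! ## Categories of twisted modules and tensor products -/

section Categories

variable {V : Type u} [AddCommGroup V] [Module ℂ V] {𝒱 : VOA V}

/-- A full category of twisted modules, given by its objects: `C g W` means that `W` is a
`g`-twisted module in the category. -/
abbrev TwClass (𝒱 : VOA V) := (V ≃ₗ[ℂ] V) → VData.{u, w} 𝒱 → Prop

/-- A category of twisted modules with `G`-actions, given by its objects. -/
abbrev TwClassWithAction (𝒱 : VOA V) (G : Subgroup (V ≃ₗ[ℂ] V)) :=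
  (g : G) → (W : VData.{u, w} 𝒱) → Representation ℂ G W → Prop

/-- `C` is a category of `g`-twisted `V`-modules without `g`-actions for `g ∈ G`. -/
def IsCategoryWithoutAction (G : Subgroup (V ≃ₗ[ℂ] V)) (C : TwClass.{u, w} 𝒱) : Prop :=
  ∀ g W, C g W → g ∈ G ∧ IsTwistedModule g W

/-- `C` is a category of `g`-twisted `V`-modules with actions of `G` for `g ∈ G`. -/
def IsCategoryWithAction (G : Subgroup (V ≃ₗ[ℂ] V)) (C : TwClassWithAction.{u, w} 𝒱 G) : Prop :=
  ∀ g W ρ, C g W ρ → IsTwistedModule (g : V ≃ₗ[ℂ] V) W ∧ IsGAction g W ρ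

/-- The underlying modules of the objects of a category of modules with `G`-actions: those that
carry an action with which they are objects. Module maps and intertwining maps only involve these
underlying modules. -/
def TwClassWithAction.underlying {G : Subgroup (V ≃ₗ[ℂ] V)} (C : TwClassWithAction.{u, w} 𝒱 G) :
    TwClass.{u, w} 𝒱 :=
  fun g W => ∃ (hg : g ∈ G) (ρ : Representation ℂ G W), C ⟨g, hg⟩ W ρ

/-- `(P, B)` is a `P(z)`-product of `W₁` and `W₂` in `C`. -/
def IsPzProduct (C : TwClass.{u, w} 𝒱) (z : ℂ) (g₁ g₂ : V ≃ₗ[ℂ] V) (W₁ W₂ P : VData.{u, w} 𝒱)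
    (B : W₁ ⊗[ℂ] W₂ →ₗ[ℂ] P.Completion) : Prop :=
  C (g₁ * g₂) P ∧ IsPzIntertwiningMap z W₁ W₂ P B

/-- `(P, B)` is a `P(z)`-tensor product of `W₁` and `W₂` in `C`. The natural extension of `f` to the
completions sends `(y_n)` to `(f y_n)`. -/
def IsPzTensorProduct (C : TwClass.{u, w} 𝒱) (z : ℂ) (g₁ g₂ : V ≃ₗ[ℂ] V)
    (W₁ W₂ P : VData.{u, w} 𝒱) (B : W₁ ⊗[ℂ] W₂ →ₗ[ℂ] P.Completion) : Prop :=
  IsPzProduct C z g₁ g₂ W₁ W₂ P B ∧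
  ∀ (W₃ : VData.{u, w} 𝒱) (I : W₁ ⊗[ℂ] W₂ →ₗ[ℂ] W₃.Completion),
    IsPzProduct C z g₁ g₂ W₁ W₂ W₃ I →
    ∃! f : P →ₗ[ℂ] W₃, IsModuleMap P W₃ f ∧
      ∀ (t : W₁ ⊗[ℂ] W₂) (n : ℂ), f (B t n : P) = (I t n : W₃)

/-- `λ_{I, w₃'}`, the functional `t ↦ ⟨w₃', I(t)⟩`. -/
def lamFun {W₁ W₂ W₃ : VData.{u, w} 𝒱} (I : W₁ ⊗[ℂ] W₂ →ₗ[ℂ] W₃.Completion) (φ : W₃.gdual) :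
    Module.Dual ℂ (W₁ ⊗[ℂ] W₂) :=
  (W₃.pairing φ).comp I

variable (C : TwClass.{u, w} 𝒱) (z : ℂ) (g₁ g₂ : V ≃ₗ[ℂ] V) (W₁ W₂ : VData.{u, w} 𝒱)

/-- The underlying space of `W₁ ⊠̃ W₂`: the span of all `λ_{I, w₃'}`. -/
def hboxSpace : Submodule ℂ (Module.Dual ℂ (W₁ ⊗[ℂ] W₂)) :=
  Submodule.span ℂ {y | ∃ (W₃ : VData.{u, w} 𝒱) (I : W₁ ⊗[ℂ] W₂ →ₗ[ℂ] W₃.Completion)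
    (φ : W₃.gdual), IsPzProduct C z g₁ g₂ W₁ W₂ W₃ I ∧ y = lamFun I φ}

/-- The span of all `λ_{I, w₃'}` with `w₃'` of weight `n`. -/
def hboxWtSpan (n : ℂ) : Submodule ℂ (Module.Dual ℂ (W₁ ⊗[ℂ] W₂)) :=
  Submodule.span ℂ {y | ∃ (W₃ : VData.{u, w} 𝒱) (I : W₁ ⊗[ℂ] W₂ →ₗ[ℂ] W₃.Completion)
    (φ : W₃.gdual), IsPzProduct C z g₁ g₂ W₁ W₂ W₃ I ∧ φ ∈ W₃.contra.wt n ∧ y = lamFun I φ}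

theorem hboxWtSpan_le (n : ℂ) : hboxWtSpan C z g₁ g₂ W₁ W₂ n ≤ hboxSpace C z g₁ g₂ W₁ W₂ := by
  refine Submodule.span_mono ?_
  rintro y ⟨W₃, I, φ, h, _, rfl⟩
  exact ⟨W₃, I, φ, h, rfl⟩

/-- The defining property `Y(v, x) λ_{I, w₃'} = λ_{I, Y'(v, x) w₃'}` of the vertex operator map of
`W₁ ⊠̃ W₂`. It determines the map, since the `λ_{I, w₃'}` span. -/
def IsHboxY (T : V →ₗ[ℂ] hboxSpace C z g₁ g₂ W₁ W₂ →ₗ[ℂ]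
    LogSeries (hboxSpace C z g₁ g₂ W₁ W₂)) : Prop :=
  ∀ (W₃ : VData.{u, w} 𝒱) (I : W₁ ⊗[ℂ] W₂ →ₗ[ℂ] W₃.Completion) (φ : W₃.gdual),
    IsPzProduct C z g₁ g₂ W₁ W₂ W₃ I →
    ∀ y : hboxSpace C z g₁ g₂ W₁ W₂, (y : Module.Dual ℂ (W₁ ⊗[ℂ] W₂)) = lamFun I φ →
    ∀ (v : V) (n : ℂ) (k : ℕ),
      (T v y n k : Module.Dual ℂ (W₁ ⊗[ℂ] W₂)) = lamFun I (W₃.contraY v φ n k)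

open Classical in
/-- The vertex operator map of `W₁ ⊠̃ W₂`. (The value `0` where no map has the defining property is
never that of a nonzero twisted module, by the identity property.) -/
def hboxY : V →ₗ[ℂ] hboxSpace C z g₁ g₂ W₁ W₂ →ₗ[ℂ] LogSeries (hboxSpace C z g₁ g₂ W₁ W₂) :=
  if h : ∃ T, IsHboxY C z g₁ g₂ W₁ W₂ T then Classical.choose h else 0

/-- `W₁ ⊠̃_{P(z)} W₂`. -/
def hbox : VData.{u, w} 𝒱 where
  carrier := hboxSpace C z g₁ g₂ W₁ W₂
  wt n := (hboxWtSpan C z g₁ g₂ W₁ W₂ n).comap (hboxSpace C z g₁ g₂ W₁ W₂).subtype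
  Y := hboxY C z g₁ g₂ W₁ W₂
  homog := by
    intro h v hv m x hx n k
    unfold hboxY
    split_ifs with hT
    · have hT' := Classical.choose_spec hT
      set T := Classical.choose hT
      have key : ∀ y (hy : y ∈ hboxWtSpan C z g₁ g₂ W₁ W₂ m),
          (T v ⟨y, hboxWtSpan_le C z g₁ g₂ W₁ W₂ m hy⟩ n k : Module.Dual ℂ (W₁ ⊗[ℂ] W₂)) ∈
            hboxWtSpan C z g₁ g₂ W₁ W₂ (m + h - n - 1) := by
        intro y hy
        induction hy using Submodule.span_induction with
        | mem y hy =>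
          obtain ⟨W₃, I, φ, hI, hφ, rfl⟩ := hy
          rw [hT' W₃ I φ hI _ rfl v n k]
          exact Submodule.subset_span
            ⟨W₃, I, _, hI, W₃.contra.homog h v hv m φ hφ n k, rfl⟩
        | zero =>
          have : (T v ⟨0, hboxWtSpan_le C z g₁ g₂ W₁ W₂ m (zero_mem _)⟩ n k) = 0 := by
            change T v 0 n k = 0
            simp
          rw [this]; exact zero_mem _
        | add a b ha hb iha ihb =>
          have : T v ⟨a + b, hboxWtSpan_le C z g₁ g₂ W₁ W₂ m (add_mem ha hb)⟩ n k =
              T v ⟨a, hboxWtSpan_le C z g₁ g₂ W₁ W₂ m ha⟩ n k +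
              T v ⟨b, hboxWtSpan_le C z g₁ g₂ W₁ W₂ m hb⟩ n k := by
            rw [← Pi.add_apply, ← Pi.add_apply, ← map_add]; rfl
          rw [this]; exact add_mem iha ihb
        | smul c a ha iha =>
          have : T v ⟨c • a, hboxWtSpan_le C z g₁ g₂ W₁ W₂ m (Submodule.smul_mem _ c ha)⟩ n k =
              c • T v ⟨a, hboxWtSpan_le C z g₁ g₂ W₁ W₂ m ha⟩ n k := by
            rw [← Pi.smul_apply, ← Pi.smul_apply, ← map_smul]; rfl
          rw [this]; exact Submodule.smul_mem _ c iha
      exact key x hx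
    · exact zero_mem _

/-- The assumption on the category `C`: closure under `⊠̃_{P(z)}`, closure under contragredients, and
equivalence of each object with its double contragredient. -/
structure TensorAssumption (C : TwClass.{u, w} 𝒱) (z : ℂ) : Prop where
  hbox_mem : ∀ (g₁ g₂ : V ≃ₗ[ℂ] V) (W₁ W₂ : VData.{u, w} 𝒱), C g₁ W₁ → C g₂ W₂ →
    C (g₁ * g₂)⁻¹ (hbox C z g₁ g₂ W₁ W₂)
  contra_mem : ∀ (g : V ≃ₗ[ℂ] V) (W : VData.{u, w} 𝒱), C g W → C g⁻¹ W.contra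
  double_contra : ∀ (g : V ≃ₗ[ℂ] V) (W : VData.{u, w} 𝒱), C g W →
    IsEquivalent W W.contra.contra

/-- `W₁ ⊠_{P(z)} W₂`, the contragredient of `W₁ ⊠̃_{P(z)} W₂`. -/
def boxProd : VData.{u, w} 𝒱 := (hbox C z g₁ g₂ W₁ W₂).contra

/-- The functional `λ ↦ (π_n λ)(t)` on `W₁ ⊠̃ W₂`. -/
def boxFun (n : ℂ) (t : W₁ ⊗[ℂ] W₂) : Module.Dual ℂ (hbox C z g₁ g₂ W₁ W₂) :=
  ((Module.Dual.eval ℂ (W₁ ⊗[ℂ] W₂) t).comp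
    ((hboxSpace C z g₁ g₂ W₁ W₂).subtype.comp ((hbox C z g₁ g₂ W₁ W₂).wt n).subtype)).comp
      ((hbox C z g₁ g₂ W₁ W₂).proj n)

theorem boxFun_mem (n : ℂ) (t : W₁ ⊗[ℂ] W₂) :
    boxFun C z g₁ g₂ W₁ W₂ n t ∈ (hbox C z g₁ g₂ W₁ W₂).dualWt n := by
  intro m hm x hx
  have := (hbox C z g₁ g₂ W₁ W₂).proj_of_ne hm x hx
  rw [boxFun, LinearMap.comp_apply, this, map_zero]

/-- The canonical map `⊠_{P(z)}` from `W₁ ⊗ W₂` to the completion of `W₁ ⊠_{P(z)} W₂`: its component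
of weight `n` is the functional `λ ↦ λ(t)` on the weight space of `W₁ ⊠̃_{P(z)} W₂` of weight `n`, so
that `⟨λ, ⊠_{P(z)}(t)⟩ = λ(t)` for all `λ`. -/
def boxMap : W₁ ⊗[ℂ] W₂ →ₗ[ℂ] (boxProd C z g₁ g₂ W₁ W₂).Completion where
  toFun t n := ⟨⟨boxFun C z g₁ g₂ W₁ W₂ n t,
    Submodule.mem_iSup_of_mem n (boxFun_mem C z g₁ g₂ W₁ W₂ n t)⟩,
    boxFun_mem C z g₁ g₂ W₁ W₂ n t⟩
  map_add' s t := by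
    funext n
    apply Subtype.ext
    apply Subtype.ext
    apply LinearMap.ext
    intro x
    simp only [boxFun, map_add]
    rfl
  map_smul' c t := by
    funext n
    apply Subtype.ext
    apply Subtype.ext
    apply LinearMap.ext
    intro x
    simp only [boxFun, map_smul]
    rfl

end Categories

end

/-! Write X for W₁ ⊠̃ W₂ and P = X' for the candidate tensor product. For a product (W₃, I), the map
φ ↦ λ_{I,φ} from W₃' to X is a weight-preserving module map (`lamMap_isGraded`,
`lamMap_isModuleMap`). If W₃ has finite-dimensional weight spaces, this map has a transpose f : P →
W₃ (`exists_transpose`), and f is a module map because the contragredient formula is an involution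
(`sum_contraY_apply`). Pairing with φ gives φ(f(⊠(t))) = λ_{I,φ}(t) = φ(I(t)), which is the required
factorization (`IsBoxLift.map_boxMap`). It is unique because X_[n] is a finite-dimensional space of
functionals on W₁ ⊗ W₂, so every functional on X_[n] is evaluation at some t (`boxProd_hom_ext`).

The finiteness comes from the double contragredient (`finiteDimensional_wt`). Module maps preserve
weights, since weight spaces are generalized eigenspaces of L(0). An infinite-dimensional space has
strictly smaller dimension than its dual, so an isomorphism W ≅ W'' forces each W_[n] to be
finite-dimensional.

It remains to see that ⊠ itself comes from an intertwining operator with values in P. A coefficient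
in P must be a functional on one weight space of X. For λ = λ_{I,φ}, the numbers λ(L(-1)^j w₁ ⊗ w₂)
are the derivatives at z of a single term x^{-n-1} p(log x), and they determine the polynomial p.
Thus p depends only on λ, and linearly; its coefficients are the wanted functionals
(`exists_isBoxCoeff_of_mem`, `exists_boxOperator`). Since X_[m] is finite-dimensional, the degree of
p is bounded.

Algebraic axioms in P are checked after applying all the lifts f, which jointly separate points
(`boxProd_ext`). For the analytic axioms, every functional in P' is a finite sum of functionals φ ∘
f (`boxProd_gdual_induction`). For φ ∘ f the series are literally those of the operator in W₃
(`DualityAt.pullback`, `ProductsAt.pullback`), so only closure under sums is left (`DualityAt.add`,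
`ProductsAt.add`).

This closure is where multivaluedness matters: a sum of multivalued functions makes sense only after
their germs are matched at a common base point. On a cut region, the branches can be matched if
every point is reached by a path that avoids the cuts before its end (`exists_isBranchOn_add`). For
regular singularities, a branch of a sum near the singularity must be split into branches of the
summands (`exists_isBranchOn_split`). Punctured polydiscs become convex in logarithmic coordinates,
and continuation along segments from one point then yields a single-valued branch. -/

/-! ## Analytic continuation along paths -/

section Continuation

variable {n : ℕ}

/-- A family of germs along a path that is locally constant. -/
structure IsGermFamily (γ : C(unitInterval, Fin n → ℂ)) (Φ : unitInterval → (Fin n → ℂ) → ℂ) :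
    Prop where
  analyticAt : ∀ t, AnalyticAt ℂ (Φ t) (γ t)
  locally_const : ∀ t, ∀ᶠ s in 𝓝 t, Φ s =ᶠ[𝓝 (γ s)] Φ t

theorem isContinuationAlong_iff {γ : C(unitInterval, Fin n → ℂ)} {φ ψ : (Fin n → ℂ) → ℂ} :
    IsContinuationAlong γ φ ψ ↔
      ∃ Φ, IsGermFamily γ Φ ∧ Φ 0 =ᶠ[𝓝 (γ 0)] φ ∧ Φ 1 =ᶠ[𝓝 (γ 1)] ψ :=
  ⟨fun ⟨Φ, h1, h2, h3, h4⟩ => ⟨Φ, ⟨h1, h2⟩, h3, h4⟩,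
    fun ⟨Φ, ⟨h1, h2⟩, h3, h4⟩ => ⟨Φ, h1, h2, h3, h4⟩⟩

/-- On a ball where both functions are analytic, the identity theorem spreads equality of germs at
one point to the whole ball. Equality of germs is therefore locally constant in the base point. -/
theorem AnalyticAt.eventuallyEq_iff_near {φ ψ : (Fin n → ℂ) → ℂ} {z : Fin n → ℂ}
    (hφ : AnalyticAt ℂ φ z) (hψ : AnalyticAt ℂ ψ z) :
    ∀ᶠ y in 𝓝 z, (φ =ᶠ[𝓝 y] ψ ↔ φ =ᶠ[𝓝 z] ψ) := by
  by_cases h : φ =ᶠ[𝓝 z] ψ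
  · filter_upwards [h.eventuallyEq_nhds] with y hy
    exact ⟨fun _ => h, fun _ => hy⟩
  obtain ⟨r, hr, hr'⟩ := Metric.eventually_nhds_iff_ball.mp
    (hφ.eventually_analyticAt.and hψ.eventually_analyticAt)
  filter_upwards [Metric.ball_mem_nhds z hr] with y hy
  refine ⟨fun h2 => ?_, fun h2 => absurd h2 h⟩
  have h1 := AnalyticOnNhd.eqOn_of_preconnected_of_eventuallyEq (f := φ) (g := ψ)
    (fun x hx => (hr' x hx).1) (fun x hx => (hr' x hx).2)
    (convex_ball z r).isPreconnected hy h2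
  exact h1.eventuallyEq_of_mem (Metric.ball_mem_nhds z hr)

/-- Uniqueness of analytic continuation. -/
theorem IsGermFamily.eventuallyEq {γ : C(unitInterval, Fin n → ℂ)}
    {Φ Ψ : unitInterval → (Fin n → ℂ) → ℂ} (hΦ : IsGermFamily γ Φ) (hΨ : IsGermFamily γ Ψ)
    (h0 : Φ 0 =ᶠ[𝓝 (γ 0)] Ψ 0) (t : unitInterval) : Φ t =ᶠ[𝓝 (γ t)] Ψ t := by
  -- Agreement of the two families is a locally constant proposition on the connected interval, so
  -- it propagates from 0.
  have hloc : IsLocallyConstant fun t => Φ t =ᶠ[𝓝 (γ t)] Ψ t := by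
    rw [IsLocallyConstant.iff_eventually_eq]
    intro t
    filter_upwards [hΦ.locally_const t, hΨ.locally_const t, γ.continuous.continuousAt.eventually
      ((hΦ.analyticAt t).eventuallyEq_iff_near (hΨ.analyticAt t))] with s h1 h2 h3
    rw [← h3]
    exact propext ⟨fun h => h1.symm.trans (h.trans h2), fun h => h1.trans (h.trans h2.symm)⟩
  have h1 := hloc.apply_eq_of_preconnectedSpace t 0
  simp only [h0] at h1
  exact of_eq_true h1

theorem IsGermFamily.comp {γ : C(unitInterval, Fin n → ℂ)} {Φ : unitInterval → (Fin n → ℂ) → ℂ}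
    (hΦ : IsGermFamily γ Φ) (h : C(unitInterval, unitInterval)) :
    IsGermFamily (γ.comp h) (Φ ∘ h) where
  analyticAt t := hΦ.analyticAt (h t)
  locally_const t := h.continuous.continuousAt.eventually (hΦ.locally_const (h t))

theorem IsGermFamily.add {γ : C(unitInterval, Fin n → ℂ)} {Φ Ψ : unitInterval → (Fin n → ℂ) → ℂ}
    (hΦ : IsGermFamily γ Φ) (hΨ : IsGermFamily γ Ψ) : IsGermFamily γ (Φ + Ψ) where
  analyticAt t := (hΦ.analyticAt t).add (hΨ.analyticAt t)
  locally_const t := by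
    filter_upwards [hΦ.locally_const t, hΨ.locally_const t] with s h1 h2 using h1.add h2

/-- Pulling a family of germs back along an analytic map. -/
theorem IsGermFamily.comp_analytic {γ δ : C(unitInterval, Fin n → ℂ)}
    {Φ : unitInterval → (Fin n → ℂ) → ℂ} (hΦ : IsGermFamily γ Φ) {E : (Fin n → ℂ) → Fin n → ℂ}
    (hE : ∀ x, AnalyticAt ℂ E x) (hδ : ∀ t, E (δ t) = γ t) :
    IsGermFamily δ fun t => Φ t ∘ E where
  analyticAt t := AnalyticAt.comp (by rw [hδ]; exact hΦ.analyticAt t) (hE _)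
  locally_const t := by
    filter_upwards [hΦ.locally_const t] with s h
    rw [← hδ] at h
    exact h.comp_tendsto (hE _).continuousAt

namespace IsContinuationAlong

variable {γ : C(unitInterval, Fin n → ℂ)} {φ φ' ψ ψ' : (Fin n → ℂ) → ℂ}

theorem analyticAt_right (h : IsContinuationAlong γ φ ψ) : AnalyticAt ℂ ψ (γ 1) := by
  obtain ⟨Φ, h1, -, -, h4⟩ := h
  exact (h1 1).congr h4

theorem congr (h : IsContinuationAlong γ φ ψ) (hφ : φ =ᶠ[𝓝 (γ 0)] φ')
    (hψ : ψ =ᶠ[𝓝 (γ 1)] ψ') : IsContinuationAlong γ φ' ψ' := by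
  obtain ⟨Φ, h1, h2, h3, h4⟩ := h
  exact ⟨Φ, h1, h2, h3.trans hφ, h4.trans hψ⟩

theorem unique (h : IsContinuationAlong γ φ ψ) (h' : IsContinuationAlong γ φ' ψ')
    (hφ : φ =ᶠ[𝓝 (γ 0)] φ') : ψ =ᶠ[𝓝 (γ 1)] ψ' := by
  obtain ⟨Φ, hΦ, h1, h2⟩ := isContinuationAlong_iff.mp h
  obtain ⟨Ψ, hΨ, h3, h4⟩ := isContinuationAlong_iff.mp h'
  exact h2.symm.trans ((hΦ.eventuallyEq hΨ (h1.trans (hφ.trans h3.symm)) 1).trans h4)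

theorem add (h : IsContinuationAlong γ φ ψ) (h' : IsContinuationAlong γ φ' ψ') :
    IsContinuationAlong γ (φ + φ') (ψ + ψ') := by
  obtain ⟨Φ, hΦ, h1, h2⟩ := isContinuationAlong_iff.mp h
  obtain ⟨Ψ, hΨ, h3, h4⟩ := isContinuationAlong_iff.mp h'
  exact isContinuationAlong_iff.mpr ⟨_, hΦ.add hΨ, h1.add h3, h2.add h4⟩

theorem zero (γ : C(unitInterval, Fin n → ℂ)) : IsContinuationAlong γ 0 0 :=
  ⟨fun _ => 0, fun _ => analyticAt_const, fun _ => Filter.Eventually.of_forall fun _ => .rfl,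
    .rfl, .rfl⟩

theorem symm (h : IsContinuationAlong γ φ ψ) :
    IsContinuationAlong (γ.comp ⟨unitInterval.symm, unitInterval.continuous_symm⟩) ψ φ := by
  obtain ⟨Φ, hΦ, h1, h2⟩ := isContinuationAlong_iff.mp h
  refine isContinuationAlong_iff.mpr ⟨_, hΦ.comp _, ?_, ?_⟩
  · simpa using h2
  · simpa using h1

theorem comp_analytic (h : IsContinuationAlong γ φ ψ) {δ : C(unitInterval, Fin n → ℂ)}
    {E : (Fin n → ℂ) → Fin n → ℂ} (hE : ∀ x, AnalyticAt ℂ E x) (hδ : ∀ t, E (δ t) = γ t) :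
    IsContinuationAlong δ (φ ∘ E) (ψ ∘ E) := by
  obtain ⟨Φ, hΦ, h1, h2⟩ := isContinuationAlong_iff.mp h
  refine isContinuationAlong_iff.mpr ⟨_, hΦ.comp_analytic hE hδ, ?_, ?_⟩
  · rw [← hδ] at h1; exact h1.comp_tendsto (hE _).continuousAt
  · rw [← hδ] at h2; exact h2.comp_tendsto (hE _).continuousAt

end IsContinuationAlong

/-! ### Concatenation of paths -/

/-- The parameter `2 t`, cut off at `1`. -/
noncomputable def paramDouble : C(unitInterval, unitInterval) where
  toFun t := Set.projIcc 0 1 zero_le_one (2 * (t : ℝ))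
  continuous_toFun := by fun_prop

/-- The parameter `2 t - 1`, cut off at `0`. -/
noncomputable def paramDoubleSub : C(unitInterval, unitInterval) where
  toFun t := Set.projIcc 0 1 zero_le_one (2 * (t : ℝ) - 1)
  continuous_toFun := by fun_prop

/-- The parameter `t / 2`. -/
noncomputable def paramHalf : C(unitInterval, unitInterval) where
  toFun t := ⟨(t : ℝ) / 2, by have := t.2.1; have := t.2.2; constructor <;> linarith⟩
  continuous_toFun := by fun_prop

/-- The parameter `(t + 1) / 2`. -/
noncomputable def paramHalfAdd : C(unitInterval, unitInterval) where
  toFun t := ⟨((t : ℝ) + 1) / 2, by have := t.2.1; have := t.2.2; constructor <;> linarith⟩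
  continuous_toFun := by fun_prop

theorem paramDouble_of_half_le {t : unitInterval} (ht : 1 / 2 ≤ (t : ℝ)) : paramDouble t = 1 :=
  Set.projIcc_of_right_le zero_le_one (by linarith)

theorem paramDoubleSub_of_le_half {t : unitInterval} (ht : (t : ℝ) ≤ 1 / 2) :
    paramDoubleSub t = 0 :=
  Set.projIcc_of_le_left zero_le_one (by linarith)

theorem paramDouble_paramHalf (t : unitInterval) : paramDouble (paramHalf t) = t := by
  have : (2 * ((t : ℝ) / 2)) = t := by ring
  change Set.projIcc 0 1 zero_le_one (2 * ((t : ℝ) / 2)) = t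
  rw [this, Set.projIcc_val]

theorem paramDoubleSub_paramHalfAdd (t : unitInterval) : paramDoubleSub (paramHalfAdd t) = t := by
  have : (2 * (((t : ℝ) + 1) / 2) - 1) = t := by ring
  change Set.projIcc 0 1 zero_le_one (2 * (((t : ℝ) + 1) / 2) - 1) = t
  rw [this, Set.projIcc_val]

/-- The path `γ` followed by the path `γ'`. -/
noncomputable def concatPath (γ γ' : C(unitInterval, Fin n → ℂ)) (h : γ 1 = γ' 0) :
    C(unitInterval, Fin n → ℂ) where
  toFun t := if (t : ℝ) ≤ 1 / 2 then γ (paramDouble t) else γ' (paramDoubleSub t)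
  continuous_toFun := by
    refine Continuous.if_le (by fun_prop) (by fun_prop) (by fun_prop) (by fun_prop) fun t ht => ?_
    rw [paramDouble_of_half_le ht.ge, paramDoubleSub_of_le_half ht.le, h]

variable {γ γ' : C(unitInterval, Fin n → ℂ)} {h : γ 1 = γ' 0}

theorem concatPath_of_le {t : unitInterval} (ht : (t : ℝ) ≤ 1 / 2) :
    concatPath γ γ' h t = γ (paramDouble t) := if_pos ht

theorem concatPath_of_ge {t : unitInterval} (ht : 1 / 2 ≤ (t : ℝ)) :
    concatPath γ γ' h t = γ' (paramDoubleSub t) := by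
  rcases ht.eq_or_lt with ht' | ht'
  · rw [concatPath_of_le ht'.ge, paramDouble_of_half_le ht, paramDoubleSub_of_le_half ht'.ge, h]
  · exact if_neg (not_le.mpr ht')

theorem concatPath_zero : concatPath γ γ' h 0 = γ 0 := by
  rw [concatPath_of_le (by norm_num)]
  congr 1
  exact Set.projIcc_of_le_left zero_le_one (by norm_num)

theorem concatPath_one : concatPath γ γ' h 1 = γ' 1 := by
  rw [concatPath_of_ge (by norm_num)]
  congr 1
  exact Set.projIcc_of_right_le zero_le_one (by norm_num)

theorem concatPath_mem {S : Set (Fin n → ℂ)} (hγ : ∀ t, γ t ∈ S) (hγ' : ∀ t, γ' t ∈ S)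
    (t : unitInterval) : concatPath γ γ' h t ∈ S := by
  rcases le_total (t : ℝ) (1 / 2) with ht | ht
  · rw [concatPath_of_le ht]; exact hγ _
  · rw [concatPath_of_ge ht]; exact hγ' _

theorem concatPath_comp_half : (concatPath γ γ' h).comp paramHalf = γ := by
  ext1 t
  rw [ContinuousMap.comp_apply, concatPath_of_le, paramDouble_paramHalf]
  have := t.2.2
  change (t : ℝ) / 2 ≤ 1 / 2
  linarith

theorem concatPath_comp_halfAdd : (concatPath γ γ' h).comp paramHalfAdd = γ' := by
  ext1 t
  rw [ContinuousMap.comp_apply, concatPath_of_ge, paramDoubleSub_paramHalfAdd]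
  have := t.2.1
  change 1 / 2 ≤ ((t : ℝ) + 1) / 2
  linarith

theorem IsGermFamily.concat {Φ Ψ : unitInterval → (Fin n → ℂ) → ℂ} (hΦ : IsGermFamily γ Φ)
    (hΨ : IsGermFamily γ' Ψ) (hΦΨ : Φ 1 =ᶠ[𝓝 (γ 1)] Ψ 0) :
    IsGermFamily (concatPath γ γ' h) fun t =>
      if (t : ℝ) ≤ 1 / 2 then Φ (paramDouble t) else Ψ (paramDoubleSub t) where
  analyticAt t := by
    by_cases ht : (t : ℝ) ≤ 1 / 2
    · simp only [if_pos ht, concatPath_of_le ht]; exact hΦ.analyticAt _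
    · simp only [if_neg ht, concatPath_of_ge (not_le.mp ht).le]; exact hΨ.analyticAt _
  locally_const t := by
    have h1 := (hΦ.comp paramDouble).locally_const t
    have h2 := (hΨ.comp paramDoubleSub).locally_const t
    rcases lt_trichotomy (t : ℝ) (1 / 2) with ht | ht | ht
    · filter_upwards [h1, continuous_subtype_val.continuousAt.eventually_lt
        continuousAt_const ht] with s hs hs'
      simp only [if_pos ht.le, if_pos hs'.le, concatPath_of_le hs'.le]
      exact hs
    -- At the junction, parameters to the right carry germs of `Ψ` while the reference germ is `Φ
    -- 1`. These two germs agree also at nearby points of the second path.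
    · have h3 : ∀ᶠ s in 𝓝 t, Φ 1 =ᶠ[𝓝 (γ' (paramDoubleSub s))] Ψ 0 := by
        have hc : ContinuousAt (fun s => γ' (paramDoubleSub s)) t := by fun_prop
        refine hc.eventually (p := fun y => Φ 1 =ᶠ[𝓝 y] Ψ 0) ?_
        change ∀ᶠ y in 𝓝 (γ' (paramDoubleSub t)), Φ 1 =ᶠ[𝓝 y] Ψ 0
        rw [paramDoubleSub_of_le_half ht.le, ← h]
        exact hΦΨ.eventuallyEq_nhds
      filter_upwards [h1, h2, h3] with s hs1 hs2 hs3
      simp only [if_pos ht.le]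
      by_cases hs : (s : ℝ) ≤ 1 / 2
      · simp only [if_pos hs, concatPath_of_le hs]; exact hs1
      · simp only [if_neg hs, concatPath_of_ge (not_le.mp hs).le]
        simp only [Function.comp_apply, ContinuousMap.comp_apply,
          paramDoubleSub_of_le_half ht.le] at hs2
        rw [paramDouble_of_half_le ht.ge]
        exact hs2.trans hs3.symm
    · filter_upwards [h2, continuousAt_const.eventually_lt
        continuous_subtype_val.continuousAt ht] with s hs hs'
      simp only [if_neg (not_le.mpr ht), if_neg (not_le.mpr hs'), concatPath_of_ge hs'.le]
      exact hs

theorem IsContinuationAlong.concat {φ ψ χ : (Fin n → ℂ) → ℂ} (h1 : IsContinuationAlong γ φ ψ)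
    (h2 : IsContinuationAlong γ' ψ χ) : IsContinuationAlong (concatPath γ γ' h) φ χ := by
  obtain ⟨Φ, hΦ, h3, h4⟩ := isContinuationAlong_iff.mp h1
  obtain ⟨Ψ, hΨ, h5, h6⟩ := isContinuationAlong_iff.mp h2
  rw [← h] at h5
  refine isContinuationAlong_iff.mpr ⟨_, hΦ.concat hΨ (h4.trans h5.symm), ?_, ?_⟩
  · rw [concatPath_zero, if_pos (by norm_num)]
    have : paramDouble 0 = 0 := Set.projIcc_of_le_left zero_le_one (by norm_num)
    rw [this]; exact h3
  · rw [concatPath_one, if_neg (by norm_num)]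
    have : paramDoubleSub 1 = 1 := Set.projIcc_of_right_le zero_le_one (by norm_num)
    rw [this]; exact h6

/-- By uniqueness, the first half of the long continuation ends in the given germ, so the second
half starts there. This reduces continuability from a new base germ to continuability from the old
one. -/
theorem IsContinuationAlong.of_concat {φ ψ χ : (Fin n → ℂ) → ℂ}
    (h1 : IsContinuationAlong γ φ ψ) (h2 : IsContinuationAlong (concatPath γ γ' h) φ χ) :
    IsContinuationAlong γ' ψ χ := by
  obtain ⟨Φ, hΦ, h3, h4⟩ := isContinuationAlong_iff.mp h2
  have c1 := hΦ.comp paramHalf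
  have c2 := hΦ.comp paramHalfAdd
  rw [concatPath_comp_half] at c1
  rw [concatPath_comp_halfAdd] at c2
  have e0 : paramHalf 0 = 0 := Subtype.ext (by change (0 : ℝ) / 2 = 0; norm_num)
  have e1 : paramHalf 1 = paramHalfAdd 0 :=
    Subtype.ext (by change (1 : ℝ) / 2 = (0 + 1) / 2; norm_num)
  have e2 : paramHalfAdd 1 = 1 := Subtype.ext (by change ((1 : ℝ) + 1) / 2 = 1; norm_num)
  rw [concatPath_zero] at h3
  rw [concatPath_one] at h4
  have c3 : IsContinuationAlong γ φ (Φ (paramHalfAdd 0)) :=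
    isContinuationAlong_iff.mpr ⟨_, c1, by simpa only [Function.comp_apply, e0] using h3,
      by rw [Function.comp_apply, e1]⟩
  have c4 := c3.unique h1 .rfl
  rw [h] at c4
  exact isContinuationAlong_iff.mpr ⟨_, c2, c4, by simpa only [Function.comp_apply, e2] using h4⟩

end Continuation

/-! ### Change of base point and sums -/

namespace MultiFun

variable {n : ℕ} {Ω : Set (Fin n → ℂ)}

theorem IsGermAt.mem {f : MultiFun n Ω} {z : Fin n → ℂ} {ψ : (Fin n → ℂ) → ℂ}
    (h : f.IsGermAt z ψ) : z ∈ Ω := by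
  obtain ⟨γ, -, h1, h2, -⟩ := h
  rw [← h1]; exact h2 1

theorem IsGermAt.analyticAt {f : MultiFun n Ω} {z : Fin n → ℂ} {ψ : (Fin n → ℂ) → ℂ}
    (h : f.IsGermAt z ψ) : AnalyticAt ℂ ψ z := by
  obtain ⟨γ, -, rfl, -, h3⟩ := h
  exact h3.analyticAt_right

/-- The multivalued function `f` with a germ at `b` as initial germ. -/
def rebase (f : MultiFun n Ω) (b : Fin n → ℂ) (ψ : (Fin n → ℂ) → ℂ) (h : f.IsGermAt b ψ) :
    MultiFun n Ω where
  base := b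
  base_mem := h.mem
  germ := ψ
  analyticAt := h.analyticAt
  continuable := by
    intro γ' h0 hγ'
    obtain ⟨γ, h1, h2, h3, h4⟩ := h
    have h5 : γ 1 = γ' 0 := h2.trans h0.symm
    obtain ⟨χ, hχ⟩ := f.continuable (concatPath γ γ' h5) (concatPath_zero.trans h1)
      (concatPath_mem h3 hγ')
    exact ⟨χ, h4.of_concat hχ⟩

/-- Paths to the new base point can be run forwards and backwards, so the set of germs does not
change. Branches and regularity are defined through germs alone and are equally unaffected. -/
theorem isGermAt_rebase_iff {f : MultiFun n Ω} {b : Fin n → ℂ} {ψ : (Fin n → ℂ) → ℂ}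
    {h : f.IsGermAt b ψ} {z : Fin n → ℂ} {χ : (Fin n → ℂ) → ℂ} :
    (f.rebase b ψ h).IsGermAt z χ ↔ f.IsGermAt z χ := by
  obtain ⟨γ, h1, h2, h3, h4⟩ := id h
  constructor
  · rintro ⟨γ', k1, k2, k3, k4⟩
    have h5 : γ 1 = γ' 0 := h2.trans k1.symm
    exact ⟨concatPath γ γ' h5, concatPath_zero.trans h1, concatPath_one.trans k2,
      concatPath_mem h3 k3, h4.concat k4⟩
  · rintro ⟨γ', k1, k2, k3, k4⟩
    let γr := γ.comp ⟨unitInterval.symm, unitInterval.continuous_symm⟩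
    have h0 : γr 0 = b := by simpa [γr] using h2
    have h5 : γr 1 = γ' 0 := by simpa [γr] using h1.trans k1.symm
    exact ⟨concatPath γr γ' h5, concatPath_zero.trans h0, concatPath_one.trans k2,
      concatPath_mem (fun t => h3 _) k3, h4.symm.concat k4⟩

theorem isBranchOn_rebase_iff {f : MultiFun n Ω} {b : Fin n → ℂ} {ψ : (Fin n → ℂ) → ℂ}
    {h : f.IsGermAt b ψ} {ι : Type*} {R : Set (Fin n → ℂ)} {c : ι → (Fin n → ℂ) → ℂ}
    {F : (Fin n → ℂ) → ℂ} : (f.rebase b ψ h).IsBranchOn R c F ↔ f.IsBranchOn R c F := by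
  simp only [IsBranchOn, isGermAt_rebase_iff]

theorem isRegularSingularity_rebase_iff {f : MultiFun n Ω} {b : Fin n → ℂ}
    {ψ : (Fin n → ℂ) → ℂ} {h : f.IsGermAt b ψ} {A : GL (Fin n) ℂ} {β : Fin n → ℂ}
    {δ : Fin n → Bool} :
    (f.rebase b ψ h).IsRegularSingularity A β δ ↔ f.IsRegularSingularity A β δ := by
  simp only [IsRegularSingularity, isBranchOn_rebase_iff]

/-- The sum of two multivalued functions with the same base point. -/
def sum (f g : MultiFun n Ω) (h : f.base = g.base) : MultiFun n Ω where
  base := f.base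
  base_mem := f.base_mem
  germ := f.germ + g.germ
  analyticAt := f.analyticAt.add (by rw [h]; exact g.analyticAt)
  continuable := by
    intro γ h0 hγ
    obtain ⟨ψ, hψ⟩ := f.continuable γ h0 hγ
    obtain ⟨χ, hχ⟩ := g.continuable γ (h0.trans h) hγ
    exact ⟨_, hψ.add hχ⟩

/-- The multivalued function `0`. -/
def zero (b : Fin n → ℂ) (hb : b ∈ Ω) : MultiFun n Ω where
  base := b
  base_mem := hb
  germ := 0
  analyticAt := analyticAt_const
  continuable γ _ _ := ⟨0, IsContinuationAlong.zero γ⟩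

end MultiFun

/-! ## Branches on cut regions -/

namespace MultiFun

variable {n : ℕ} {Ω : Set (Fin n → ℂ)} {ι : Type*} {R : Set (Fin n → ℂ)}
  {c : ι → (Fin n → ℂ) → ℂ}

/-- A path in `R` that meets the cuts at most at its end point, which it approaches from the side to
which the cuts are attached. -/
structure IsApproach (R : Set (Fin n → ℂ)) (c : ι → (Fin n → ℂ) → ℂ)
    (γ : C(unitInterval, Fin n → ℂ)) : Prop where
  mem : ∀ t, γ t ∈ R
  continuousAt : ∀ t, t ≠ 1 → ∀ i, ContinuousAt (fun z => argPos (c i z)) (γ t)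
  near : ∀ᶠ t in 𝓝 1, ∀ i, |argPos (c i (γ t)) - argPos (c i (γ 1))| < Real.pi

theorem eventually_abs_sub_lt [Finite ι] {z : Fin n → ℂ} {y : ι → ℝ}
    (hc : ∀ i, ContinuousAt (fun z => argPos (c i z)) z)
    (hy : ∀ i, |argPos (c i z) - y i| < Real.pi) :
    ∀ᶠ z' in 𝓝 z, ∀ i, |argPos (c i z') - y i| < Real.pi := by
  rw [Filter.eventually_all]
  intro i
  exact (((hc i).sub continuousAt_const).abs).eventually_lt continuousAt_const (hy i)

/-- Where all the arguments are continuous, the proviso in `IsBranchOn` holds on a full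
neighbourhood, so the branch itself is a germ of the function. -/
theorem IsBranchOn.analyticAt [Finite ι] {f : MultiFun n Ω} {F : (Fin n → ℂ) → ℂ}
    (hF : f.IsBranchOn R c F) {z : Fin n → ℂ} (hz : z ∈ R)
    (hc : ∀ i, ContinuousAt (fun z => argPos (c i z)) z) :
    f.IsGermAt z F ∧ AnalyticAt ℂ F z := by
  obtain ⟨ψ, hψ, h1⟩ := hF z hz
  have h2 : ψ =ᶠ[𝓝 z] F := by
    filter_upwards [h1, eventually_abs_sub_lt (y := fun i => argPos (c i z)) hc
      (by simp [Real.pi_pos])] with z' h3 h4 using (h3 h4).symm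
  refine ⟨?_, hψ.analyticAt.congr h2⟩
  obtain ⟨γ, k1, rfl, k3, k4⟩ := hψ
  exact ⟨γ, k1, rfl, k3, k4.congr .rfl h2⟩

/-- A branch is continued along a path that approaches the cuts from the right side. -/
theorem IsBranchOn.exists_continuation [Finite ι] {f : MultiFun n Ω} {F : (Fin n → ℂ) → ℂ}
    (hF : f.IsBranchOn R c F) {γ : C(unitInterval, Fin n → ℂ)} (hγ : IsApproach R c γ) :
    ∃ ψ, IsContinuationAlong γ F ψ ∧
      ∀ᶠ z' in 𝓝 (γ 1), (∀ i, |argPos (c i z') - argPos (c i (γ 1))| < Real.pi) →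
        F z' = ψ z' := by
  classical
  obtain ⟨ψ, hψ, h1⟩ := hF _ (hγ.mem 1)
  -- Before the end the branch serves as its own germ. The end point may lie on a cut, where `F` can
  -- jump and `ψ` must replace it.
  refine ⟨ψ, ⟨fun t => if t = 1 then ψ else F, ?_, ?_, ?_, ?_⟩, h1⟩
  · intro t
    by_cases ht : t = 1
    · subst ht; simpa using hψ.analyticAt
    · simpa only [if_neg ht] using (hF.analyticAt (hγ.mem t) (hγ.continuousAt t ht)).2
  · intro t
    by_cases ht : t = 1
    · subst ht
      filter_upwards [hγ.near, γ.continuous.continuousAt.eventually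
        (eventually_eventually_nhds.mpr h1)] with s h2 h3
      by_cases hs : s = 1
      · subst hs; rfl
      · rw [if_neg hs, if_pos rfl]
        filter_upwards [h3, eventually_abs_sub_lt (hγ.continuousAt s hs) h2] with z' h4 h5
          using h4 h5
    · filter_upwards [isOpen_ne.mem_nhds ht] with s hs
      rw [if_neg hs, if_neg ht]
  · change (if (0 : unitInterval) = 1 then ψ else F) =ᶠ[_] F
    rw [if_neg (by norm_num)]
  · change (if (1 : unitInterval) = 1 then ψ else F) =ᶠ[_] ψ
    rw [if_pos rfl]

/-- Each point of `R` is the end point of a path from `b` that approaches the cuts from the right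
side. -/
def IsCutStar (R : Set (Fin n → ℂ)) (c : ι → (Fin n → ℂ) → ℂ) (b : Fin n → ℂ) : Prop :=
  ∀ z ∈ R, ∃ γ : C(unitInterval, Fin n → ℂ), IsApproach R c γ ∧ γ 0 = b ∧ γ 1 = z

theorem IsCutStar.continuousAt {b : Fin n → ℂ} (h : IsCutStar R c b) (hb : b ∈ R) (i : ι) :
    ContinuousAt (fun z => argPos (c i z)) b := by
  obtain ⟨γ, h1, rfl, h2⟩ := h b hb
  exact h1.continuousAt 0 (by norm_num) i

theorem isBranchOn_zero {b : Fin n → ℂ} (h : IsCutStar R c b) (hR : R ⊆ Ω) (hb : b ∈ R) :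
    (zero b (hR hb)).IsBranchOn R c 0 := by
  intro z hz
  obtain ⟨γ, h1, h2, h3⟩ := h z hz
  exact ⟨0, ⟨γ, h2, h3, fun t => hR (h1.mem t), IsContinuationAlong.zero γ⟩,
    Filter.Eventually.of_forall fun _ _ => rfl⟩

theorem isRegularSingularity_zero {b : Fin n → ℂ} (hb : b ∈ Ω) (A : GL (Fin n) ℂ)
    (β : Fin n → ℂ) (δ : Fin n → Bool) : (zero b hb).IsRegularSingularity A β δ := by
  refine ⟨0, fun _ => ∅, fun F ⟨r, hr, hF⟩ => ⟨r, 0, hr, fun z hz => ?_⟩⟩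
  obtain ⟨ψ, ⟨γ, h1, h2, h3, h4⟩, h5⟩ := hF z hz
  have h6 := (h4.unique (IsContinuationAlong.zero γ) .rfl).self_of_nhds
  rw [h2] at h6
  rw [h5.self_of_nhds (by simp [Real.pi_pos]), h6]
  simp

/-- Sums of branches on a cut region are branches of the sum. -/
theorem exists_isBranchOn_add [Finite ι] {b : Fin n → ℂ} (h : IsCutStar R c b) (hR : R ⊆ Ω)
    (hb : b ∈ R) {f g : MultiFun n Ω} {F G : (Fin n → ℂ) → ℂ} (hF : f.IsBranchOn R c F)
    (hG : g.IsBranchOn R c G) :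
    ∃ (hf : f.IsGermAt b F) (hg : g.IsGermAt b G),
      ((f.rebase b F hf).sum (g.rebase b G hg) rfl).IsBranchOn R c (F + G) := by
  have hf := (hF.analyticAt hb (h.continuousAt hb)).1
  have hg := (hG.analyticAt hb (h.continuousAt hb)).1
  -- Both functions now start at `b` with the germs of their branches, so one approach path to `z`
  -- continues them simultaneously and matches the sheets.
  refine ⟨hf, hg, fun z hz => ?_⟩
  obtain ⟨γ, h1, h2, rfl⟩ := h z hz
  obtain ⟨ψ, k1, k2⟩ := hF.exists_continuation h1
  obtain ⟨χ, k3, k4⟩ := hG.exists_continuation h1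
  refine ⟨ψ + χ, ⟨γ, h2, rfl, fun t => hR (h1.mem t), k1.add k3⟩, ?_⟩
  filter_upwards [k2, k4] with z' h3 h4 h5
  rw [Pi.add_apply, Pi.add_apply, h3 h5, h4 h5]

/-! ### Continuation along segments -/

/-- The segment from `a` to `b`. -/
noncomputable def segPath (a b : Fin n → ℂ) : C(unitInterval, Fin n → ℂ) where
  toFun t := AffineMap.lineMap (k := ℝ) a b (t : ℝ)
  continuous_toFun := by
    exact (AffineMap.lineMap_continuous (R := ℝ) (p := a) (q := b)).comp continuous_subtype_val

theorem segPath_zero (a b : Fin n → ℂ) : segPath a b 0 = a := AffineMap.lineMap_apply_zero a b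

theorem segPath_one (a b : Fin n → ℂ) : segPath a b 1 = b := AffineMap.lineMap_apply_one a b

/-- The continuation of a germ along a segment extends to a neighbourhood of the segment. -/
theorem exists_analytic_tube {a b : Fin n → ℂ} {Φ : unitInterval → (Fin n → ℂ) → ℂ}
    (hΦ : IsGermFamily (segPath a b) Φ) :
    ∃ ε > 0, ∃ G : (Fin n → ℂ) → ℂ,
      (∀ t, ∀ y ∈ Metric.ball (segPath a b t) ε, AnalyticAt ℂ G y) ∧
      ∀ t, G =ᶠ[𝓝 (segPath a b t)] Φ t := by
  classical
  set σ := segPath a b with hσ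
  -- The factor 2 keeps an `r t`-ball about any point within `r t` of `σ t` inside the domain of
  -- analyticity of `Φ t`.
  have hloc : ∀ t, ∃ r > 0, ∀ y ∈ Metric.ball (σ t) (2 * r), AnalyticAt ℂ (Φ t) y := by
    intro t
    obtain ⟨r, hr, h⟩ := Metric.eventually_nhds_iff_ball.mp (hΦ.analyticAt t).eventually_analyticAt
    exact ⟨r / 2, by positivity, by rwa [mul_div_cancel₀ r two_ne_zero]⟩
  choose r hr hr' using hloc
  let U : unitInterval → Set unitInterval := fun t =>
    interior {s | Φ s =ᶠ[𝓝 (σ s)] Φ t ∧ σ s ∈ Metric.ball (σ t) (r t)}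
  have hU : ∀ t, t ∈ U t := fun t => mem_interior_iff_mem_nhds.mpr <| by
    filter_upwards [hΦ.locally_const t, σ.continuous.continuousAt.eventually
      (Metric.ball_mem_nhds (σ t) (hr t))] with s h1 h2 using ⟨h1, h2⟩
  obtain ⟨τ, hτ0, hτm, ⟨N, hN⟩, hτ⟩ := exists_monotone_Icc_subset_open_cover_unitInterval
    (c := U) (fun t => isOpen_interior) (fun t _ => Set.mem_iUnion.mpr ⟨t, hU t⟩)
  have himg : ∀ s t : unitInterval, Convex ℝ (σ '' Set.Icc s t) := by
    intro s t
    have : σ '' Set.Icc s t = (AffineMap.lineMap (k := ℝ) a b) '' Set.Icc (s : ℝ) (t : ℝ) := by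
      ext y
      constructor
      · rintro ⟨u, hu, rfl⟩
        exact ⟨u, hu, rfl⟩
      · rintro ⟨u, hu, rfl⟩
        exact ⟨⟨u, s.2.1.trans hu.1, hu.2.trans t.2.2⟩, hu, rfl⟩
    rw [this]
    exact (convex_Icc _ _).affine_image _
  -- Gluing along a finite subdivision of the interval, on each piece of which a single germ
  -- represents the continuation.
  have step : ∀ m : ℕ, ∃ ε > 0, ∃ G : (Fin n → ℂ) → ℂ,
      (∀ y ∈ Metric.thickening ε (σ '' Set.Icc 0 (τ m)), AnalyticAt ℂ G y) ∧
      ∀ t ∈ Set.Icc 0 (τ m), G =ᶠ[𝓝 (σ t)] Φ t := by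
    intro m
    induction m with
    | zero =>
      refine ⟨2 * r 0, by have := hr 0; positivity, Φ 0, ?_, ?_⟩
      · rw [hτ0, Set.Icc_self, Set.image_singleton, Metric.thickening_singleton]
        exact hr' 0
      · intro t ht
        rw [hτ0, Set.Icc_self, Set.mem_singleton_iff] at ht
        subst ht; rfl
    | succ m ih =>
      obtain ⟨ε, hε, G, hG1, hG2⟩ := ih
      obtain ⟨t₀, ht₀⟩ := hτ m
      have ht₀' : ∀ s ∈ Set.Icc (τ m) (τ (m + 1)),
          Φ s =ᶠ[𝓝 (σ s)] Φ t₀ ∧ σ s ∈ Metric.ball (σ t₀) (r t₀) :=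
        fun s hs => by
          have := interior_subset (ht₀ hs)
          exact this
      set ε' := min ε (r t₀) with hε'
      have hε'0 : 0 < ε' := lt_min hε (hr t₀)
      set A := Metric.thickening ε' (σ '' Set.Icc 0 (τ m)) with hA
      set B := Metric.thickening ε' (σ '' Set.Icc (τ m) (τ (m + 1))) with hB
      have hAo : IsOpen A := Metric.isOpen_thickening
      have hBo : IsOpen B := Metric.isOpen_thickening
      have hAG : ∀ y ∈ A, AnalyticAt ℂ G y := fun y hy =>
        hG1 y (Metric.thickening_mono (min_le_left _ _) _ hy)
      have hBΦ : ∀ y ∈ B, AnalyticAt ℂ (Φ t₀) y := by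
        intro y hy
        obtain ⟨_, ⟨s, hs, rfl⟩, hys⟩ := Metric.mem_thickening_iff.mp hy
        refine hr' t₀ y ?_
        have h1 := (ht₀' s hs).2
        rw [Metric.mem_ball] at h1 ⊢
        have h2 : ε' ≤ r t₀ := min_le_right _ _
        linarith [dist_triangle y (σ s) (σ t₀)]
      have hmA : σ (τ m) ∈ A := Metric.self_subset_thickening hε'0 _
        ⟨τ m, ⟨unitInterval.nonneg', le_rfl⟩, rfl⟩
      have hmB : σ (τ m) ∈ B := Metric.self_subset_thickening hε'0 _
        ⟨τ m, ⟨le_rfl, hτm (Nat.le_succ m)⟩, rfl⟩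
      -- Both sets are thickenings of convex pieces of a segment, so their intersection is convex.
      -- Agreement near the common point `σ (τ m)` then extends to all of it.
      have heq : Set.EqOn G (Φ t₀) (A ∩ B) := by
        refine AnalyticOnNhd.eqOn_of_preconnected_of_eventuallyEq (fun y hy => hAG y hy.1)
          (fun y hy => hBΦ y hy.2)
          (((himg _ _).thickening _).inter ((himg _ _).thickening _)).isPreconnected
          ⟨hmA, hmB⟩ ?_
        exact (hG2 (τ m) ⟨unitInterval.nonneg', le_rfl⟩).trans
          (ht₀' (τ m) ⟨le_rfl, hτm (Nat.le_succ m)⟩).1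
      let G' : (Fin n → ℂ) → ℂ := fun y => if y ∈ A then G y else Φ t₀ y
      have hGA : ∀ y ∈ A, G' =ᶠ[𝓝 y] G := fun y hy => by
        filter_upwards [hAo.mem_nhds hy] with y' hy' using if_pos hy'
      have hGB : ∀ y ∈ B, G' =ᶠ[𝓝 y] Φ t₀ := fun y hy => by
        filter_upwards [hBo.mem_nhds hy] with y' hy'
        by_cases h : y' ∈ A
        · exact (if_pos h).trans (heq ⟨h, hy'⟩)
        · exact if_neg h
      have hcase : ∀ t ∈ Set.Icc 0 (τ (m + 1)),
          t ∈ Set.Icc 0 (τ m) ∨ t ∈ Set.Icc (τ m) (τ (m + 1)) := fun t ht =>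
        (le_total t (τ m)).imp (fun h => ⟨ht.1, h⟩) fun h => ⟨h, ht.2⟩
      refine ⟨ε', hε'0, G', ?_, ?_⟩
      · intro y hy
        obtain ⟨_, ⟨s, hs, rfl⟩, hys⟩ := Metric.mem_thickening_iff.mp hy
        rcases hcase s hs with h | h
        · have hyA : y ∈ A := Metric.mem_thickening_iff.mpr ⟨_, ⟨s, h, rfl⟩, hys⟩
          exact (hAG y hyA).congr (hGA y hyA).symm
        · have hyB : y ∈ B := Metric.mem_thickening_iff.mpr ⟨_, ⟨s, h, rfl⟩, hys⟩
          exact (hBΦ y hyB).congr (hGB y hyB).symm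
      · intro t ht
        rcases hcase t ht with h | h
        · exact (hGA _ (Metric.self_subset_thickening hε'0 _ ⟨t, h, rfl⟩)).trans (hG2 t h)
        · exact (hGB _ (Metric.self_subset_thickening hε'0 _ ⟨t, h, rfl⟩)).trans
            (ht₀' t h).1.symm
  obtain ⟨ε, hε, G, h1, h2⟩ := step N
  rw [hN N le_rfl] at h1 h2
  have htop : ∀ t : unitInterval, t ∈ Set.Icc (0 : unitInterval) 1 := fun t =>
    ⟨unitInterval.nonneg', unitInterval.le_one'⟩
  exact ⟨ε, hε, G, fun t y hy => h1 y (Metric.mem_thickening_iff.mpr ⟨_, ⟨t, htop t, rfl⟩, hy⟩),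
    fun t => h2 t (htop t)⟩

/-- The results of continuation along the segments from a fixed point fit together. -/
theorem eventually_eq_of_segPath {a b : Fin n → ℂ} {φ ψ : (Fin n → ℂ) → ℂ}
    (h : IsContinuationAlong (segPath a b) φ ψ) :
    ∀ᶠ b' in 𝓝 b, ∀ ψ', IsContinuationAlong (segPath a b') φ ψ' → ψ' b' = ψ b' := by
  obtain ⟨Φ, hΦ, h0, h1⟩ := isContinuationAlong_iff.mp h
  obtain ⟨ε, hε, G, hG, hGΦ⟩ := exists_analytic_tube hΦ
  have h2 : G =ᶠ[𝓝 b] ψ := by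
    have := (hGΦ 1).trans h1
    rwa [segPath_one] at this
  have h3 : G =ᶠ[𝓝 a] φ := by
    have := (hGΦ 0).trans h0
    rwa [segPath_zero] at this
  filter_upwards [h2, Metric.ball_mem_nhds b hε] with b' hb' hball ψ' hψ'
  have hG' : IsContinuationAlong (segPath a b') φ G := by
    -- The segments to `b` and `b'` are at most `dist b' b` apart at equal parameters, so the second
    -- lies in the tube and the one function `G` continues the germ along it.
    refine ⟨fun _ => G, fun t => hG t _ ?_, fun t => Filter.Eventually.of_forall fun _ => .rfl,
      by rw [segPath_zero]; exact h3, .rfl⟩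
    rw [Metric.mem_ball] at hball ⊢
    refine lt_of_le_of_lt ?_ hball
    change dist (AffineMap.lineMap (k := ℝ) a b' (t : ℝ)) (AffineMap.lineMap a b (t : ℝ)) ≤ _
    rw [AffineMap.lineMap_apply_module', AffineMap.lineMap_apply_module', dist_add_right,
      dist_smul₀, dist_sub_right, Real.norm_of_nonneg t.2.1]
    exact mul_le_of_le_one_left dist_nonneg t.2.2
  have h4 := (hψ'.unique hG' .rfl).self_of_nhds
  rw [segPath_one] at h4
  rw [h4, hb']

end MultiFun

/-! ## The normalised argument -/

section ArgPos

theorem argPos_nonneg (ζ : ℂ) : 0 ≤ argPos ζ := by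
  unfold argPos
  split_ifs with h
  · exact h
  · linarith [Complex.neg_pi_lt_arg ζ, Real.pi_pos]

theorem argPos_lt (ζ : ℂ) : argPos ζ < 2 * Real.pi := by
  unfold argPos
  split_ifs with h
  · linarith [Complex.arg_le_pi ζ, Real.pi_pos]
  · linarith

theorem argPos_of_im_nonneg {ζ : ℂ} (h : 0 ≤ ζ.im) : argPos ζ = ζ.arg :=
  if_pos (Complex.arg_nonneg_iff.mpr h)

/-- Off the nonnegative real axis this argument equals arg(-ζ) + π, and the principal argument is
continuous on the slit plane. -/
theorem continuousAt_argPos {ζ : ℂ} (h : ζ.im ≠ 0 ∨ ζ.re < 0) : ContinuousAt argPos ζ := by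
  have hmem : -ζ ∈ Complex.slitPlane := by
    rw [Complex.mem_slitPlane_iff]
    simpa [or_comm] using h
  have heq : (fun ζ => (-ζ).arg + Real.pi) =ᶠ[𝓝 ζ] argPos := by
    filter_upwards [continuous_neg.continuousAt.preimage_mem_nhds
      (Complex.isOpen_slitPlane.mem_nhds hmem)] with ζ' h'
    have h' : -ζ' ∈ Complex.slitPlane := h'
    rw [Complex.mem_slitPlane_iff, Complex.neg_re, Complex.neg_im] at h'
    unfold argPos
    rcases lt_trichotomy ζ'.im 0 with him | him | him
    · rw [if_neg (by rw [Complex.arg_nonneg_iff]; exact not_le.mpr him),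
        Complex.arg_neg_eq_arg_add_pi_of_im_neg him]
      ring
    · have hre : ζ'.re < 0 := by
        rcases h' with h' | h'
        · linarith
        · exact absurd (by rw [him, neg_zero]) h'
      have e1 : ζ'.arg = Real.pi := Complex.arg_eq_pi_iff.mpr ⟨hre, him⟩
      have e2 : (-ζ').arg = 0 := Complex.arg_eq_zero_iff.mpr ⟨by simp [hre.le], by simp [him]⟩
      rw [if_pos (by rw [e1]; exact Real.pi_pos.le), e1, e2, zero_add]
    · rw [if_pos (Complex.arg_nonneg_iff.mpr him.le),
        Complex.arg_neg_eq_arg_sub_pi_of_im_pos him]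
      ring
  refine ContinuousAt.congr ?_ heq
  exact ((Complex.continuousAt_arg hmem).comp continuous_neg.continuousAt).add continuousAt_const

theorem argPos_eq_zero {ζ : ℂ} (h : ¬(ζ.im ≠ 0 ∨ ζ.re < 0)) : argPos ζ = 0 := by
  push Not at h
  rw [argPos_of_im_nonneg h.1.ge]
  exact Complex.arg_eq_zero_iff.mpr ⟨h.2, h.1⟩

theorem continuousAt_argPos_of_pos {ζ : ℂ} (h : 0 < argPos ζ) : ContinuousAt argPos ζ := by
  refine continuousAt_argPos ?_
  by_contra h'
  exact h.ne' (argPos_eq_zero h')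

/-- The argument is continuous from the side to which the cut is attached. -/
theorem tendsto_argPos {ζ : ℂ} (hζ : ζ ≠ 0) :
    Filter.Tendsto argPos (𝓝[{ζ' | |argPos ζ' - argPos ζ| < Real.pi}] ζ) (𝓝 (argPos ζ)) := by
  by_cases h : ζ.im ≠ 0 ∨ ζ.re < 0
  · exact (continuousAt_argPos h).mono_left nhdsWithin_le_nhds
  · have h0 := argPos_eq_zero h
    push Not at h
    have hre : 0 < ζ.re := lt_of_le_of_ne h.2 fun h1 => hζ (Complex.ext h1.symm h.1)
    have hc : ContinuousAt Complex.arg ζ :=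
      Complex.continuousAt_arg (Complex.mem_slitPlane_iff.mpr (Or.inl hre))
    have he : argPos ζ = ζ.arg := argPos_of_im_nonneg h.1.ge
    rw [he]
    refine (hc.mono_left nhdsWithin_le_nhds).congr' ?_
    filter_upwards [self_mem_nhdsWithin] with ζ' h1
    have h1 : |argPos ζ' - ζ.arg| < Real.pi := h1
    -- On the positive axis the condition reads argPos ζ' < π, which excludes the lower half-plane,
    -- where the value arg ζ' + 2π exceeds π.
    rw [← he, h0, sub_zero, abs_of_nonneg (argPos_nonneg _)] at h1
    unfold argPos at h1 ⊢
    split_ifs with h2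
    · rfl
    · rw [if_neg h2] at h1
      linarith [Complex.neg_pi_lt_arg ζ']

theorem lBranch_zero (ζ : ℂ) : lBranch 0 ζ = (Real.log ‖ζ‖ : ℂ) + argPos ζ * Complex.I := by
  simp [lBranch]

theorem lBranch_zero_im (ζ : ℂ) : (lBranch 0 ζ).im = argPos ζ := by
  simp [lBranch_zero]

theorem exp_lBranch_zero {ζ : ℂ} (hζ : ζ ≠ 0) : Complex.exp (lBranch 0 ζ) = ζ := by
  have h1 : Complex.exp ((argPos ζ : ℂ) * Complex.I) = Complex.exp (ζ.arg * Complex.I) := by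
    unfold argPos
    split_ifs with h
    · rfl
    · push_cast
      rw [add_mul, Complex.exp_add, Complex.exp_two_pi_mul_I, mul_one]
  rw [lBranch_zero, Complex.exp_add, h1, ← Complex.ofReal_exp, Real.exp_log (norm_pos_iff.mpr hζ)]
  exact Complex.norm_mul_exp_arg_mul_I ζ

/-- Two logarithms of the same number differ by 2πik. Since both imaginary parts lie in [0, 2π), k =
0. -/
theorem argPos_exp {x : ℂ} (h0 : 0 ≤ x.im) (h1 : x.im < 2 * Real.pi) :
    argPos (Complex.exp x) = x.im := by
  have h2 := exp_lBranch_zero (Complex.exp_ne_zero x)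
  obtain ⟨k, hk⟩ := Complex.exp_eq_exp_iff_exists_int.mp h2
  have h3 := congrArg Complex.im hk
  rw [lBranch_zero_im] at h3
  have h4 : argPos (Complex.exp x) = x.im + k * (2 * Real.pi) := by
    rw [h3]; simp
  have h5 := argPos_nonneg (Complex.exp x)
  have h6 := argPos_lt (Complex.exp x)
  have hpi := Real.pi_pos
  have h7 : (-1 : ℝ) < k := by
    by_contra h; push Not at h; nlinarith
  have h8 : (k : ℝ) < 1 := by
    by_contra h; push Not at h; nlinarith
  have h9 : k = 0 := by
    have a : (-1 : ℤ) < k := by exact_mod_cast h7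
    have b : k < 1 := by exact_mod_cast h8
    omega
  rw [h4, h9]; simp

end ArgPos

namespace MultiFun

variable {n : ℕ} {Ω : Set (Fin n → ℂ)}

/-! ## Regions that are convex in logarithmic coordinates -/

/-- The region `T`, which does not meet the coordinate hyperplanes, is convex in logarithmic
coordinates and contains points with negative coordinates. -/
structure IsLogConvex (T : Set (Fin n → ℂ)) : Prop where
  isOpen : IsOpen T
  ne_zero : ∀ ζ ∈ T, ∀ i, ζ i ≠ 0
  convex : Convex ℝ {x : Fin n → ℂ | (fun i => Complex.exp (x i)) ∈ T}

/-- The map inverse to `ζ = exp x`, `ζ = z A - β`. -/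
noncomputable def expChart (A : GL (Fin n) ℂ) (β : Fin n → ℂ) (x : Fin n → ℂ) : Fin n → ℂ :=
  Matrix.vecMul ((fun i => Complex.exp (x i)) + β) ((A⁻¹ : GL (Fin n) ℂ) : Matrix (Fin n) (Fin n) ℂ)

variable {A : GL (Fin n) ℂ} {β : Fin n → ℂ}

theorem newVar_expChart (x : Fin n → ℂ) :
    newVar A β (expChart A β x) = fun i => Complex.exp (x i) := by
  have : ((A⁻¹ : GL (Fin n) ℂ) : Matrix (Fin n) (Fin n) ℂ) * (A : Matrix (Fin n) (Fin n) ℂ) = 1 :=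
    A.inv_mul
  rw [newVar, expChart, Matrix.vecMul_vecMul, this, Matrix.vecMul_one, add_sub_cancel_right]

theorem expChart_log {z : Fin n → ℂ} (hz : ∀ i, newVar A β z i ≠ 0) :
    expChart A β (fun i => lBranch 0 (newVar A β z i)) = z := by
  have : (A : Matrix (Fin n) (Fin n) ℂ) * ((A⁻¹ : GL (Fin n) ℂ) : Matrix (Fin n) (Fin n) ℂ) = 1 :=
    A.mul_inv
  have h1 : (fun i => Complex.exp (lBranch 0 (newVar A β z i))) = newVar A β z :=
    funext fun i => exp_lBranch_zero (hz i)
  rw [expChart, h1, newVar, sub_add_cancel, Matrix.vecMul_vecMul, this, Matrix.vecMul_one]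

theorem continuous_newVar : Continuous (newVar A β) := by
  unfold newVar
  exact (Continuous.matrix_vecMul continuous_id continuous_const).sub continuous_const

theorem analyticAt_expChart (x : Fin n → ℂ) : AnalyticAt ℂ (expChart A β) x := by
  rw [analyticAt_pi_iff]
  intro j
  have : (fun x => expChart A β x j) = fun x : Fin n → ℂ => ∑ i, (Complex.exp (x i) + β i) *
      ((A⁻¹ : GL (Fin n) ℂ) : Matrix (Fin n) (Fin n) ℂ) i j := by
    funext x; rfl
  rw [this]
  refine Finset.analyticAt_fun_sum _ fun i _ => ?_
  have h1 : AnalyticAt ℂ (fun x : Fin n → ℂ => x i) x :=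
    (ContinuousLinearMap.proj (R := ℂ) (φ := fun _ : Fin n => ℂ) i).analyticAt x
  exact ((h1.cexp).add analyticAt_const).mul analyticAt_const

/-- The image of a segment in logarithmic coordinates. -/
noncomputable def chartPath (A : GL (Fin n) ℂ) (β : Fin n → ℂ) (b z : Fin n → ℂ) :
    C(unitInterval, Fin n → ℂ) where
  toFun t := expChart A β (segPath b (fun i => lBranch 0 (newVar A β z i)) t)
  continuous_toFun := by
    have : Continuous (expChart A β) :=
      continuous_iff_continuousAt.mpr fun x => (analyticAt_expChart x).continuousAt
    fun_prop

variable {T : Set (Fin n → ℂ)} {b : Fin n → ℂ}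

theorem chartPath_zero (z : Fin n → ℂ) : chartPath A β b z 0 = expChart A β b :=
  congrArg (expChart A β) (segPath_zero _ _)

theorem chartPath_one {z : Fin n → ℂ} (hz : ∀ i, newVar A β z i ≠ 0) :
    chartPath A β b z 1 = z :=
  (congrArg (expChart A β) (segPath_one _ _)).trans (expChart_log hz)

/-- In logarithmic coordinates each imaginary part moves affinely from π to a value in [0, 2π). It
stays in (0, 2π) before the end, hence off the cuts, and can reach 0 only from above, the side to
which the cut is attached. -/
theorem isApproach_chartPath (hT : IsLogConvex T) (hb : (fun i => Complex.exp (b i)) ∈ T)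
    (hbi : ∀ i, (b i).im = Real.pi) {z : Fin n → ℂ} (hz : newVar A β z ∈ T) :
    IsApproach {z | newVar A β z ∈ T} (fun i z => newVar A β z i) (chartPath A β b z) := by
  set y : Fin n → ℂ := fun i => lBranch 0 (newVar A β z i) with hy
  have hyT : (fun i => Complex.exp (y i)) ∈ T := by
    have : (fun i => Complex.exp (y i)) = newVar A β z :=
      funext fun i => exp_lBranch_zero (hT.ne_zero _ hz i)
    rwa [this]
  have him : ∀ t i, (segPath b y t i).im = (1 - (t : ℝ)) * Real.pi + t * argPos (newVar A β z i) := by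
    intro t i
    change (AffineMap.lineMap (k := ℝ) b y (t : ℝ) i).im = _
    rw [AffineMap.lineMap_apply_module]
    simp [hbi, hy, lBranch_zero_im]
  have hval : ∀ t, newVar A β (chartPath A β b z t) = fun i => Complex.exp (segPath b y t i) :=
    fun t => newVar_expChart _
  have hbound : ∀ (t : unitInterval) i, 0 ≤ (segPath b y t i).im ∧
      (segPath b y t i).im < 2 * Real.pi ∧ (t ≠ 1 → 0 < (segPath b y t i).im) := by
    intro t i
    rw [him]
    have h0 := argPos_nonneg (newVar A β z i)
    have h1 := argPos_lt (newVar A β z i)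
    have t0 := t.2.1
    have t1 := t.2.2
    have hpi := Real.pi_pos
    refine ⟨by nlinarith [mul_nonneg t0 h0, mul_nonneg (sub_nonneg.mpr t1) hpi.le], ?_, fun ht => ?_⟩
    · rcases t0.eq_or_lt with h | h
      · rw [← h]; linarith
      · nlinarith [mul_lt_mul_of_pos_left h1 h, mul_nonneg (sub_nonneg.mpr t1) hpi.le]
    · have : (t : ℝ) < 1 := lt_of_le_of_ne t1 fun h => ht (Subtype.ext h)
      nlinarith [mul_nonneg t0 h0, mul_pos (sub_pos.mpr this) hpi]
  have harg : ∀ t i, argPos (newVar A β (chartPath A β b z t) i) = (segPath b y t i).im := by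
    intro t i
    rw [hval]
    exact argPos_exp (hbound t i).1 (hbound t i).2.1
  refine ⟨fun t => ?_, fun t ht i => ?_, ?_⟩
  · change newVar A β (chartPath A β b z t) ∈ T
    rw [hval]
    have h1 := hT.convex.segment_subset hb hyT
    refine h1 ?_
    rw [segment_eq_image_lineMap]
    exact ⟨t, t.2, rfl⟩
  · have h1 : 0 < argPos (newVar A β (chartPath A β b z t) i) := by
      rw [harg]; exact (hbound t i).2.2 ht
    exact ContinuousAt.comp (f := fun z => newVar A β z i) (continuousAt_argPos_of_pos h1)
      ((continuous_apply i).comp continuous_newVar).continuousAt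
  · rw [Filter.eventually_all]
    intro i
    simp only [harg]
    have hc : Continuous fun t : unitInterval => (segPath b y t i).im := by fun_prop
    have : ContinuousAt (fun t : unitInterval => |(segPath b y t i).im - (segPath b y 1 i).im|) 1 := by
      fun_prop
    exact this.eventually_lt continuousAt_const (by simp [Real.pi_pos])

theorem isCutStar_of_isLogConvex (hT : IsLogConvex T) (hb : (fun i => Complex.exp (b i)) ∈ T)
    (hbi : ∀ i, (b i).im = Real.pi) :
    IsCutStar {z | newVar A β z ∈ T} (fun i z => newVar A β z i) (expChart A β b) := fun z hz =>
  ⟨chartPath A β b z, isApproach_chartPath hT hb hbi hz, chartPath_zero z,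
    chartPath_one (hT.ne_zero _ hz)⟩

/-- Logarithms are continuous from the attached side of the cuts. This turns a statement about
neighbouring segments in the chart into one about neighbouring points of the cut region. -/
theorem tendsto_log_newVar {z : Fin n → ℂ} (hz : ∀ i, newVar A β z i ≠ 0) :
    Filter.Tendsto (fun z i => lBranch 0 (newVar A β z i))
      (𝓝[{z' | ∀ i, |argPos (newVar A β z' i) - argPos (newVar A β z i)| < Real.pi}] z)
      (𝓝 fun i => lBranch 0 (newVar A β z i)) := by
  rw [tendsto_pi_nhds]
  intro i
  simp only [lBranch_zero]
  have hc : Continuous fun z => newVar A β z i := (continuous_apply i).comp continuous_newVar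
  refine Filter.Tendsto.add ?_ (Filter.Tendsto.mul ?_ tendsto_const_nhds)
  · refine (Complex.continuous_ofReal.tendsto _).comp ?_
    have h1 : ContinuousAt (fun z => Real.log ‖newVar A β z i‖) z :=
      (hc.norm.continuousAt).log (norm_ne_zero_iff.mpr (hz i))
    exact h1.mono_left nhdsWithin_le_nhds
  · refine (Complex.continuous_ofReal.tendsto _).comp ?_
    refine (tendsto_argPos (hz i)).comp ?_
    refine tendsto_nhdsWithin_iff.mpr ⟨(hc.tendsto z).mono_left nhdsWithin_le_nhds, ?_⟩
    filter_upwards [self_mem_nhdsWithin] with z' h using h i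

/-- A germ of a multivalued function extends to a single-valued branch on a region that is convex in
logarithmic coordinates. -/
theorem exists_isBranchOn (hT : IsLogConvex T) (hR : {z | newVar A β z ∈ T} ⊆ Ω)
    (hb : (fun i => Complex.exp (b i)) ∈ T) (hbi : ∀ i, (b i).im = Real.pi) (f : MultiFun n Ω)
    {ψ : (Fin n → ℂ) → ℂ} (hψ : f.IsGermAt (expChart A β b) ψ) :
    ∃ F, f.IsBranchOn {z | newVar A β z ∈ T} (fun i z => newVar A β z i) F ∧
      ∀ z, newVar A β z ∈ T →
        ∃ χ, IsContinuationAlong (chartPath A β b z) ψ χ ∧ F z = χ z := by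
  classical
  have hpath : ∀ z, newVar A β z ∈ T → ∀ t, chartPath A β b z t ∈ Ω := fun z hz t =>
    hR ((isApproach_chartPath hT hb hbi hz).mem t)
  have hex : ∀ z, ∃ χ, newVar A β z ∈ T → IsContinuationAlong (chartPath A β b z) ψ χ := by
    intro z
    by_cases hz : newVar A β z ∈ T
    · obtain ⟨χ, hχ⟩ := (f.rebase _ ψ hψ).continuable (chartPath A β b z) (chartPath_zero z)
        (hpath z hz)
      exact ⟨χ, fun _ => hχ⟩
    · exact ⟨0, fun h => absurd h hz⟩
  choose χ hχ using hex
  -- The branch at `z` is the value of the germ obtained along the chart path ending at `z`. Fixing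
  -- one path per point makes it single-valued.
  refine ⟨fun z => χ z z, fun z hz => ⟨χ z, ?_, ?_⟩, fun z hz => ⟨χ z, hχ z hz, rfl⟩⟩
  · rw [← isGermAt_rebase_iff (h := hψ)]
    exact ⟨_, chartPath_zero z, chartPath_one (hT.ne_zero _ hz), hpath z hz, hχ z hz⟩
  -- Pulled back by the exponential chart, the paths become genuine segments from `b`, so
  -- `eventually_eq_of_segPath` compares the germs at nearby end points.
  · have pull : ∀ z, newVar A β z ∈ T →
        IsContinuationAlong (segPath b fun i => lBranch 0 (newVar A β z i)) (ψ ∘ expChart A β)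
          (χ z ∘ expChart A β) := fun z hz =>
      (hχ z hz).comp_analytic analyticAt_expChart fun t => rfl
    have h1 := (tendsto_log_newVar (hT.ne_zero _ hz)).eventually
      (eventually_eq_of_segPath (pull z hz))
    rw [eventually_nhdsWithin_iff] at h1
    filter_upwards [h1, (hT.isOpen.preimage continuous_newVar).mem_nhds hz] with z' h2 h3 h4
    have h5 := h2 h4 _ (pull z' h3)
    simp only [Function.comp_apply] at h5
    rwa [expChart_log (hT.ne_zero _ h3)] at h5

/-- A branch of a sum is a sum of branches. -/
theorem exists_isBranchOn_split (hT : IsLogConvex T)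
    (hb : (fun i => Complex.exp (b i)) ∈ T) (hbi : ∀ i, (b i).im = Real.pi) {f g : MultiFun n Ω}
    {hfg : f.base = g.base} {F : (Fin n → ℂ) → ℂ}
    (hF : (f.sum g hfg).IsBranchOn {z | newVar A β z ∈ T} (fun i z => newVar A β z i) F) :
    ∃ F₁ F₂, f.IsBranchOn {z | newVar A β z ∈ T} (fun i z => newVar A β z i) F₁ ∧
      g.IsBranchOn {z | newVar A β z ∈ T} (fun i z => newVar A β z i) F₂ ∧
      ∀ z, newVar A β z ∈ T → F z = F₁ z + F₂ z := by
  have hR : {z | newVar A β z ∈ T} ⊆ Ω := fun z hz => by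
    obtain ⟨ψ, hψ, -⟩ := hF z hz
    exact hψ.mem
  have hb' : expChart A β b ∈ {z | newVar A β z ∈ T} := by
    change newVar A β (expChart A β b) ∈ T
    rwa [newVar_expChart]
  obtain ⟨γ, h1, h2, h3, h4⟩ := (hF.analyticAt hb'
    ((isCutStar_of_isLogConvex hT hb hbi).continuousAt hb')).1
  -- The path that yields the germ of `F` at the centre is used for both summands. Any other pair of
  -- paths could give sheets that do not add up to `F`.
  obtain ⟨ψ₁, hψ₁⟩ := f.continuable γ h1 h3
  obtain ⟨ψ₂, hψ₂⟩ := g.continuable γ (h1.trans hfg) h3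
  have h5 : F =ᶠ[𝓝 (expChart A β b)] ψ₁ + ψ₂ := by
    rw [← h2]; exact h4.unique (hψ₁.add hψ₂) .rfl
  obtain ⟨F₁, hF₁, hF₁'⟩ := exists_isBranchOn hT hR hb hbi f ⟨γ, h1, h2, h3, hψ₁⟩
  obtain ⟨F₂, hF₂, hF₂'⟩ := exists_isBranchOn hT hR hb hbi g ⟨γ, h1.trans hfg, h2, h3, hψ₂⟩
  refine ⟨F₁, F₂, hF₁, hF₂, fun z hz => ?_⟩
  obtain ⟨χ₁, k1, k2⟩ := hF₁' z hz
  obtain ⟨χ₂, k3, k4⟩ := hF₂' z hz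
  obtain ⟨χ, k5, k6⟩ := hF.exists_continuation (isApproach_chartPath hT hb hbi hz)
  rw [← chartPath_zero z] at h5
  have k7 := (k5.unique (k1.add k3) h5).self_of_nhds
  rw [chartPath_one (hT.ne_zero _ hz)] at k6 k7
  rw [k6.self_of_nhds (by simp [Real.pi_pos]), k7, k2, k4]
  rfl

end MultiFun

namespace MultiFun

variable {n : ℕ} {Ω : Set (Fin n → ℂ)}

/-! ## Sums of functions with regular singularities -/

/-- The punctured polydisc in the variables `ζ`. -/
def polydiscRegion (δ : Fin n → Bool) (r : Fin n → ℝ) : Set (Fin n → ℂ) :=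
  {ζ | ∀ i, if δ i then r i < ‖ζ i‖ else 0 < ‖ζ i‖ ∧ ‖ζ i‖ < r i}

/-- The bounds on |ζ_i| become half-space conditions on the real parts of the logarithms. -/
theorem isLogConvex_polydiscRegion {δ : Fin n → Bool} {r : Fin n → ℝ} (hr : ∀ i, 0 < r i) :
    IsLogConvex (polydiscRegion δ r) where
  isOpen := by
    have : polydiscRegion δ r =
        ⋂ i, {ζ : Fin n → ℂ | if δ i then r i < ‖ζ i‖ else 0 < ‖ζ i‖ ∧ ‖ζ i‖ < r i} := by
      ext ζ; simp [polydiscRegion]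
    rw [this]
    refine isOpen_iInter_of_finite fun i => ?_
    have hc : Continuous fun ζ : Fin n → ℂ => ‖ζ i‖ := by fun_prop
    by_cases h : δ i
    · simp only [h, if_true]; exact isOpen_lt continuous_const hc
    · simp only [h]
      exact (isOpen_lt continuous_const hc).inter (isOpen_lt hc continuous_const)
  ne_zero := by
    intro ζ hζ i
    have := hζ i
    split_ifs at this
    · exact norm_pos_iff.mp ((hr i).trans this)
    · exact norm_pos_iff.mp this.1
  convex := by
    have : {x : Fin n → ℂ | (fun i => Complex.exp (x i)) ∈ polydiscRegion δ r} =
        ⋂ i, {x : Fin n → ℂ | if δ i then Real.log (r i) < (x i).re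
          else (x i).re < Real.log (r i)} := by
      ext x
      simp only [polydiscRegion, Set.mem_ofPred_eq, Set.mem_iInter, Complex.norm_exp,
        Real.exp_pos, true_and, Real.lt_log_iff_exp_lt (hr _), Real.log_lt_iff_lt_exp (hr _)]
    rw [this]
    refine convex_iInter fun i => ?_
    have hl : IsLinearMap ℝ fun x : Fin n → ℂ => (x i).re :=
      ⟨fun x y => by simp, fun c x => by simp⟩
    by_cases h : δ i
    · simp only [h, if_true]; exact convex_halfSpace_gt hl _
    · simp only [h]; exact convex_halfSpace_lt hl _

theorem exists_mem_polydiscRegion {δ : Fin n → Bool} {r : Fin n → ℝ} (hr : ∀ i, 0 < r i) :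
    ∃ b : Fin n → ℂ, (fun i => Complex.exp (b i)) ∈ polydiscRegion δ r ∧
      ∀ i, (b i).im = Real.pi := by
  refine ⟨fun i => ⟨if δ i then Real.log (r i) + 1 else Real.log (r i) - 1, Real.pi⟩, fun i => ?_,
    fun i => rfl⟩
  simp only [Complex.norm_exp, Real.exp_pos, true_and]
  split_ifs
  · rw [Real.exp_add, Real.exp_log (hr i)]
    exact lt_mul_of_one_lt_right (hr i) (Real.one_lt_exp_iff.mpr one_pos)
  · rw [Real.exp_sub, Real.exp_log (hr i)]
    exact div_lt_self (hr i) (Real.one_lt_exp_iff.mpr one_pos)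

theorem exponents_mono {E E' : Finset ℂ} (h : E ⊆ E') (d : Bool) :
    exponents E d ⊆ exponents E' d := fun _ ⟨e, he, m, hm⟩ => ⟨e, h he, m, hm⟩

/-- A regular expansion remains one with larger sets of exponents and more logarithms. -/
theorem hasSum_extend_exponents {A : GL (Fin n) ℂ} {β : Fin n → ℂ} {δ : Fin n → Bool}
    {K K' : ℕ} {E E' : Fin n → Finset ℂ} (hK : K ≤ K') (hE : ∀ i, E i ⊆ E' i)
    (α : (∀ i, exponents (E i) (δ i)) × (Fin n → Fin (K + 1)) → ℂ) :
    ∃ α' : (∀ i, exponents (E' i) (δ i)) × (Fin n → Fin (K' + 1)) → ℂ,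
      ∀ (z : Fin n → ℂ) (y : ℂ),
        HasSum (fun q : (∀ i, exponents (E i) (δ i)) × (Fin n → Fin (K + 1)) =>
          α q * ∏ i, (Complex.exp ((q.1 i : ℂ) * lBranch 0 (newVar A β z i)) *
            lBranch 0 (newVar A β z i) ^ (q.2 i : ℕ))) y →
        HasSum (fun q : (∀ i, exponents (E' i) (δ i)) × (Fin n → Fin (K' + 1)) =>
          α' q * ∏ i, (Complex.exp ((q.1 i : ℂ) * lBranch 0 (newVar A β z i)) *
            lBranch 0 (newVar A β z i) ^ (q.2 i : ℕ))) y := by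
  let e : (∀ i, exponents (E i) (δ i)) × (Fin n → Fin (K + 1)) →
      (∀ i, exponents (E' i) (δ i)) × (Fin n → Fin (K' + 1)) := fun q =>
    (fun i => ⟨q.1 i, exponents_mono (hE i) _ (q.1 i).2⟩,
      fun i => Fin.castLE (by omega) (q.2 i))
  have he : Function.Injective e := by
    rintro ⟨a, s⟩ ⟨a', s'⟩ h
    rw [Prod.mk.injEq] at h
    refine Prod.ext (funext fun i => ?_) (funext fun i => ?_)
    · have h1 := congrArg Subtype.val (congrFun h.1 i)
      exact Subtype.ext h1
    · have h2 := congrArg Fin.val (congrFun h.2 i)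
      exact Fin.ext h2
  -- Coefficients at the new indices are zero, so the sum is unchanged under the injection of index
  -- sets.
  refine ⟨Function.extend e α 0, fun z y h => ?_⟩
  rw [← he.hasSum_iff]
  · convert h using 2 with q
    simp only [Function.comp_apply, he.extend_apply, e, Fin.val_castLE]
  · intro q hq
    rw [Function.extend_apply' _ _ _ hq, Pi.zero_apply, zero_mul]

theorem puncturedPolydisc_mono {A : GL (Fin n) ℂ} {β : Fin n → ℂ} {δ : Fin n → Bool}
    {r r' : Fin n → ℝ} (h : ∀ i, if δ i then r' i ≤ r i else r i ≤ r' i) :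
    puncturedPolydisc A β δ r ⊆ puncturedPolydisc A β δ r' := by
  intro z hz i
  have h1 := hz i
  have h2 := h i
  split_ifs at h1 h2 ⊢
  · exact h2.trans_lt h1
  · exact ⟨h1.1, h1.2.trans_le h2⟩

theorem exists_common_radius (δ : Fin n → Bool) {r r' : Fin n → ℝ} (hr : ∀ i, 0 < r i)
    (hr' : ∀ i, 0 < r' i) : ∃ s : Fin n → ℝ, (∀ i, 0 < s i) ∧
      (∀ i, if δ i then r i ≤ s i else s i ≤ r i) ∧
      ∀ i, if δ i then r' i ≤ s i else s i ≤ r' i := by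
  refine ⟨fun i => if δ i then max (r i) (r' i) else min (r i) (r' i), fun i => ?_, fun i => ?_,
    fun i => ?_⟩
  all_goals cases h : δ i <;> simp [h, hr i, hr' i]

/-- A sum of functions with regular singularities has a regular singularity. -/
theorem IsRegularSingularity.sum {f g : MultiFun n Ω} {hfg : f.base = g.base}
    {A : GL (Fin n) ℂ} {β : Fin n → ℂ} {δ : Fin n → Bool} (hf : f.IsRegularSingularity A β δ)
    (hg : g.IsRegularSingularity A β δ) : (f.sum g hfg).IsRegularSingularity A β δ := by
  obtain ⟨K₁, E₁, h₁⟩ := hf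
  obtain ⟨K₂, E₂, h₂⟩ := hg
  refine ⟨max K₁ K₂, fun i => E₁ i ∪ E₂ i, fun F ⟨r, hr, hF⟩ => ?_⟩
  obtain ⟨b, hb, hbi⟩ := exists_mem_polydiscRegion (δ := δ) hr
  obtain ⟨F₁, F₂, hF₁, hF₂, hadd⟩ :=
    exists_isBranchOn_split (isLogConvex_polydiscRegion hr) hb hbi hF
  obtain ⟨r₁, α₁, hr₁, hs₁⟩ := h₁ F₁ ⟨r, hr, hF₁⟩
  obtain ⟨r₂, α₂, hr₂, hs₂⟩ := h₂ F₂ ⟨r, hr, hF₂⟩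
  obtain ⟨α₁', hα₁⟩ := hasSum_extend_exponents (A := A) (β := β) (le_max_left K₁ K₂)
    (fun i => Finset.subset_union_left (s₁ := E₁ i) (s₂ := E₂ i)) α₁
  obtain ⟨α₂', hα₂⟩ := hasSum_extend_exponents (A := A) (β := β) (le_max_right K₁ K₂)
    (fun i => Finset.subset_union_right (s₁ := E₁ i) (s₂ := E₂ i)) α₂
  obtain ⟨s, hs0, hs1, hs2⟩ := exists_common_radius δ hr₁ hr₂
  -- A second adjustment of the radii, because the splitting of `F` is known only on the original
  -- polydisc of radii `r`.
  obtain ⟨s', hs0', hs1', hs2'⟩ := exists_common_radius δ hs0 hr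
  refine ⟨s', α₁' + α₂', hs0', fun z hz => ?_⟩
  have hzs := puncturedPolydisc_mono hs1' hz
  rw [hadd z (puncturedPolydisc_mono hs2' hz)]
  simp only [Pi.add_apply, add_mul]
  exact (hα₁ z _ (hs₁ z (puncturedPolydisc_mono hs1 hzs))).add
    (hα₂ z _ (hs₂ z (puncturedPolydisc_mono hs2 hzs)))

/-! ## The regions of convergence of products -/

/-- The region `|z_1| > ⋯ > |z_k| > 0`. -/
def radialRegion (r : ℕ) : Set (Fin (r + 1) → ℂ) :=
  {z | StrictAnti (fun i => ‖z i‖) ∧ 0 < ‖z (Fin.last r)‖}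

theorem radialRegion_subset (r : ℕ) : radialRegion r ⊆ Mspace (r + 1) := by
  rintro z ⟨h1, h2⟩
  refine ⟨fun i => ?_, fun i j hij h => hij (h1.injective (congrArg norm h))⟩
  exact norm_pos_iff.mp (h2.trans_le (h1.antitone (Fin.le_last i)))

theorem radialRegion_eq (r : ℕ) :
    radialRegion r = {z | newVar (1 : GL (Fin (r + 1)) ℂ) 0 z ∈ radialRegion r} := by
  ext z
  simp [newVar]

/-- The ordering of the absolute values becomes a system of linear inequalities between real parts,
and positivity of the last one is automatic for exponentials. -/
theorem isLogConvex_radialRegion (r : ℕ) : IsLogConvex (radialRegion r) where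
  isOpen := by
    have : radialRegion r = (⋂ i, ⋂ j, {z : Fin (r + 1) → ℂ | i < j → ‖z j‖ < ‖z i‖}) ∩
        {z | 0 < ‖z (Fin.last r)‖} := by
      ext z
      simp only [radialRegion, StrictAnti, Set.mem_inter_iff, Set.mem_iInter, Set.mem_ofPred_eq]
    rw [this]
    refine (isOpen_iInter_of_finite fun i => isOpen_iInter_of_finite fun j => ?_).inter
      (isOpen_lt (by fun_prop) (by fun_prop))
    by_cases h : i < j
    · simp only [h, true_imp_iff]; exact isOpen_lt (by fun_prop) (by fun_prop)
    · simp [h]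
  ne_zero ζ hζ := (radialRegion_subset r hζ).1
  convex := by
    have : {x : Fin (r + 1) → ℂ | (fun i => Complex.exp (x i)) ∈ radialRegion r} =
        ⋂ i, ⋂ j, {x : Fin (r + 1) → ℂ | i < j → (x j).re - (x i).re < 0} := by
      ext x
      simp [radialRegion, StrictAnti, Complex.norm_exp]
    rw [this]
    refine convex_iInter fun i => convex_iInter fun j => ?_
    by_cases h : i < j
    · simp only [h, true_imp_iff]
      exact convex_halfSpace_lt ⟨fun x y => by simp; ring, fun c x => by simp; ring⟩ _
    · simp [h, convex_univ]

theorem exists_mem_radialRegion (r : ℕ) : ∃ b : Fin (r + 1) → ℂ,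
    (fun i => Complex.exp (b i)) ∈ radialRegion r ∧ ∀ i, (b i).im = Real.pi := by
  refine ⟨fun i => ⟨-(i : ℕ), Real.pi⟩, ⟨fun i j h => ?_, ?_⟩, fun i => rfl⟩
  · simp only [Complex.norm_exp, Real.exp_lt_exp, neg_lt_neg_iff, Nat.cast_lt]
    exact h
  · rw [Complex.norm_exp]; exact Real.exp_pos _

theorem exists_isCutStar_radialRegion (r : ℕ) :
    ∃ b ∈ radialRegion r, IsCutStar (radialRegion r) (fun i z => z i) b := by
  obtain ⟨b, hb, hbi⟩ := exists_mem_radialRegion r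
  have h1 := isCutStar_of_isLogConvex (A := 1) (β := 0) (isLogConvex_radialRegion r) hb hbi
  rw [← radialRegion_eq] at h1
  have h2 : (fun (i : Fin (r + 1)) z => newVar (1 : GL (Fin (r + 1)) ℂ) 0 z i) =
      fun i z => z i := by
    funext i z; simp [newVar]
  rw [h2] at h1
  refine ⟨_, ?_, h1⟩
  rw [radialRegion_eq]
  change newVar 1 0 (expChart 1 0 b) ∈ radialRegion r
  rwa [newVar_expChart]

/-! ## The cut space `M^2` -/

/-- A path from `-a` to `c` that avoids the cut except perhaps at its end point. -/
noncomputable def cutPath (c : ℂ) (a s t : ℝ) : ℂ :=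
  t * c - (1 - t) * a + s * a * t * (1 - t) * Complex.I

theorem cutPath_re (c : ℂ) (a s t : ℝ) : (cutPath c a s t).re = t * c.re - (1 - t) * a := by
  simp [cutPath]

theorem cutPath_im (c : ℂ) (a s t : ℝ) :
    (cutPath c a s t).im = t * (c.im + s * a * (1 - t)) := by
  simp [cutPath]; ring

theorem cutPath_one (c : ℂ) (a s : ℝ) : cutPath c a s 1 = c := by
  simp [cutPath]

/-- The imaginary bump lifts the path off the axis when Im c ≥ 0. When Im c < 0, the bound on s · a
makes the bump too small to bring the path back to the axis. At t = 0 the path is at the negative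
number -a. -/
theorem cutPath_off_cut {c : ℂ} {a s t : ℝ} (ha : 0 < a) (hs : 0 < s)
    (hsc : c.im < 0 → s * a < -c.im) (ht0 : 0 ≤ t) (ht1 : t < 1) :
    (cutPath c a s t).im ≠ 0 ∨ (cutPath c a s t).re < 0 := by
  rw [cutPath_re, cutPath_im]
  rcases ht0.eq_or_lt with rfl | ht
  · right; simpa using ha
  have hsa := mul_pos hs ha
  rcases lt_trichotomy c.im 0 with h | h | h
  · left
    refine (mul_neg_of_pos_of_neg ht ?_).ne
    nlinarith [hsc h, mul_pos hsa ht]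
  · left
    rw [h, zero_add]
    exact (mul_pos ht (mul_pos hsa (sub_pos.mpr ht1))).ne'
  · left
    exact (mul_pos ht (add_pos h (mul_pos hsa (sub_pos.mpr ht1)))).ne'

/-- If c lies on the cut, the bump makes the path arrive through the upper half-plane, where the
normalised argument is below π. -/
theorem cutPath_near {c : ℂ} {a s : ℝ} (ha : 0 < a) (hs : 0 < s) :
    ∀ᶠ t : unitInterval in 𝓝 1, |argPos (cutPath c a s t) - argPos c| < Real.pi := by
  by_cases h : c.im ≠ 0 ∨ c.re < 0
  · have h1 : ContinuousAt argPos (cutPath c a s ((1 : unitInterval) : ℝ)) := by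
      rw [Set.Icc.coe_one, cutPath_one]; exact continuousAt_argPos h
    have h2 : Continuous fun t : unitInterval => cutPath c a s t := by
      unfold cutPath; fun_prop
    have h3 : ContinuousAt (fun t : unitInterval => |argPos (cutPath c a s t) - argPos c|) 1 :=
      ((ContinuousAt.comp (f := fun t : unitInterval => cutPath c a s t) h1
        h2.continuousAt).sub continuousAt_const).abs
    refine h3.eventually_lt continuousAt_const ?_
    rw [Set.Icc.coe_one, cutPath_one]
    simp [Real.pi_pos]
  · have h0 := argPos_eq_zero h
    push Not at h
    rw [h0]
    have hpos : ∀ᶠ t : unitInterval in 𝓝 1, (0 : ℝ) < t :=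
      continuousAt_const.eventually_lt continuous_subtype_val.continuousAt (by norm_num)
    filter_upwards [hpos] with t ht
    rcases t.2.2.eq_or_lt with h1 | h1
    · rw [h1, cutPath_one, h0]; simp [Real.pi_pos]
    · have him : 0 < (cutPath c a s t).im := by
        rw [cutPath_im, h.1, zero_add]
        exact mul_pos ht (mul_pos (mul_pos hs ha) (sub_pos.mpr h1))
      rw [sub_zero, argPos_of_im_nonneg him.le, abs_of_nonneg (Complex.arg_nonneg_iff.mpr him.le)]
      exact Complex.arg_lt_pi_iff.mpr (Or.inr him.ne')

theorem mspace_two_iff {z : Fin 2 → ℂ} : z ∈ Mspace 2 ↔ ∀ i, cutsM2 i z ≠ 0 := by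
  simp only [Mspace, cutsM2, Fin.forall_fin_succ, Set.mem_ofPred_eq]
  simp [sub_eq_zero]
  tauto

theorem mem_mspace_two : (![-2, -1] : Fin 2 → ℂ) ∈ Mspace 2 := by
  rw [mspace_two_iff]
  intro i
  fin_cases i <;> norm_num [cutsM2]

/-- All three of z₁, z₂, z₁ - z₂ must avoid their cuts at once. `cutPath` is affine jointly in c and
a, so the difference of the paths with a = 2 and a = 1 is again such a path, with a = 1. A common
small s then serves all three. -/
theorem isCutStar_mspace_two : IsCutStar (Mspace 2) cutsM2 ![-2, -1] := by
  intro z hz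
  rw [mspace_two_iff] at hz
  -- As a ≤ 2, dividing by 3 leaves the bump height s · a at most two thirds of |Im c|.
  let m : ℂ → ℝ := fun c => if c.im < 0 then -c.im / 3 else 1
  have hm : ∀ c, 0 < m c := by
    intro c; simp only [m]; split_ifs with h
    · linarith
    · exact one_pos
  set s := min (m (cutsM2 0 z)) (min (m (cutsM2 1 z)) (m (cutsM2 2 z))) with hs
  have hs0 : 0 < s := lt_min (hm _) (lt_min (hm _) (hm _))
  have hsm : ∀ i, s ≤ m (cutsM2 i z) := by
    intro i
    fin_cases i
    · exact min_le_left _ _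
    · exact (min_le_right _ _).trans (min_le_left _ _)
    · exact (min_le_right _ _).trans (min_le_right _ _)
  let a : Fin 3 → ℝ := ![2, 1, 1]
  have ha : ∀ i, 0 < a i := by intro i; fin_cases i <;> simp [a]
  have ha2 : ∀ i, a i ≤ 2 := by intro i; fin_cases i <;> simp [a]
  have hsc : ∀ i, (cutsM2 i z).im < 0 → s * a i < -(cutsM2 i z).im := by
    intro i h
    have h1 := hsm i
    simp only [m, if_pos h] at h1
    nlinarith [mul_le_mul_of_nonneg_left (ha2 i) hs0.le]
  let γ : C(unitInterval, Fin 2 → ℂ) :=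
    ⟨fun t => ![cutPath (z 0) 2 s t, cutPath (z 1) 1 s t], by
      refine continuous_pi fun i => ?_
      fin_cases i <;> simp [cutPath] <;> fun_prop⟩
  have hγ : ∀ t i, cutsM2 i (γ t) = cutPath (cutsM2 i z) (a i) s t := by
    intro t i
    fin_cases i
    · simp [cutsM2, γ, a]
    · simp [cutsM2, γ, a]
    · simp [cutsM2, γ, a, cutPath]; ring
  have hγ1 : γ 1 = z := by
    funext i
    fin_cases i <;> simp [γ, cutPath]
  refine ⟨γ, ⟨fun t => ?_, fun t ht i => ?_, ?_⟩, ?_, hγ1⟩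
  · rw [mspace_two_iff]
    intro i
    rcases t.2.2.eq_or_lt with h | h
    · have : t = 1 := Subtype.ext h
      rw [this, hγ1]; exact hz i
    · rw [hγ]
      rcases cutPath_off_cut (ha i) hs0 (hsc i) t.2.1 h with h1 | h1
      · intro h0; rw [h0] at h1; simp at h1
      · intro h0; rw [h0] at h1; simp at h1
  · have h : (t : ℝ) < 1 := lt_of_le_of_ne t.2.2 fun h => ht (Subtype.ext h)
    have h1 := continuousAt_argPos (cutPath_off_cut (ha i) hs0 (hsc i) t.2.1 h)
    rw [← hγ] at h1
    have h2 : Continuous (cutsM2 i) := by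
      fin_cases i <;> simp [cutsM2] <;> fun_prop
    exact ContinuousAt.comp h1 h2.continuousAt
  · rw [Filter.eventually_all]
    intro i
    rw [hγ1]
    simp only [hγ]
    exact cutPath_near (ha i) hs0
  · funext i
    fin_cases i <;> simp [γ, cutPath]

end MultiFun

/-! ## Graded spaces, their graded duals and graded maps -/

namespace VOA

variable {V : Type u} [AddCommGroup V] [Module ℂ V] (𝒱 : VOA V)

theorem wt_eq_bot_of_lt_lowest {n : ℤ} (hn : n < 𝒱.lowest) : 𝒱.wt n = ⊥ :=
  Classical.choose_spec 𝒱.lower_bounded n hn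

theorem L_one_pow_eq_zero {h : ℤ} {v : V} (hv : v ∈ 𝒱.wt h) {j : ℕ}
    (hj : h - 𝒱.lowest < j) : ((𝒱.L 1) ^ j) v = 0 := by
  have h1 := 𝒱.L_one_pow_mem h v hv j
  rwa [𝒱.wt_eq_bot_of_lt_lowest (by omega), Submodule.mem_bot] at h1

theorem induction_homogeneous {p : V → Prop} (hwt : ∀ n, ∀ v ∈ 𝒱.wt n, p v)
    (h0 : p 0) (hadd : ∀ a b, p a → p b → p (a + b)) (v : V) : p v := by
  have hv : v ∈ ⨆ n, 𝒱.wt n := by rw [𝒱.internal.submodule_iSup_eq_top]; trivial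
  induction hv using Submodule.iSup_induction' with
  | mem i x hx => exact hwt i x hx
  | zero => exact h0
  | add x y _ _ hx hy => exact hadd x y hx hy

end VOA

namespace VData

variable {V : Type u} [AddCommGroup V] [Module ℂ V] {𝒱 : VOA V}

/-! ### Projections to weight spaces and separation by the graded dual -/

section Proj

variable (W : VData.{u, w} 𝒱)

theorem induction_homogeneous {W : VData.{u, w} 𝒱} (hW : DirectSum.IsInternal W.wt)
    {p : W → Prop} (hwt : ∀ n, ∀ x ∈ W.wt n, p x)
    (h0 : p 0) (hadd : ∀ a b, p a → p b → p (a + b)) (x : W) : p x := by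
  have hx : x ∈ ⨆ n, W.wt n := by rw [hW.submodule_iSup_eq_top]; trivial
  induction hx using Submodule.iSup_induction' with
  | mem i x hx => exact hwt i x hx
  | zero => exact h0
  | add x y _ _ hx hy => exact hadd x y hx hy

variable {W}

theorem proj_of_mem (hW : DirectSum.IsInternal W.wt) {n : ℂ} {x : W} (hx : x ∈ W.wt n) :
    (W.proj n x : W) = x := by
  have h : Function.Bijective (DirectSum.coeLinearMap W.wt) := hW
  unfold proj
  rw [dif_pos h]
  have : (LinearEquiv.ofBijective (DirectSum.coeLinearMap W.wt) h).symm x =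
      DirectSum.of (fun n => W.wt n) n ⟨x, hx⟩ := by
    rw [LinearEquiv.symm_apply_eq, LinearEquiv.ofBijective_apply]
    exact (DirectSum.coeLinearMap_of W.wt n ⟨x, hx⟩).symm
  rw [LinearMap.comp_apply, LinearEquiv.coe_coe, this]
  change ((DirectSum.of (fun n => W.wt n) n ⟨x, hx⟩ : ⨁ n, W.wt n) n : W) = x
  rw [DirectSum.of_eq_same]

theorem proj_coe (hW : DirectSum.IsInternal W.wt) {n : ℂ} (x : W.wt n) :
    W.proj n (x : W) = x :=
  Subtype.ext (proj_of_mem hW x.2)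

theorem eq_zero_of_proj_eq_zero (hW : DirectSum.IsInternal W.wt) {x : W}
    (hx : ∀ n, W.proj n x = 0) : x = 0 := by
  have h : Function.Bijective (DirectSum.coeLinearMap W.wt) := hW
  have h1 : (LinearEquiv.ofBijective (DirectSum.coeLinearMap W.wt) h).symm x = 0 := by
    ext n
    have := hx n
    unfold proj at this
    rw [dif_pos h] at this
    exact congrArg Subtype.val this
  simpa using h1

/-- A functional of weight `n` factors through the projection to `W_[n]`. -/
theorem dualWt_apply_proj (hW : DirectSum.IsInternal W.wt) {n : ℂ} {φ : Module.Dual ℂ W}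
    (hφ : φ ∈ W.dualWt n) (x : W) : φ (W.proj n x : W) = φ x := by
  induction x using induction_homogeneous hW with
  | hwt m x hx =>
    by_cases h : m = n
    · subst h; rw [proj_of_mem hW hx]
    · rw [W.proj_of_ne h x hx, hφ m h x hx]; simp
  | h0 => simp
  | hadd a b ha hb => simp only [map_add, Submodule.coe_add, ha, hb]

theorem comp_proj_mem_dualWt (n : ℂ) (f : Module.Dual ℂ (W.wt n)) :
    f.comp (W.proj n) ∈ W.dualWt n := by
  intro m hm x hx
  rw [LinearMap.comp_apply, W.proj_of_ne hm x hx, map_zero]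

variable (W) in
/-- Extension by zero of a functional on `W_[n]`. -/
noncomputable def extendDual (n : ℂ) : Module.Dual ℂ (W.wt n) →ₗ[ℂ] W.gdual where
  toFun f := ⟨f.comp (W.proj n), Submodule.mem_iSup_of_mem n (comp_proj_mem_dualWt n f)⟩
  map_add' _ _ := rfl
  map_smul' _ _ := rfl

theorem extendDual_apply (n : ℂ) (f : Module.Dual ℂ (W.wt n)) (x : W) :
    (W.extendDual n f : Module.Dual ℂ W) x = f (W.proj n x) := rfl

theorem extendDual_mem (n : ℂ) (f : Module.Dual ℂ (W.wt n)) :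
    W.extendDual n f ∈ W.contra.wt n := comp_proj_mem_dualWt n f

theorem extendDual_injective (hW : DirectSum.IsInternal W.wt) (n : ℂ) :
    Function.Injective (W.extendDual n) := by
  intro f g hfg
  ext x
  have := congrArg (fun φ : W.gdual => (φ : Module.Dual ℂ W) (x : W)) hfg
  simpa only [extendDual_apply, proj_coe hW] using this

theorem eq_zero_of_gdual (hW : DirectSum.IsInternal W.wt) {x : W}
    (hx : ∀ n, ∀ φ ∈ W.dualWt n, φ x = 0) : x = 0 := by
  refine eq_zero_of_proj_eq_zero hW fun n => ?_
  rw [← Module.forall_dual_apply_eq_zero_iff ℂ]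
  intro f
  exact hx n _ (comp_proj_mem_dualWt n f)

theorem ext_gdual (hW : DirectSum.IsInternal W.wt) {x y : W}
    (h : ∀ φ : W.gdual, (φ : Module.Dual ℂ W) x = (φ : Module.Dual ℂ W) y) : x = y := by
  rw [← sub_eq_zero]
  refine eq_zero_of_gdual hW fun n φ hφ => ?_
  rw [map_sub, h ⟨φ, Submodule.mem_iSup_of_mem n hφ⟩, sub_self]

theorem mem_wt_of_gdual (hW : DirectSum.IsInternal W.wt) {x : W} {n : ℂ}
    (h : ∀ m, m ≠ n → ∀ φ ∈ W.dualWt m, φ x = 0) : x ∈ W.wt n := by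
  have : x = W.proj n x := by
    rw [← sub_eq_zero]
    refine eq_zero_of_gdual hW fun m φ hφ => ?_
    by_cases hm : m = n
    · subst hm; rw [map_sub, dualWt_apply_proj hW hφ, sub_self]
    · rw [map_sub, h m hm φ hφ, hφ n (Ne.symm hm) _ (W.proj n x).2, sub_self]
  rw [this]; exact (W.proj n x).2

theorem gdual_induction {p : W.gdual → Prop}
    (hwt : ∀ n (φ : W.gdual), φ ∈ W.contra.wt n → p φ)
    (h0 : p 0) (hadd : ∀ a b, p a → p b → p (a + b)) (φ : W.gdual) : p φ := by
  obtain ⟨φ, hφ⟩ := φ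
  have hφ' := hφ
  unfold gdual at hφ
  induction hφ using Submodule.iSup_induction' with
  | mem i x hx => exact hwt i _ hx
  | zero => exact h0
  | add x y hx hy ihx ihy => exact hadd ⟨x, hx⟩ ⟨y, hy⟩ (ihx hx) (ihy hy)

theorem pairing_of_mem {n : ℂ} {φ : W.gdual} (hφ : φ ∈ W.contra.wt n) (y : W.Completion) :
    W.pairing φ y = (φ : Module.Dual ℂ W) (y n : W) :=
  finsum_eq_single _ n fun m hm => hφ m hm _ (y m).2

theorem pairing_add (φ ψ : W.gdual) (y : W.Completion) :
    W.pairing (φ + ψ) y = W.pairing φ y + W.pairing ψ y :=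
  finsum_add_distrib (W.pairing_finite φ y) (W.pairing_finite ψ y)

theorem pairing_smul (c : ℂ) (φ : W.gdual) (y : W.Completion) :
    W.pairing (c • φ) y = c * W.pairing φ y :=
  (mul_finsum' _ c (W.pairing_finite φ y)).symm

theorem pairing_zero (y : W.Completion) : W.pairing 0 y = 0 := by
  have := pairing_smul 0 (0 : W.gdual) y
  rwa [zero_smul, zero_mul] at this

end Proj

/-! ### Weight-preserving maps and local finiteness -/

section Graded

variable {P W : VData.{u, w} 𝒱}

/-- `f` preserves the weights. -/
def IsGraded (f : P →ₗ[ℂ] W) : Prop := ∀ n, ∀ x ∈ P.wt n, f x ∈ W.wt n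

/-- The extension of a map that preserves the weights to the completions. -/
def IsGraded.completion {f : P →ₗ[ℂ] W} (hf : IsGraded f) (y : P.Completion) : W.Completion :=
  fun n => ⟨f (y n), hf n _ (y n).2⟩

theorem IsGraded.map_proj {f : P →ₗ[ℂ] W} (hf : IsGraded f) (hP : DirectSum.IsInternal P.wt)
    (hW : DirectSum.IsInternal W.wt) (n : ℂ) (x : P) : f (P.proj n x) = W.proj n (f x) := by
  induction x using induction_homogeneous hP with
  | hwt m x hx =>
    by_cases h : m = n
    · subst h; rw [proj_of_mem hP hx, proj_of_mem hW (hf m x hx)]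
    · rw [P.proj_of_ne h x hx, W.proj_of_ne h _ (hf m x hx)]; simp
  | h0 => simp
  | hadd a b ha hb => simp only [map_add, Submodule.coe_add, ha, hb]

/-- Each weight component of the formal series `s` has finitely many terms. -/
def IsLocallyFinite (s : LogSeries W) : Prop :=
  ∀ m : ℂ, {q : ℂ × ℕ | W.proj m (s q.1 q.2) ≠ 0}.Finite

theorem IsLocallyFinite.add {s t : LogSeries W} (hs : IsLocallyFinite s)
    (ht : IsLocallyFinite t) : IsLocallyFinite (s + t) := by
  intro m
  refine ((hs m).union (ht m)).subset fun q hq => ?_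
  by_contra hne
  simp only [Set.mem_union, Set.mem_ofPred_eq, not_or, not_not] at hne
  exact hq (by rw [Pi.add_apply, Pi.add_apply, map_add, hne.1, hne.2, add_zero])

theorem isLocallyFinite_zero : IsLocallyFinite (0 : LogSeries W) := by
  intro m
  simp

/-- Only the power with n = e - m - 1 contributes to weight m, and it carries finitely many powers
of the logarithm. -/
theorem isLocallyFinite_of_homog {s : LogSeries W} {e : ℂ} (hs : ∀ n k, s n k ∈ W.wt (e - n - 1))
    (hlog : ∀ n, ∃ K : ℕ, ∀ k, K < k → s n k = 0) : IsLocallyFinite s := by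
  intro m
  obtain ⟨K, hK⟩ := hlog (e - m - 1)
  refine ((Set.finite_singleton (e - m - 1)).prod (Set.finite_Iic K)).subset ?_
  rintro ⟨n, k⟩ hq
  have h1 : n = e - m - 1 := by
    by_contra hne
    refine hq (W.proj_of_ne (fun h => hne ?_) _ (hs n k))
    rw [← h]; ring
  subst h1
  refine ⟨rfl, ?_⟩
  by_contra hk
  exact hq (by rw [hK k (not_le.mp hk), map_zero])

/-- Local finiteness is essential: `finsum` is 0 on infinite supports and would not commute with `f`
there. -/
theorem IsGraded.map_eval {f : P →ₗ[ℂ] W} (hf : IsGraded f) (hP : DirectSum.IsInternal P.wt)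
    (hW : DirectSum.IsInternal W.wt) (ℓ : ℂ) {s : LogSeries P} (hs : IsLocallyFinite s) :
    hf.completion (P.eval ℓ s) = W.eval ℓ (fun n k => f (s n k)) := by
  funext m
  let g : P.wt m →ₗ[ℂ] W.wt m := f.restrict fun x hx => hf m x hx
  have hg : ∀ x, g (P.proj m x) = W.proj m (f x) := fun x =>
    Subtype.ext (hf.map_proj hP hW m x)
  change g (P.eval ℓ s m) = _
  unfold eval
  rw [← LinearMap.toAddMonoidHom_coe, AddMonoidHom.map_finsum]
  · simp only [LinearMap.toAddMonoidHom_coe, map_smul, hg]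
  · refine (hs m).subset fun q hq => ?_
    intro h0
    exact hq (by simp only [h0, smul_zero])

/-- The functional `φ ∘ f`. -/
def IsGraded.pullback {f : P →ₗ[ℂ] W} (hf : IsGraded f) (φ : W.gdual) : P.gdual :=
  ⟨(φ : Module.Dual ℂ W).comp f, by
    induction φ using gdual_induction with
    | hwt n φ hφ =>
      exact Submodule.mem_iSup_of_mem n fun m hm x hx => hφ m hm _ (hf m x hx)
    | h0 => exact zero_mem _
    | hadd a b ha hb => exact add_mem ha hb⟩

theorem IsGraded.pairing_pullback {f : P →ₗ[ℂ] W} (hf : IsGraded f) (φ : W.gdual)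
    (y : P.Completion) : P.pairing (hf.pullback φ) y = W.pairing φ (hf.completion y) := rfl

theorem Y_isLocallyFinite (hW : DirectSum.IsInternal W.wt)
    (hlog : ∀ (v : V) (x : W), ∃ K : ℕ, ∀ (n : ℂ) (k : ℕ), K < k → W.Y v x n k = 0)
    (v : V) (x : W) : IsLocallyFinite (W.Y v x) := by
  induction v using 𝒱.induction_homogeneous with
  | hwt h v hv =>
    induction x using induction_homogeneous hW with
    | hwt m x hx =>
      obtain ⟨K, hK⟩ := hlog v x
      exact isLocallyFinite_of_homog (W.homog h v hv m x hx) fun n => ⟨K, hK n⟩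
    | h0 => rw [map_zero]; exact isLocallyFinite_zero
    | hadd a b ha hb => rw [map_add]; exact ha.add hb
  | h0 => rw [map_zero]; exact isLocallyFinite_zero
  | hadd a b ha hb => rw [map_add]; exact ha.add hb

end Graded

/-! ### The double contragredient -/

section DoubleContra

variable {W : VData.{u, w} 𝒱}

/-- Since L(1)^j v vanishes once its weight is below the lowest one, the range may be enlarged. This
freedom is used to bring double sums to a common shape. -/
theorem contraY_eq_sum {h : ℤ} {v : V} (hv : v ∈ 𝒱.wt h) {N : ℕ}
    (hN : (h - 𝒱.lowest).toNat + 1 ≤ N) (φ : W.gdual) (n : ℂ) (k : ℕ) :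
    W.contraY v φ n k = ∑ j ∈ Finset.range N,
      ((-1 : ℂ) ^ h * (-1 : ℂ) ^ k / (j.factorial : ℂ)) •
        W.adj (((𝒱.L 1) ^ j) v) φ (2 * h - n - 2 - j) k := by
  rw [W.contraY_of_mem h v hv]
  refine Finset.sum_subset (Finset.range_mono hN) fun j _ hj => ?_
  rw [Finset.mem_range, not_lt] at hj
  rw [𝒱.L_one_pow_eq_zero hv (by omega)]
  ext x
  simp [adj, adjFun]

theorem contraY_apply {h : ℤ} {v : V} (hv : v ∈ 𝒱.wt h) {N : ℕ}
    (hN : (h - 𝒱.lowest).toNat + 1 ≤ N) (φ : W.gdual) (n : ℂ) (k : ℕ) (x : W) :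
    (W.contraY v φ n k : Module.Dual ℂ W) x = ∑ j ∈ Finset.range N,
      ((-1 : ℂ) ^ h * (-1 : ℂ) ^ k / (j.factorial : ℂ)) *
        (φ : Module.Dual ℂ W) (W.Y (((𝒱.L 1) ^ j) v) x (2 * h - n - 2 - j) k) := by
  rw [contraY_eq_sum hv hN]
  simp [adj, adjFun]

/-- The expansion of (1 - 1)^m / m!, that is, the coefficient of x^m in e^{-x} e^{x}. -/
theorem sum_neg_one_pow_div_factorial (m : ℕ) (hm : m ≠ 0) :
    ∑ j ∈ Finset.range (m + 1),
      (-1 : ℂ) ^ j / ((j.factorial : ℂ) * ((m - j).factorial : ℂ)) = 0 := by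
  have h1 : ∀ j ∈ Finset.range (m + 1),
      (-1 : ℂ) ^ j / ((j.factorial : ℂ) * ((m - j).factorial : ℂ)) =
        (1 / (m.factorial : ℂ)) * ((-1 : ℂ) ^ j * (m.choose j : ℂ)) := by
    intro j hj
    rw [Finset.mem_range] at hj
    have h3 : (m.choose j : ℂ) * j.factorial * (m - j).factorial = m.factorial := by
      exact_mod_cast Nat.choose_mul_factorial_mul_factorial (n := m) (k := j) (by omega)
    have := Nat.factorial_ne_zero j
    have := Nat.factorial_ne_zero (m - j)
    have h4 : (m.choose j : ℂ) ≠ 0 := by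
      exact_mod_cast (Nat.choose_pos (by omega : j ≤ m)).ne'
    rw [← h3]
    field_simp
  rw [Finset.sum_congr rfl h1, ← Finset.mul_sum]
  have h6 : ∑ j ∈ Finset.range (m + 1), (-1 : ℂ) ^ j * (m.choose j : ℂ) = 0 := by
    exact_mod_cast congrArg (Int.cast : ℤ → ℂ) (Int.alternating_sum_range_choose_of_ne hm)
  rw [h6, mul_zero]

/-- The formula defining the contragredient vertex operators is an involution. -/
theorem sum_contraY_apply {h : ℤ} {v : V} (hv : v ∈ 𝒱.wt h) (φ : W.gdual) (n : ℂ) (k : ℕ)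
    (x : W) : ∑ j ∈ Finset.range ((h - 𝒱.lowest).toNat + 1),
      ((-1 : ℂ) ^ h * (-1 : ℂ) ^ k / (j.factorial : ℂ)) *
        (W.contraY (((𝒱.L 1) ^ j) v) φ (2 * h - n - 2 - j) k : Module.Dual ℂ W) x =
      (φ : Module.Dual ℂ W) (W.Y v x n k) := by
  set N := (h - 𝒱.lowest).toNat + 1 with hN
  let F : ℕ → ℂ := fun m => (φ : Module.Dual ℂ W) (W.Y (((𝒱.L 1) ^ m) v) x (n - m) k)
  have hF : ∀ m, N ≤ m → F m = 0 := by
    intro m hm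
    simp only [F]
    rw [𝒱.L_one_pow_eq_zero hv (by omega)]
    simp
  -- L(1)^j v has weight h - j, so the signs of the two contragredients combine to (-1)^j, turning
  -- the product of exponentials into e^{-xL(1)} e^{xL(1)} = 1.
  have sign : ∀ j : ℕ, (-1 : ℂ) ^ h * (-1 : ℂ) ^ (h - j) = (-1) ^ j := by
    intro j
    rw [zpow_sub₀ (by norm_num), zpow_natCast, ← mul_div_assoc, ← mul_zpow]
    simp only [mul_neg, mul_one, neg_neg, one_zpow]
    rcases Nat.even_or_odd j with h | h <;> simp [h]
  -- The inner range `2 * N - j` is longer than necessary, so that after extending j to 2N the pairs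
  -- fill the triangle j + i < 2N and can be regrouped by m = j + i.
  have step : ∀ j ∈ Finset.range N,
      ((-1 : ℂ) ^ h * (-1 : ℂ) ^ k / (j.factorial : ℂ)) *
        (W.contraY (((𝒱.L 1) ^ j) v) φ (2 * h - n - 2 - j) k : Module.Dual ℂ W) x =
      ∑ i ∈ Finset.range (2 * N - j),
        (-1 : ℂ) ^ j / ((j.factorial : ℂ) * (i.factorial : ℂ)) * F (j + i) := by
    intro j hj
    rw [Finset.mem_range] at hj
    rw [contraY_apply (𝒱.L_one_pow_mem h v hv j) (N := 2 * N - j) (by omega), Finset.mul_sum]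
    refine Finset.sum_congr rfl fun i _ => ?_
    have e1 : ((𝒱.L 1) ^ i) (((𝒱.L 1) ^ j) v) = ((𝒱.L 1) ^ (j + i)) v := by
      rw [← Module.End.mul_apply, ← pow_add, add_comm]
    have e2 : (2 * ((h - j : ℤ) : ℂ) - (2 * h - n - 2 - j) - 2 - i) = n - ((j + i : ℕ) : ℂ) := by
      push_cast; ring
    rw [e1, e2, ← sign j]
    have e3 : (-1 : ℂ) ^ k * (-1 : ℂ) ^ k = 1 := by rw [← mul_pow]; simp
    simp only [F]
    linear_combination ((-1 : ℂ) ^ h / (j.factorial : ℂ) * ((-1 : ℂ) ^ (h - j) / (i.factorial : ℂ)) *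
      (φ : Module.Dual ℂ W) (W.Y (((𝒱.L 1) ^ (j + i)) v) x (n - ((j + i : ℕ) : ℂ)) k)) * e3
  rw [Finset.sum_congr rfl step]
  have ext1 : ∑ j ∈ Finset.range N, ∑ i ∈ Finset.range (2 * N - j),
        (-1 : ℂ) ^ j / ((j.factorial : ℂ) * (i.factorial : ℂ)) * F (j + i) =
      ∑ j ∈ Finset.range (2 * N), ∑ i ∈ Finset.range (2 * N - j),
        (-1 : ℂ) ^ j / ((j.factorial : ℂ) * (i.factorial : ℂ)) * F (j + i) := by
    refine Finset.sum_subset (Finset.range_mono (by omega)) fun j _ hj => ?_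
    rw [Finset.mem_range, not_lt] at hj
    exact Finset.sum_eq_zero fun i _ => by rw [hF _ (by omega), mul_zero]
  have inner : ∀ j ∈ Finset.range (2 * N), ∑ i ∈ Finset.range (2 * N - j),
        (-1 : ℂ) ^ j / ((j.factorial : ℂ) * (i.factorial : ℂ)) * F (j + i) =
      ∑ m ∈ Finset.Ico j (2 * N),
        (-1 : ℂ) ^ j / ((j.factorial : ℂ) * ((m - j).factorial : ℂ)) * F m := by
    intro j _
    rw [Finset.sum_Ico_eq_sum_range]
    simp only [Nat.add_sub_cancel_left]
  rw [ext1, Finset.sum_congr rfl inner,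
    Finset.sum_comm' (s' := fun m => Finset.range (m + 1)) (t' := Finset.range (2 * N))
      (by intro j m; simp only [Finset.mem_range, Finset.mem_Ico]; omega)]
  simp only [← Finset.sum_mul]
  rw [Finset.sum_eq_single 0]
  · simp [F]
  · intro m _ hm
    rw [sum_neg_one_pow_div_factorial m hm, zero_mul]
  · intro h0
    exact absurd (Finset.mem_range.mpr (by omega)) h0

end DoubleContra

end VData

namespace VData

variable {V : Type u} [AddCommGroup V] [Module ℂ V] {𝒱 : VOA V}

/-! ### Weight spaces as generalized eigenspaces of `L(0)` -/

theorem L_zero_mem {W : VData.{u, w} 𝒱} {m : ℂ} {x : W} (hx : x ∈ W.wt m) : W.L 0 x ∈ W.wt m := by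
  have := W.homog 2 𝒱.ω 𝒱.ω_mem m x hx ((0 : ℤ) + 1) 0
  have e : m + ((2 : ℤ) : ℂ) - ((0 : ℤ) + 1) - 1 = m := by push_cast; ring
  rwa [e] at this

theorem pow_L_zero_sub_mem {W : VData.{u, w} 𝒱} {m : ℂ} (n : ℂ) (K : ℕ) {x : W} (hx : x ∈ W.wt m) :
    ((W.L 0 - n • (1 : Module.End ℂ W)) ^ K) x ∈ W.wt m := by
  induction K with
  | zero => simpa using hx
  | succ K ih =>
    rw [pow_succ', Module.End.mul_apply, LinearMap.sub_apply]
    exact sub_mem (L_zero_mem ih) (Submodule.smul_mem _ n ih)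

/-- A component of weight m ≠ n would lie in the generalized eigenspaces of L(0) for both m and n,
which meet only in 0. -/
theorem mem_wt_of_L_zero {W : VData.{u, w} 𝒱} {g : V ≃ₗ[ℂ] V} (hW : IsTwistedModule g W)
    {n : ℂ} {K : ℕ} {x : W} (hx : ((W.L 0 - n • (1 : Module.End ℂ W)) ^ K) x = 0) :
    x ∈ W.wt n := by
  have key : ∀ m, m ≠ n → W.proj m x = 0 := by
    intro m hm
    have hgr : IsGraded ((W.L 0 - n • (1 : Module.End ℂ W)) ^ K) :=
      fun r y hy => pow_L_zero_sub_mem n K hy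
    have h1 := hgr.map_proj hW.internal hW.internal m x
    rw [hx, map_zero, Submodule.coe_zero] at h1
    obtain ⟨K', -, h2⟩ := hW.L_zero_grading m _ (W.proj m x).2
    have h3 := Submodule.disjoint_def.mp ((W.L 0).disjoint_genEigenspace hm K' K) (W.proj m x : W)
      (Module.End.mem_genEigenspace_nat.mpr h2) (Module.End.mem_genEigenspace_nat.mpr h1)
    exact Subtype.ext h3
  have : x = W.proj n x := by
    rw [← sub_eq_zero]
    refine eq_zero_of_proj_eq_zero hW.internal fun m => ?_
    by_cases hm : m = n
    · subst hm; rw [map_sub, proj_coe hW.internal, sub_self]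
    · rw [map_sub, key m hm, W.proj_of_ne (Ne.symm hm) _ (W.proj n x).2, sub_self]
  rw [this]; exact (W.proj n x).2

/-- Module maps commute with L(0), a coefficient of the conformal element, and so respect its
generalized eigenspaces. -/
theorem isGraded_of_isModuleMap {W W' : VData.{u, w} 𝒱} {g g' : V ≃ₗ[ℂ] V}
    (hW : IsTwistedModule g W) (hW' : IsTwistedModule g' W') {f : W →ₗ[ℂ] W'}
    (hf : IsModuleMap W W' f) : IsGraded f := by
  intro n x hx
  obtain ⟨K, -, hK⟩ := hW.L_zero_grading n x hx
  refine mem_wt_of_L_zero hW' (K := K) ?_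
  have comm : ∀ (K : ℕ) (x : W), f (((W.L 0 - n • (1 : Module.End ℂ W)) ^ K) x) =
      ((W'.L 0 - n • (1 : Module.End ℂ W')) ^ K) (f x) := by
    intro K
    induction K with
    | zero => intro x; rfl
    | succ K ih =>
      intro x
      rw [pow_succ, Module.End.mul_apply, ih, pow_succ, Module.End.mul_apply]
      congr 1
      rw [LinearMap.sub_apply, map_sub, LinearMap.sub_apply, LinearMap.smul_apply, map_smul]
      congr 1
      exact hf 𝒱.ω x _ 0
  rw [← comm, hK, map_zero]

/-- A twisted module that is equivalent to its double contragredient has finite-dimensional weight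
spaces. -/
theorem finiteDimensional_wt {W : VData.{u, w} 𝒱} {g g' g'' : V ≃ₗ[ℂ] V}
    (hW : IsTwistedModule g W) (hW' : IsTwistedModule g' W.contra)
    (hW'' : IsTwistedModule g'' W.contra.contra) (h : IsEquivalent W W.contra.contra) (n : ℂ) :
    FiniteDimensional ℂ (W.wt n) := by
  obtain ⟨e, he⟩ := h
  have hsymm : IsModuleMap W.contra.contra W e.symm.toLinearMap := by
    intro v x n k
    apply e.injective
    have := he v (e.symm x) n k
    simp only [LinearEquiv.coe_coe, LinearEquiv.apply_symm_apply] at this ⊢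
    exact this.symm
  have dual_le : ∀ U : VData.{u, w} 𝒱, DirectSum.IsInternal U.wt →
      Module.rank ℂ (Module.Dual ℂ (U.wt n)) ≤ Module.rank ℂ (U.contra.wt n) := by
    intro U hU
    let F : Module.Dual ℂ (U.wt n) →ₗ[ℂ] U.contra.wt n :=
      LinearMap.codRestrict (U.contra.wt n) (U.extendDual n) (extendDual_mem n)
    refine LinearMap.rank_le_of_injective F fun a b hab => ?_
    exact extendDual_injective hU n (congrArg Subtype.val hab)
  have h2 : Module.rank ℂ (W.contra.contra.wt n) ≤ Module.rank ℂ (W.wt n) := by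
    let F : W.contra.contra.wt n →ₗ[ℂ] W.wt n :=
      e.symm.toLinearMap.restrict fun x hx => isGraded_of_isModuleMap hW'' hW hsymm n x hx
    refine LinearMap.rank_le_of_injective F fun a b hab => ?_
    exact Subtype.ext (e.symm.injective (congrArg Subtype.val hab))
  by_contra hfd
  have hinf : Cardinal.aleph0 ≤ Module.rank ℂ (W.wt n) := by
    rw [← not_lt, Module.rank_lt_aleph0_iff]; exact hfd
  -- Passing to the dual strictly raises an infinite dimension. Doing so twice contradicts the
  -- embedding of the double contragredient's weight space into the original one.
  have h3 : Module.rank ℂ (W.wt n) < Module.rank ℂ (W.contra.wt n) := by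
    refine lt_of_lt_of_le ?_ (dual_le W hW.internal)
    simpa using lift_rank_lt_rank_dual hinf
  have h4 : Module.rank ℂ (W.contra.wt n) < Module.rank ℂ (W.contra.contra.wt n) := by
    refine lt_of_lt_of_le ?_ (dual_le W.contra hW'.internal)
    simpa using lift_rank_lt_rank_dual (hinf.trans h3.le)
  exact absurd (h3.trans h4) (not_lt.mpr h2)

/-! ### Transposes -/

theorem eq_extendDual {W : VData.{u, w} 𝒱} (hW : DirectSum.IsInternal W.wt) {n : ℂ} {φ : W.gdual}
    (hφ : φ ∈ W.contra.wt n) :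
    φ = W.extendDual n ((φ : Module.Dual ℂ W).comp (W.wt n).subtype) := by
  apply Subtype.ext
  ext x
  rw [extendDual_apply]
  exact (dualWt_apply_proj hW hφ x).symm

/-- If the weight spaces are finite-dimensional, then the double graded dual consists of evaluations. -/
theorem exists_eq_eval {W : VData.{u, w} 𝒱} (hW : DirectSum.IsInternal W.wt)
    (hfd : ∀ n, FiniteDimensional ℂ (W.wt n)) (θ : W.contra.gdual) :
    ∃ x : W, ∀ φ : W.gdual, (θ : Module.Dual ℂ W.contra) φ = (φ : Module.Dual ℂ W) x := by
  induction θ using gdual_induction with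
  | hwt n θ hθ =>
    have := hfd n
    let Θ : Module.Dual ℂ (Module.Dual ℂ (W.wt n)) :=
      (θ : Module.Dual ℂ W.contra).comp (W.extendDual n)
    obtain ⟨x, hx⟩ := (Module.bijective_dual_eval ℂ (W.wt n)).2 Θ
    refine ⟨x, fun φ => ?_⟩
    induction φ using gdual_induction with
    | hwt m φ hφ =>
      by_cases h : m = n
      · subst h
        have h1 := LinearMap.congr_fun hx ((φ : Module.Dual ℂ W).comp (W.wt m).subtype)
        change (φ : Module.Dual ℂ W) x = (θ : Module.Dual ℂ W.contra) (W.extendDual m _) at h1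
        rw [h1, ← eq_extendDual hW hφ]
      · exact (hθ m h φ hφ).trans (hφ n (Ne.symm h) _ x.2).symm
    | h0 => exact map_zero (θ : Module.Dual ℂ W.contra)
    | hadd a b ha hb =>
      have h1 : (θ : Module.Dual ℂ W.contra) (a + b) =
          (θ : Module.Dual ℂ W.contra) a + (θ : Module.Dual ℂ W.contra) b :=
        map_add (θ : Module.Dual ℂ W.contra) _ _
      rw [h1, ha, hb]; rfl
  | h0 => exact ⟨0, fun φ => by rw [map_zero]; rfl⟩
  | hadd a b ha hb =>
    obtain ⟨x, hx⟩ := ha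
    obtain ⟨y, hy⟩ := hb
    refine ⟨x + y, fun φ => ?_⟩
    rw [map_add, ← hx, ← hy]; rfl

/-- The transpose `X' → W` of a module map `W' → X`, where `W` has finite-dimensional weight
spaces. -/
theorem exists_transpose {W X : VData.{u, w} 𝒱} (hW : DirectSum.IsInternal W.wt)
    (hfd : ∀ n, FiniteDimensional ℂ (W.wt n)) (Λ : W.contra →ₗ[ℂ] X) (hgr : IsGraded Λ)
    (hΛ : IsModuleMap W.contra X Λ) :
    ∃ f : X.contra →ₗ[ℂ] W, IsModuleMap X.contra W f ∧ IsGraded f ∧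
      ∀ (ψ : X.gdual) (φ : W.gdual),
        (φ : Module.Dual ℂ W) (f ψ) = (ψ : Module.Dual ℂ X) (Λ φ) := by
  choose F hF using fun ψ : X.gdual => exists_eq_eval hW hfd (hgr.pullback ψ)
  have hF' : ∀ (ψ : X.gdual) (φ : W.gdual),
      (φ : Module.Dual ℂ W) (F ψ) = (ψ : Module.Dual ℂ X) (Λ φ) := fun ψ φ => (hF ψ φ).symm
  let f : X.gdual →ₗ[ℂ] W :=
    { toFun := F
      map_add' := fun a b => ext_gdual hW fun φ => by rw [map_add, hF', hF', hF']; rfl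
      map_smul' := fun c a => ext_gdual hW fun φ => by rw [map_smul, hF', hF']; rfl }
  refine ⟨f, ?_, ?_, hF'⟩
  · intro v (ψ : X.gdual) n k
    change F (X.contraY v ψ n k) = W.Y v (F ψ) n k
    induction v using 𝒱.induction_homogeneous with
    | hwt h v hv =>
      refine ext_gdual hW fun φ => ?_
      -- The action on W is rewritten as a contragredient of a contragredient. Both sides then carry
      -- the same outer formula and match term by term, since `Λ` is a module map.
      rw [hF', contraY_apply hv le_rfl, ← sum_contraY_apply hv φ n k (F ψ)]
      refine Finset.sum_congr rfl fun j _ => ?_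
      congr 1
      rw [hF']
      exact congrArg _ (hΛ _ φ _ _).symm
    | h0 =>
      simp only [map_zero, LinearMap.zero_apply, Pi.zero_apply]
      exact map_zero f
    | hadd a b ha hb =>
      simp only [map_add, LinearMap.add_apply, Pi.add_apply]
      rw [← ha, ← hb]
      exact map_add f _ _
  · intro n ψ hψ
    refine mem_wt_of_gdual hW fun m hm φ hφ => ?_
    exact (hF' ψ ⟨φ, Submodule.mem_iSup_of_mem m hφ⟩).trans (hψ m hm _ (hgr m _ hφ))

end VData

/-! ## The universal property of the tensor product -/

section Box

variable {V : Type u} [AddCommGroup V] [Module ℂ V] {𝒱 : VOA V}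

/-- Evaluation at `x` as a functional on the contragredient. -/
def VData.evalFun {X : VData.{u, w} 𝒱} (x : X) : Module.Dual ℂ X.contra :=
  show X.gdual →ₗ[ℂ] ℂ from
  { toFun := fun φ => (φ : Module.Dual ℂ X) x
    map_add' := fun _ _ => rfl
    map_smul' := fun _ _ => rfl }

theorem VData.evalFun_zero {X : VData.{u, w} 𝒱} : VData.evalFun (0 : X) = 0 :=
  LinearMap.ext fun (φ : X.gdual) => map_zero (φ : Module.Dual ℂ X)

theorem VData.evalFun_add {X : VData.{u, w} 𝒱} (x y : X) :
    VData.evalFun (x + y) = VData.evalFun x + VData.evalFun y :=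
  LinearMap.ext fun (φ : X.gdual) => map_add (φ : Module.Dual ℂ X) x y

theorem VData.evalFun_mem {X : VData.{u, w} 𝒱} (hX : DirectSum.IsInternal X.wt) (x : X) :
    VData.evalFun x ∈ X.contra.gdual := by
  induction x using VData.induction_homogeneous hX with
  | hwt n x hx =>
    exact Submodule.mem_iSup_of_mem n fun m hm φ hφ => hφ n (Ne.symm hm) x hx
  | h0 => rw [VData.evalFun_zero]; exact zero_mem _
  | hadd a b ha hb => rw [VData.evalFun_add]; exact add_mem ha hb

/-- Evaluation at `x`, as an element of the double graded dual. -/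
def VData.evalGdual {X : VData.{u, w} 𝒱} (hX : DirectSum.IsInternal X.wt) (x : X) :
    X.contra.gdual :=
  ⟨VData.evalFun x, VData.evalFun_mem hX x⟩

/-! ### The map w₃' ↦ λ_{I, w₃'} and its transpose -/

variable {C : TwClass.{u, w} 𝒱} {z : ℂ} {g₁ g₂ : V ≃ₗ[ℂ] V} {W₁ W₂ W₃ : VData.{u, w} 𝒱}
  {I : W₁ ⊗[ℂ] W₂ →ₗ[ℂ] W₃.Completion}

theorem lamFun_mem_hboxSpace (hI : IsPzProduct C z g₁ g₂ W₁ W₂ W₃ I) (φ : W₃.gdual) :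
    lamFun I φ ∈ hboxSpace C z g₁ g₂ W₁ W₂ :=
  Submodule.subset_span ⟨W₃, I, φ, hI, rfl⟩

/-- The map `w₃' ↦ λ_{I, w₃'}` from `W₃'` to `W₁ ⊠̃ W₂`. -/
noncomputable def lamMap (hI : IsPzProduct C z g₁ g₂ W₁ W₂ W₃ I) :
    W₃.contra →ₗ[ℂ] hbox C z g₁ g₂ W₁ W₂ :=
  show W₃.gdual →ₗ[ℂ] hboxSpace C z g₁ g₂ W₁ W₂ from
  { toFun := fun φ => ⟨lamFun I φ, lamFun_mem_hboxSpace hI φ⟩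
    map_add' := fun φ ψ => by
      apply Subtype.ext
      exact LinearMap.ext fun t => VData.pairing_add φ ψ _
    map_smul' := fun c φ => by
      apply Subtype.ext
      exact LinearMap.ext fun t => VData.pairing_smul c φ _ }

theorem lamMap_isGraded (hI : IsPzProduct C z g₁ g₂ W₁ W₂ W₃ I) :
    VData.IsGraded (lamMap hI) :=
  fun _ φ hφ => Submodule.subset_span ⟨W₃, I, φ, hI, hφ, rfl⟩

/-- If the default value 0 had been taken, the identity axiom would make the space zero, and then 0
itself would have the defining property. -/
theorem isHboxY_hboxY {g : V ≃ₗ[ℂ] V} (hX : IsTwistedModule g (hbox C z g₁ g₂ W₁ W₂)) :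
    IsHboxY C z g₁ g₂ W₁ W₂ (hboxY C z g₁ g₂ W₁ W₂) := by
  have h : ∃ T, IsHboxY C z g₁ g₂ W₁ W₂ T := by
    by_contra h
    have h0 : hboxY C z g₁ g₂ W₁ W₂ = 0 := by unfold hboxY; rw [dif_neg h]
    have hz : ∀ x : hboxSpace C z g₁ g₂ W₁ W₂, x = 0 := by
      intro x
      have h1 := hX.identity x (-1) 0
      have h2 : hboxY C z g₁ g₂ W₁ W₂ 𝒱.vac x (-1) 0 = x := h1.trans (if_pos ⟨rfl, rfl⟩)
      rw [h0] at h2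
      exact h2.symm
    refine h ⟨0, fun W₃ I φ hI y _ v n k => ?_⟩
    exact (congrArg Subtype.val (hz ⟨_, lamFun_mem_hboxSpace hI (W₃.contraY v φ n k)⟩)).symm
  unfold hboxY
  rw [dif_pos h]
  exact Classical.choose_spec h

theorem lamMap_isModuleMap {g : V ≃ₗ[ℂ] V} (hX : IsTwistedModule g (hbox C z g₁ g₂ W₁ W₂))
    (hI : IsPzProduct C z g₁ g₂ W₁ W₂ W₃ I) :
    IsModuleMap W₃.contra (hbox C z g₁ g₂ W₁ W₂) (lamMap hI) := fun v φ n k =>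
  Subtype.ext (isHboxY_hboxY hX W₃ I φ hI (lamMap hI φ) rfl v n k).symm

theorem hbox_induction {p : hbox C z g₁ g₂ W₁ W₂ → Prop}
    (hlam : ∀ (W₃ : VData.{u, w} 𝒱) (I : W₁ ⊗[ℂ] W₂ →ₗ[ℂ] W₃.Completion)
      (hI : IsPzProduct C z g₁ g₂ W₁ W₂ W₃ I) (φ : W₃.gdual), p (lamMap hI φ))
    (h0 : p 0) (hadd : ∀ a b, p a → p b → p (a + b)) (x : hbox C z g₁ g₂ W₁ W₂) : p x := by
  obtain ⟨x, hx⟩ := x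
  -- Scalars are carried along because p is not assumed closed under them; they are absorbed through
  -- c λ_{I,φ} = λ_{I,cφ}.
  have key : ∀ c : ℂ, p (c • (show hbox C z g₁ g₂ W₁ W₂ from ⟨x, hx⟩)) := by
    have hx' := hx
    unfold hboxSpace at hx
    induction hx using Submodule.span_induction with
    | mem y hy =>
      obtain ⟨W₃, I, φ, hI, rfl⟩ := hy
      intro c
      have e : lamMap hI (c • φ : W₃.gdual) = c • lamMap hI φ := map_smul (lamMap hI) c _
      have := hlam W₃ I hI (c • φ)
      rw [e] at this
      exact this
    | zero => intro c; rw [← smul_zero c] at h0; exact h0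
    | add a b ha hb iha ihb =>
      intro c
      have := hadd _ _ (iha ha c) (ihb hb c)
      rw [← smul_add] at this
      exact this
    | smul a y hy ih =>
      intro c
      have := ih hy (c * a)
      rw [mul_smul] at this
      exact this
  have := key 1
  rwa [one_smul] at this

theorem TensorAssumption.finiteDimensional (hT : TensorAssumption C z)
    (hC : ∀ g W, C g W → IsTwistedModule g W) {g : V ≃ₗ[ℂ] V} {W : VData.{u, w} 𝒱} (hW : C g W)
    (n : ℂ) : FiniteDimensional ℂ (W.wt n) :=
  VData.finiteDimensional_wt (hC g W hW) (hC _ _ (hT.contra_mem g W hW))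
    (hC _ _ (hT.contra_mem _ _ (hT.contra_mem g W hW))) (hT.double_contra g W hW) n

/-- `f` is the transpose of `w₃' ↦ λ_{I, w₃'}`. -/
structure IsBoxLift (hI : IsPzProduct C z g₁ g₂ W₁ W₂ W₃ I)
    (f : boxProd C z g₁ g₂ W₁ W₂ →ₗ[ℂ] W₃) : Prop where
  isModuleMap : IsModuleMap (boxProd C z g₁ g₂ W₁ W₂) W₃ f
  isGraded : VData.IsGraded f
  apply_eq : ∀ (ψ : (hbox C z g₁ g₂ W₁ W₂).gdual) (φ : W₃.gdual),
    (φ : Module.Dual ℂ W₃) (f ψ) =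
      (ψ : Module.Dual ℂ (hbox C z g₁ g₂ W₁ W₂)) (lamMap hI φ)

theorem exists_isBoxLift (hT : TensorAssumption C z) (hC : ∀ g W, C g W → IsTwistedModule g W)
    (h₁ : C g₁ W₁) (h₂ : C g₂ W₂) (hI : IsPzProduct C z g₁ g₂ W₁ W₂ W₃ I) :
    ∃ f, IsBoxLift hI f := by
  obtain ⟨f, h1, h2, h3⟩ := VData.exists_transpose (hC _ _ hI.1).internal
    (fun n => hT.finiteDimensional hC hI.1 n) (lamMap hI) (lamMap_isGraded hI)
    (lamMap_isModuleMap (hC _ _ (hT.hbox_mem g₁ g₂ W₁ W₂ h₁ h₂)) hI)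
  exact ⟨f, h1, h2, h3⟩

theorem boxMap_apply (hX : DirectSum.IsInternal (hbox C z g₁ g₂ W₁ W₂).wt) (t : W₁ ⊗[ℂ] W₂) {n : ℂ}
    {x : hboxSpace C z g₁ g₂ W₁ W₂} (hx : x ∈ (hbox C z g₁ g₂ W₁ W₂).wt n) :
    boxFun C z g₁ g₂ W₁ W₂ n t x = (x : Module.Dual ℂ (W₁ ⊗[ℂ] W₂)) t :=
  congrArg (fun y : hboxSpace C z g₁ g₂ W₁ W₂ => (y : Module.Dual ℂ (W₁ ⊗[ℂ] W₂)) t)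
    (VData.proj_of_mem hX hx)

/-- Pair with φ of weight m. For m = n both sides equal λ_{I,φ}(t), and for m ≠ n both vanish. -/
theorem IsBoxLift.map_boxMap {hI : IsPzProduct C z g₁ g₂ W₁ W₂ W₃ I}
    {f : boxProd C z g₁ g₂ W₁ W₂ →ₗ[ℂ] W₃} (hf : IsBoxLift hI f)
    (hX : DirectSum.IsInternal (hbox C z g₁ g₂ W₁ W₂).wt) (hW : DirectSum.IsInternal W₃.wt)
    (t : W₁ ⊗[ℂ] W₂) (n : ℂ) :
    f (boxMap C z g₁ g₂ W₁ W₂ t n : boxProd C z g₁ g₂ W₁ W₂) = (I t n : W₃) := by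
  refine VData.ext_gdual hW fun φ => ?_
  induction φ using VData.gdual_induction with
  | hwt m φ hφ =>
    refine (hf.apply_eq _ φ).trans ?_
    change boxFun C z g₁ g₂ W₁ W₂ n t (lamMap hI φ) = _
    by_cases h : m = n
    · subst h
      rw [boxMap_apply hX t (lamMap_isGraded hI m φ hφ)]
      exact VData.pairing_of_mem hφ _
    · exact (boxFun_mem C z g₁ g₂ W₁ W₂ n t m h _ (lamMap_isGraded hI m φ hφ)).trans
        (hφ n (Ne.symm h) _ (I t n).2).symm
  | h0 => rfl
  | hadd a b ha hb =>
    rw [Submodule.coe_add, LinearMap.add_apply, LinearMap.add_apply, ha, hb]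

/-- The components of the `⊠_{P(z)}(t)` span `W₁ ⊠ W₂`. -/
theorem boxProd_hom_ext (hX : DirectSum.IsInternal (hbox C z g₁ g₂ W₁ W₂).wt)
    (hfd : ∀ n, FiniteDimensional ℂ ((hbox C z g₁ g₂ W₁ W₂).wt n))
    {f f' : boxProd C z g₁ g₂ W₁ W₂ →ₗ[ℂ] W₃}
    (h : ∀ (t : W₁ ⊗[ℂ] W₂) (n : ℂ),
      f (boxMap C z g₁ g₂ W₁ W₂ t n : boxProd C z g₁ g₂ W₁ W₂) =
        f' (boxMap C z g₁ g₂ W₁ W₂ t n : boxProd C z g₁ g₂ W₁ W₂)) : f = f' := by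
  refine LinearMap.ext fun (ψ : (hbox C z g₁ g₂ W₁ W₂).gdual) => ?_
  induction ψ using VData.gdual_induction with
  | hwt n ψ hψ =>
    have := hfd n
    let B : (hbox C z g₁ g₂ W₁ W₂).wt n →ₗ[ℂ] Module.Dual ℂ (W₁ ⊗[ℂ] W₂) :=
      (hboxSpace C z g₁ g₂ W₁ W₂).subtype.comp ((hbox C z g₁ g₂ W₁ W₂).wt n).subtype
    have hB : Function.Injective B := fun a b hab => Subtype.ext (Subtype.ext hab)
    -- A finite-dimensional space of functionals on W₁ ⊗ W₂ has all its own functionals given by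
    -- evaluation at tensors.
    obtain ⟨t, ht⟩ := LinearMap.flip_surjective_iff₁.mpr hB
      ((ψ : Module.Dual ℂ (hbox C z g₁ g₂ W₁ W₂)).comp ((hbox C z g₁ g₂ W₁ W₂).wt n).subtype)
    have e : ψ = (boxMap C z g₁ g₂ W₁ W₂ t n : boxProd C z g₁ g₂ W₁ W₂) := by
      refine (VData.eq_extendDual hX hψ).trans ?_
      rw [← ht]
      rfl
    rw [e]
    exact h t n
  | h0 => exact (map_zero f).trans (map_zero f').symm
  | hadd a b ha hb =>
    exact (map_add f _ _).trans ((congrArg₂ (· + ·) ha hb).trans (map_add f' _ _).symm)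

/-- The functionals on `W₁ ⊠ W₂` are sums of pullbacks from the products. -/
theorem boxProd_gdual_induction (hX : DirectSum.IsInternal (hbox C z g₁ g₂ W₁ W₂).wt)
    (hfd : ∀ n, FiniteDimensional ℂ ((hbox C z g₁ g₂ W₁ W₂).wt n))
    (hlift : ∀ (W₃ : VData.{u, w} 𝒱) (I : W₁ ⊗[ℂ] W₂ →ₗ[ℂ] W₃.Completion)
      (hI : IsPzProduct C z g₁ g₂ W₁ W₂ W₃ I), ∃ f, IsBoxLift hI f)
    {p : (boxProd C z g₁ g₂ W₁ W₂).gdual → Prop}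
    (hp : ∀ (W₃ : VData.{u, w} 𝒱) (I : W₁ ⊗[ℂ] W₂ →ₗ[ℂ] W₃.Completion)
      (hI : IsPzProduct C z g₁ g₂ W₁ W₂ W₃ I) (f : boxProd C z g₁ g₂ W₁ W₂ →ₗ[ℂ] W₃)
      (hf : IsBoxLift hI f) (φ : W₃.gdual), p (hf.isGraded.pullback φ))
    (h0 : p 0) (hadd : ∀ a b, p a → p b → p (a + b)) (θ : (boxProd C z g₁ g₂ W₁ W₂).gdual) :
    p θ := by
  -- Evaluation at λ_{I,φ} is φ ∘ f by the transpose relation, and finite-dimensionality makes every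
  -- functional an evaluation.
  have key : ∀ x : hbox C z g₁ g₂ W₁ W₂, p (VData.evalGdual hX x) := by
    intro x
    induction x using hbox_induction with
    | hlam W₃ I hI φ =>
      obtain ⟨f, hf⟩ := hlift W₃ I hI
      have e : VData.evalGdual hX (lamMap hI φ) = hf.isGraded.pullback φ := by
        apply Subtype.ext
        exact LinearMap.ext fun ψ => (hf.apply_eq ψ φ).symm
      rw [e]
      exact hp W₃ I hI f hf φ
    | h0 =>
      have e : VData.evalGdual hX (0 : hbox C z g₁ g₂ W₁ W₂) = 0 := by
        apply Subtype.ext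
        exact LinearMap.ext fun (ψ : (hbox C z g₁ g₂ W₁ W₂).gdual) =>
          map_zero (ψ : Module.Dual ℂ (hbox C z g₁ g₂ W₁ W₂))
      rw [e]; exact h0
    | hadd a b ha hb =>
      have e : VData.evalGdual hX (a + b) = VData.evalGdual hX a + VData.evalGdual hX b := by
        apply Subtype.ext
        exact LinearMap.ext fun (ψ : (hbox C z g₁ g₂ W₁ W₂).gdual) =>
          map_add (ψ : Module.Dual ℂ (hbox C z g₁ g₂ W₁ W₂)) a b
      rw [e]; exact hadd _ _ ha hb
  obtain ⟨x, hx⟩ := VData.exists_eq_eval hX hfd θ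
  have e : θ = VData.evalGdual hX x := Subtype.ext (LinearMap.ext hx)
  rw [e]; exact key x

/-- An element of W₁ ⊠ W₂ is a functional on the span of the λ_{I,φ}, and its value at λ_{I,φ} is
φ(f y). The lifts f therefore jointly separate points. -/
theorem boxProd_ext (hlift : ∀ (W₃ : VData.{u, w} 𝒱) (I : W₁ ⊗[ℂ] W₂ →ₗ[ℂ] W₃.Completion)
      (hI : IsPzProduct C z g₁ g₂ W₁ W₂ W₃ I), ∃ f, IsBoxLift hI f)
    {y y' : boxProd C z g₁ g₂ W₁ W₂}
    (h : ∀ (W₃ : VData.{u, w} 𝒱) (I : W₁ ⊗[ℂ] W₂ →ₗ[ℂ] W₃.Completion)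
      (hI : IsPzProduct C z g₁ g₂ W₁ W₂ W₃ I) (f : boxProd C z g₁ g₂ W₁ W₂ →ₗ[ℂ] W₃),
      IsBoxLift hI f → f y = f y') : y = y' := by
  apply Subtype.ext
  refine LinearMap.ext fun x => ?_
  induction x using hbox_induction with
  | hlam W₃ I hI φ =>
    obtain ⟨f, hf⟩ := hlift W₃ I hI
    exact (hf.apply_eq y φ).symm.trans
      ((congrArg (φ : Module.Dual ℂ W₃) (h W₃ I hI f hf)).trans (hf.apply_eq y' φ))
  | h0 => exact (map_zero (Subtype.val y)).trans (map_zero (Subtype.val y')).symm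
  | hadd a b ha hb =>
    exact (map_add (Subtype.val y) a b).trans
      ((congrArg₂ (· + ·) ha hb).trans (map_add (Subtype.val y') a b).symm)

end Box

/-! ## The intertwining operator of the tensor product -/

section LogPolynomial

open Polynomial

/-- If `x ^ (-n - 1) p(log x)` is a term of a formal series, then the corresponding term of its `j`-th
derivative is `x ^ (-n - j - 1) p_j(log x)` with `p_j = logPolyDeriv n p j`. -/
noncomputable def logPolyDeriv (n : ℂ) (p : ℂ[X]) : ℕ → ℂ[X]
  | 0 => p
  | j + 1 => derivative (logPolyDeriv n p j) - C (n + j + 1) * logPolyDeriv n p j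

theorem logPolyDeriv_add (n : ℂ) (p q : ℂ[X]) (j : ℕ) :
    logPolyDeriv n (p + q) j = logPolyDeriv n p j + logPolyDeriv n q j := by
  induction j with
  | zero => rfl
  | succ j ih => simp only [logPolyDeriv, ih, derivative_add]; ring

theorem logPolyDeriv_C_mul (n c : ℂ) (p : ℂ[X]) (j : ℕ) :
    logPolyDeriv n (C c * p) j = C c * logPolyDeriv n p j := by
  induction j with
  | zero => rfl
  | succ j ih => simp only [logPolyDeriv, ih, derivative_C_mul]; ring

theorem logPolyDeriv_zero (n : ℂ) (j : ℕ) : logPolyDeriv n 0 j = 0 := by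
  have := logPolyDeriv_C_mul n 0 0 j
  simpa using this

/-- The recursion writes p_j' as p_{j+1} + (n + j + 1) p_j. By induction all derivatives of p vanish
at ℓ, and so does its Taylor expansion. -/
theorem eq_zero_of_eval_logPolyDeriv {n ℓ : ℂ} {p : ℂ[X]}
    (h : ∀ j, (logPolyDeriv n p j).eval ℓ = 0) : p = 0 := by
  have key : ∀ i j, (derivative^[i] (logPolyDeriv n p j)).eval ℓ = 0 := by
    intro i
    induction i with
    | zero => exact h
    | succ i ih =>
      intro j
      have e : derivative^[i + 1] (logPolyDeriv n p j) =
          derivative^[i] (logPolyDeriv n p (j + 1)) + C (n + j + 1) * derivative^[i] (logPolyDeriv n p j) := by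
        rw [logPolyDeriv, iterate_derivative_sub, iterate_derivative_C_mul, Function.iterate_succ_apply]
        ring
      rw [e, eval_add, eval_mul, ih, ih, mul_zero, add_zero]
  rw [← taylor_eq_zero ℓ]
  ext i
  have h1 := key i 0
  rw [taylor_coeff, coeff_zero]
  have h2 : ((i.factorial : ℂ)) * (hasseDeriv i p).eval ℓ = 0 := by
    have := congrArg (fun q => q p) (factorial_smul_hasseDeriv (R := ℂ) i)
    simp only [nsmul_eq_mul] at this
    rw [← h1, logPolyDeriv, ← this]
    simp
  exact (mul_eq_zero.mp h2).resolve_left (by exact_mod_cast i.factorial_ne_zero)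

theorem exists_polynomial_coeff {s : ℕ → ℂ} {K : ℕ} (hs : ∀ k, K < k → s k = 0) :
    ∃ p : ℂ[X], ∀ k, p.coeff k = s k := by
  refine ⟨∑ k ∈ Finset.range (K + 1), monomial k (s k), fun k => ?_⟩
  simp only [finsetSum_coeff, coeff_monomial, Finset.sum_ite_eq', Finset.mem_range]
  split_ifs with h
  · rfl
  · exact (hs k (by omega)).symm

variable {V : Type u} [AddCommGroup V] [Module ℂ V] {𝒱 : VOA V}

/-- A functional of fixed weight sees one power of x in a homogeneous series, leaving a polynomial
in log x. -/
theorem VData.pairing_eval {W : VData.{u, w} 𝒱} (hW : DirectSum.IsInternal W.wt)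
    {s : LogSeries W} {e : ℂ} (hs : ∀ n k, s n k ∈ W.wt (e - n - 1))
    (hlog : ∀ n, ∃ K : ℕ, ∀ k, K < k → s n k = 0) (ℓ : ℂ) {n : ℂ} {φ : W.gdual}
    (hφ : φ ∈ W.contra.wt (e - n - 1)) {p : ℂ[X]}
    (hp : ∀ k, p.coeff k = (φ : Module.Dual ℂ W) (s n k)) :
    W.pairing φ (W.eval ℓ s) = Complex.exp ((-n - 1) * ℓ) * p.eval ℓ := by
  rw [VData.pairing_of_mem hφ]
  change ((φ : Module.Dual ℂ W).comp (W.wt _).subtype) (W.eval ℓ s (e - n - 1)) = _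
  unfold VData.eval
  have hloc := VData.isLocallyFinite_of_homog hs hlog (e - n - 1)
  rw [← LinearMap.toAddMonoidHom_coe, AddMonoidHom.map_finsum]
  · have e1 : ∀ q : ℂ × ℕ, ((φ : Module.Dual ℂ W).comp (W.wt (e - n - 1)).subtype)
        ((Complex.exp ((-q.1 - 1) * ℓ) * ℓ ^ q.2) • W.proj (e - n - 1) (s q.1 q.2)) =
        Complex.exp ((-q.1 - 1) * ℓ) * ℓ ^ q.2 * (φ : Module.Dual ℂ W) (s q.1 q.2) := by
      intro q
      rw [map_smul, LinearMap.comp_apply, smul_eq_mul]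
      congr 1
      exact VData.dualWt_apply_proj hW hφ _
    simp only [LinearMap.toAddMonoidHom_coe, e1]
    rw [finsum_eq_sum_of_support_subset (s := p.support.map ⟨fun k => (n, k), fun a b h => by
      simpa using h⟩)]
    · rw [Finset.sum_map, Polynomial.eval_eq_sum, Polynomial.sum, Finset.mul_sum]
      refine Finset.sum_congr rfl fun k _ => ?_
      change Complex.exp ((-n - 1) * ℓ) * ℓ ^ k * (φ : Module.Dual ℂ W) (s n k) = _
      rw [hp]
      ring
    · rintro ⟨n', k⟩ hq
      have hne : (φ : Module.Dual ℂ W) (s n' k) ≠ 0 := fun h0 => hq (by simp only [h0, mul_zero])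
      have hn : n' = n := by
        by_contra hn
        refine hne (hφ _ (fun h => hn ?_) _ (hs n' k))
        linear_combination -h
      subst hn
      simp only [Finset.coe_map, Set.mem_image, Finset.mem_coe,
        Polynomial.mem_support_iff, hp]
      exact ⟨k, hne, rfl⟩
  · refine hloc.subset fun q hq => ?_
    intro h0
    exact hq (by simp only [h0, smul_zero])

end LogPolynomial

/-! ### Recovering the coefficients of an operator from the map at z -/

section BoxOperator

open Polynomial

variable {V : Type u} [AddCommGroup V] [Module ℂ V] {𝒱 : VOA V}

theorem VData.L_neg_one_pow_mem {W : VData.{u, w} 𝒱} {m : ℂ} {x : W} (hx : x ∈ W.wt m) (j : ℕ) :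
    ((W.L (-1)) ^ j) x ∈ W.wt (m + j) := by
  induction j with
  | zero => simpa using hx
  | succ j ih =>
    rw [pow_succ', Module.End.mul_apply]
    have := W.homog 2 𝒱.ω 𝒱.ω_mem _ _ ih ((-1 : ℤ) + 1) 0
    have e : m + j + ((2 : ℤ) : ℂ) - ((-1 : ℤ) + 1) - 1 = m + ((j + 1 : ℕ) : ℂ) := by
      push_cast; ring
    rwa [e] at this

/-- The values of the derivatives of an intertwining operator determine its coefficients. -/
theorem IsTwistedIntertwiningOperator.pairing_eval_L_neg_one_pow {W₁ W₂ W₃ : VData.{u, w} 𝒱}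
    (hW : DirectSum.IsInternal W₃.wt) {𝒴 : W₁ →ₗ[ℂ] W₂ →ₗ[ℂ] LogSeries W₃}
    (h𝒴 : IsTwistedIntertwiningOperator W₁ W₂ W₃ 𝒴) {m₁ m₂ n : ℂ} {x₁ : W₁} {x₂ : W₂}
    (hx₁ : x₁ ∈ W₁.wt m₁) (hx₂ : x₂ ∈ W₂.wt m₂) {φ : W₃.gdual}
    (hφ : φ ∈ W₃.contra.wt (m₁ + m₂ - n - 1)) {p : ℂ[X]}
    (hp : ∀ k, p.coeff k = (φ : Module.Dual ℂ W₃) (𝒴 x₁ x₂ n k)) (ℓ : ℂ) (j : ℕ) :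
    W₃.pairing φ (W₃.eval ℓ (𝒴 (((W₁.L (-1)) ^ j) x₁) x₂)) =
      Complex.exp ((-(n + j) - 1) * ℓ) * (logPolyDeriv n p j).eval ℓ := by
  -- The L(-1)-derivative axiom on coefficients is exactly the recursion defining `logPolyDeriv`,
  -- with n shifted by one at each step.
  have hq : ∀ j k, (logPolyDeriv n p j).coeff k =
      (φ : Module.Dual ℂ W₃) (𝒴 (((W₁.L (-1)) ^ j) x₁) x₂ (n + j) k) := by
    intro j
    induction j with
    | zero => intro k; simpa [logPolyDeriv] using hp k
    | succ j ih =>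
      intro k
      rw [logPolyDeriv, coeff_sub, coeff_derivative, coeff_C_mul, ih, ih, pow_succ',
        Module.End.mul_apply, h𝒴.L_neg_one_derivative]
      have e : n + ((j + 1 : ℕ) : ℂ) - 1 = n + j := by push_cast; ring
      rw [e, map_add, map_smul, map_smul, smul_eq_mul, smul_eq_mul]
      push_cast
      ring
  have e : m₁ + j + m₂ - (n + j) - 1 = m₁ + m₂ - n - 1 := by ring
  refine VData.pairing_eval hW (e := m₁ + j + m₂)
    (h𝒴.homog _ _ _ (VData.L_neg_one_pow_mem hx₁ j) _ hx₂) (h𝒴.log_finite _ _) ℓ ?_ (hq j)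
  rw [e]; exact hφ

variable {C : TwClass.{u, w} 𝒱} {z : ℂ} {g₁ g₂ : V ≃ₗ[ℂ] V} {W₁ W₂ : VData.{u, w} 𝒱}

variable (C z g₁ g₂) in
/-- `y` is mapped to the coefficient of `x ^ (-n - 1) (log x) ^ k` in `𝒴(x₁, x) x₂` for all
intertwining operators `𝒴` with values in objects of the category. -/
def IsBoxCoeff (x₁ : W₁) (x₂ : W₂) (n : ℂ) (k : ℕ) (y : boxProd C z g₁ g₂ W₁ W₂) : Prop :=
  ∀ (W₃ : VData.{u, w} 𝒱) (I : W₁ ⊗[ℂ] W₂ →ₗ[ℂ] W₃.Completion)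
    (hI : IsPzProduct C z g₁ g₂ W₁ W₂ W₃ I) (f : boxProd C z g₁ g₂ W₁ W₂ →ₗ[ℂ] W₃),
    IsBoxLift hI f → ∀ 𝒴 : W₁ →ₗ[ℂ] W₂ →ₗ[ℂ] LogSeries W₃,
    IsTwistedIntertwiningOperator W₁ W₂ W₃ 𝒴 →
    (∀ (x₁ : W₁) (x₂ : W₂), I (x₁ ⊗ₜ[ℂ] x₂) = W₃.eval (lBranch 0 z) (𝒴 x₁ x₂)) →
    f y = 𝒴 x₁ x₂ n k

/-- The coefficient is a functional on X_[m] with m = m₁ + m₂ - n - 1. It reads off the kth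
coefficient of the polynomial attached to λ, which is independent of how λ is represented by
products. -/
theorem exists_isBoxCoeff_of_mem (hC : ∀ g W, C g W → IsTwistedModule g W)
    (hX : DirectSum.IsInternal (hbox C z g₁ g₂ W₁ W₂).wt)
    (hfd : ∀ n, FiniteDimensional ℂ ((hbox C z g₁ g₂ W₁ W₂).wt n))
    {m₁ m₂ : ℂ} {x₁ : W₁} {x₂ : W₂} (hx₁ : x₁ ∈ W₁.wt m₁) (hx₂ : x₂ ∈ W₂.wt m₂) (n : ℂ) :
    ∃ Y : ℕ → boxProd C z g₁ g₂ W₁ W₂, (∃ K : ℕ, ∀ k, K < k → Y k = 0) ∧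
      ∀ k, IsBoxCoeff C z g₁ g₂ x₁ x₂ n k (Y k) := by
  set m := m₁ + m₂ - n - 1 with hm
  set ℓ := lBranch 0 z
  -- The jth value of `y` is the jth derivative of x^{-n-1} p(log x) at the chosen branch. No
  -- operator is mentioned, so p depends on `y` alone.
  let Rel : Module.Dual ℂ (W₁ ⊗[ℂ] W₂) → ℂ[X] → Prop := fun y p => ∀ j : ℕ,
    y ((((W₁.L (-1)) ^ j) x₁) ⊗ₜ[ℂ] x₂) =
      Complex.exp ((-(n + j) - 1) * ℓ) * (logPolyDeriv n p j).eval ℓ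
  have rel_add : ∀ {y y' p p'}, Rel y p → Rel y' p' → Rel (y + y') (p + p') := by
    intro y y' p p' h h' j
    rw [LinearMap.add_apply, h, h', logPolyDeriv_add, eval_add, mul_add]
  have rel_smul : ∀ (c : ℂ) {y p}, Rel y p → Rel (c • y) (Polynomial.C c * p) := by
    intro c y p h j
    rw [LinearMap.smul_apply, h, logPolyDeriv_C_mul, eval_mul, eval_C, smul_eq_mul]
    ring
  have rel_unique : ∀ {y p p'}, Rel y p → Rel y p' → p = p' := by
    intro y p p' h h'
    rw [← sub_eq_zero]
    refine eq_zero_of_eval_logPolyDeriv (n := n) (ℓ := ℓ) fun j => ?_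
    have h1 := rel_add h (rel_smul (-1) h') j
    have e : p + Polynomial.C (-1) * p' = p - p' := by simp [sub_eq_add_neg]
    rw [e] at h1
    have h2 : (y + (-1 : ℂ) • y) ((((W₁.L (-1)) ^ j) x₁) ⊗ₜ[ℂ] x₂) = 0 := by simp
    rw [h2] at h1
    exact (mul_eq_zero.mp h1.symm).resolve_left (Complex.exp_ne_zero _)
  have rel_lam : ∀ (W₃ : VData.{u, w} 𝒱) (I : W₁ ⊗[ℂ] W₂ →ₗ[ℂ] W₃.Completion),
      DirectSum.IsInternal W₃.wt → ∀ 𝒴 : W₁ →ₗ[ℂ] W₂ →ₗ[ℂ] LogSeries W₃,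
      IsTwistedIntertwiningOperator W₁ W₂ W₃ 𝒴 →
      (∀ (x₁ : W₁) (x₂ : W₂), I (x₁ ⊗ₜ[ℂ] x₂) = W₃.eval ℓ (𝒴 x₁ x₂)) →
      ∀ φ : W₃.gdual, φ ∈ W₃.contra.wt m → ∃ p : ℂ[X], Rel (lamFun I φ) p ∧
        ∀ k, p.coeff k = (φ : Module.Dual ℂ W₃) (𝒴 x₁ x₂ n k) := by
    intro W₃ I hW 𝒴 h𝒴 hI φ hφ
    obtain ⟨K, hK⟩ := h𝒴.log_finite x₁ x₂ n
    obtain ⟨p, hp⟩ := exists_polynomial_coeff (K := K)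
      (s := fun k => (φ : Module.Dual ℂ W₃) (𝒴 x₁ x₂ n k)) (fun k hk => by rw [hK k hk, map_zero])
    refine ⟨p, fun j => ?_, hp⟩
    rw [lamFun, LinearMap.comp_apply, hI]
    exact h𝒴.pairing_eval_L_neg_one_pow hW hx₁ hx₂ hφ hp ℓ j
  have rel_exists : ∀ y ∈ hboxWtSpan C z g₁ g₂ W₁ W₂ m, ∃ p, Rel y p := by
    intro y hy
    unfold hboxWtSpan at hy
    induction hy using Submodule.span_induction with
    | mem y hy =>
      obtain ⟨W₃, I, φ, hI, hφ, rfl⟩ := hy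
      obtain ⟨𝒴, h𝒴, hI𝒴⟩ := hI.2
      obtain ⟨p, hp, -⟩ := rel_lam W₃ I (hC _ _ hI.1).internal 𝒴 h𝒴 hI𝒴 φ hφ
      exact ⟨p, hp⟩
    | zero => exact ⟨0, fun j => by simp [logPolyDeriv_zero]⟩
    | add a b _ _ ha hb =>
      obtain ⟨p, hp⟩ := ha
      obtain ⟨q, hq⟩ := hb
      exact ⟨_, rel_add hp hq⟩
    | smul c a _ ha =>
      obtain ⟨p, hp⟩ := ha
      exact ⟨_, rel_smul c hp⟩
  let val : (hbox C z g₁ g₂ W₁ W₂).wt m →ₗ[ℂ] Module.Dual ℂ (W₁ ⊗[ℂ] W₂) :=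
    (hboxSpace C z g₁ g₂ W₁ W₂).subtype.comp ((hbox C z g₁ g₂ W₁ W₂).wt m).subtype
  choose T hT using fun x : (hbox C z g₁ g₂ W₁ W₂).wt m => rel_exists (val x) x.2
  let T' : (hbox C z g₁ g₂ W₁ W₂).wt m →ₗ[ℂ] ℂ[X] :=
    { toFun := T
      map_add' := fun a b => rel_unique (hT (a + b)) (by rw [map_add]; exact rel_add (hT a) (hT b))
      map_smul' := fun c a => rel_unique (hT (c • a)) (by
        rw [map_smul, RingHom.id_apply, smul_eq_C_mul]; exact rel_smul c (hT a)) }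
  let Y : ℕ → (hbox C z g₁ g₂ W₁ W₂).gdual := fun k =>
    (hbox C z g₁ g₂ W₁ W₂).extendDual m ((lcoeff ℂ k).comp T')
  refine ⟨Y, ?_, ?_⟩
  · have := hfd m
    obtain ⟨S, hS⟩ := Module.Finite.fg_top (R := ℂ) (M := (hbox C z g₁ g₂ W₁ W₂).wt m)
    -- A finite spanning set of the weight space bounds the degrees, hence the powers of the
    -- logarithm.
    refine ⟨S.sup fun x => (T' x).natDegree, fun k hk => ?_⟩
    have hz : (lcoeff ℂ k).comp T' = 0 := by
      refine LinearMap.ext_on hS fun x hx => ?_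
      exact coeff_eq_zero_of_natDegree_lt
        ((Finset.le_sup (f := fun x => (T' x).natDegree) hx).trans_lt hk)
    exact (congrArg _ hz).trans (map_zero _)
  · intro k W₃ I hI f hf 𝒴 h𝒴 hI𝒴
    have hW := (hC _ _ hI.1).internal
    refine VData.ext_gdual hW fun φ => ?_
    refine (hf.apply_eq (Y k) φ).trans ?_
    induction φ using VData.gdual_induction with
    | hwt m' φ hφ =>
      by_cases h : m' = m
      · subst h
        obtain ⟨p, hp, hpk⟩ := rel_lam W₃ I hW 𝒴 h𝒴 hI𝒴 φ hφ
        rw [← hpk, ← rel_unique (hT ⟨lamMap hI φ, lamMap_isGraded hI _ φ hφ⟩) hp]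
        exact congrArg (fun x => (T x).coeff k)
          (VData.proj_coe hX ⟨lamMap hI φ, lamMap_isGraded hI _ φ hφ⟩)
      · refine Eq.trans ?_ (hφ m (Ne.symm h) _ (h𝒴.homog _ _ _ hx₁ _ hx₂ n k)).symm
        exact VData.extendDual_mem m ((lcoeff ℂ k).comp T') m' h _ (lamMap_isGraded hI m' φ hφ)
    | h0 =>
      exact (congrArg _ (map_zero (lamMap hI))).trans (map_zero (Subtype.val (Y k)))
    | hadd a b ha hb =>
      rw [Submodule.coe_add, LinearMap.add_apply, ← ha, ← hb]
      exact (congrArg _ (map_add (lamMap hI) a b)).trans (map_add (Subtype.val (Y k)) _ _)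

theorem IsBoxCoeff.add_left {x₁ x₁' : W₁} {x₂ : W₂} {n : ℂ} {k : ℕ}
    {y y' : boxProd C z g₁ g₂ W₁ W₂} (h : IsBoxCoeff C z g₁ g₂ x₁ x₂ n k y)
    (h' : IsBoxCoeff C z g₁ g₂ x₁' x₂ n k y') :
    IsBoxCoeff C z g₁ g₂ (x₁ + x₁') x₂ n k (y + y') := by
  intro W₃ I hI f hf 𝒴 h𝒴 hI𝒴
  rw [map_add, map_add, h W₃ I hI f hf 𝒴 h𝒴 hI𝒴, h' W₃ I hI f hf 𝒴 h𝒴 hI𝒴]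
  rfl

theorem IsBoxCoeff.add_right {x₁ : W₁} {x₂ x₂' : W₂} {n : ℂ} {k : ℕ}
    {y y' : boxProd C z g₁ g₂ W₁ W₂} (h : IsBoxCoeff C z g₁ g₂ x₁ x₂ n k y)
    (h' : IsBoxCoeff C z g₁ g₂ x₁ x₂' n k y') :
    IsBoxCoeff C z g₁ g₂ x₁ (x₂ + x₂') n k (y + y') := by
  intro W₃ I hI f hf 𝒴 h𝒴 hI𝒴
  rw [map_add, map_add, h W₃ I hI f hf 𝒴 h𝒴 hI𝒴, h' W₃ I hI f hf 𝒴 h𝒴 hI𝒴]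
  rfl

theorem IsBoxCoeff.smul_left (c : ℂ) {x₁ : W₁} {x₂ : W₂} {n : ℂ} {k : ℕ}
    {y : boxProd C z g₁ g₂ W₁ W₂} (h : IsBoxCoeff C z g₁ g₂ x₁ x₂ n k y) :
    IsBoxCoeff C z g₁ g₂ (c • x₁) x₂ n k (c • y) := by
  intro W₃ I hI f hf 𝒴 h𝒴 hI𝒴
  rw [map_smul, map_smul, h W₃ I hI f hf 𝒴 h𝒴 hI𝒴]
  rfl

theorem IsBoxCoeff.smul_right (c : ℂ) {x₁ : W₁} {x₂ : W₂} {n : ℂ} {k : ℕ}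
    {y : boxProd C z g₁ g₂ W₁ W₂} (h : IsBoxCoeff C z g₁ g₂ x₁ x₂ n k y) :
    IsBoxCoeff C z g₁ g₂ x₁ (c • x₂) n k (c • y) := by
  intro W₃ I hI f hf 𝒴 h𝒴 hI𝒴
  rw [map_smul, map_smul, h W₃ I hI f hf 𝒴 h𝒴 hI𝒴]
  rfl

theorem exists_isBoxCoeff (hC : ∀ g W, C g W → IsTwistedModule g W)
    (hX : DirectSum.IsInternal (hbox C z g₁ g₂ W₁ W₂).wt)
    (hfd : ∀ n, FiniteDimensional ℂ ((hbox C z g₁ g₂ W₁ W₂).wt n))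
    (hW₁ : DirectSum.IsInternal W₁.wt) (hW₂ : DirectSum.IsInternal W₂.wt)
    (x₁ : W₁) (x₂ : W₂) (n : ℂ) :
    ∃ Y : ℕ → boxProd C z g₁ g₂ W₁ W₂, (∃ K : ℕ, ∀ k, K < k → Y k = 0) ∧
      ∀ k, IsBoxCoeff C z g₁ g₂ x₁ x₂ n k (Y k) := by
  induction x₁ using VData.induction_homogeneous hW₁ with
  | hwt m₁ x₁ hx₁ =>
    induction x₂ using VData.induction_homogeneous hW₂ with
    | hwt m₂ x₂ hx₂ => exact exists_isBoxCoeff_of_mem hC hX hfd hx₁ hx₂ n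
    | h0 =>
      refine ⟨fun _ => 0, ⟨0, fun _ _ => rfl⟩, fun k W₃ I hI f hf 𝒴 h𝒴 hI𝒴 => ?_⟩
      simp
    | hadd a b ha hb =>
      obtain ⟨Y, ⟨K, hK⟩, hY⟩ := ha
      obtain ⟨Y', ⟨K', hK'⟩, hY'⟩ := hb
      refine ⟨fun k => Y k + Y' k, ⟨max K K', fun k hk => ?_⟩, fun k => (hY k).add_right (hY' k)⟩
      simp only [hK k (lt_of_le_of_lt (le_max_left _ _) hk),
        hK' k (lt_of_le_of_lt (le_max_right _ _) hk), add_zero]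
  | h0 =>
    refine ⟨fun _ => 0, ⟨0, fun _ _ => rfl⟩, fun k W₃ I hI f hf 𝒴 h𝒴 hI𝒴 => ?_⟩
    simp
  | hadd a b ha hb =>
    obtain ⟨Y, ⟨K, hK⟩, hY⟩ := ha
    obtain ⟨Y', ⟨K', hK'⟩, hY'⟩ := hb
    refine ⟨fun k => Y k + Y' k, ⟨max K K', fun k hk => ?_⟩, fun k => (hY k).add_left (hY' k)⟩
    simp only [hK k (lt_of_le_of_lt (le_max_left _ _) hk),
      hK' k (lt_of_le_of_lt (le_max_right _ _) hk), add_zero]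

theorem IsBoxCoeff.unique
    (hlift : ∀ (W₃ : VData.{u, w} 𝒱) (I : W₁ ⊗[ℂ] W₂ →ₗ[ℂ] W₃.Completion)
      (hI : IsPzProduct C z g₁ g₂ W₁ W₂ W₃ I), ∃ f, IsBoxLift hI f)
    {x₁ : W₁} {x₂ : W₂} {n : ℂ} {k : ℕ} {y y' : boxProd C z g₁ g₂ W₁ W₂}
    (h : IsBoxCoeff C z g₁ g₂ x₁ x₂ n k y) (h' : IsBoxCoeff C z g₁ g₂ x₁ x₂ n k y') : y = y' := by
  refine boxProd_ext hlift fun W₃ I hI f hf => ?_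
  obtain ⟨𝒴, h𝒴, hI𝒴⟩ := hI.2
  rw [h W₃ I hI f hf 𝒴 h𝒴 hI𝒴, h' W₃ I hI f hf 𝒴 h𝒴 hI𝒴]

/-- The coefficients of all intertwining operators come from one operator with values in `W₁ ⊠ W₂`. -/
theorem exists_boxOperator (hC : ∀ g W, C g W → IsTwistedModule g W)
    (hX : DirectSum.IsInternal (hbox C z g₁ g₂ W₁ W₂).wt)
    (hfd : ∀ n, FiniteDimensional ℂ ((hbox C z g₁ g₂ W₁ W₂).wt n))
    (hlift : ∀ (W₃ : VData.{u, w} 𝒱) (I : W₁ ⊗[ℂ] W₂ →ₗ[ℂ] W₃.Completion)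
      (hI : IsPzProduct C z g₁ g₂ W₁ W₂ W₃ I), ∃ f, IsBoxLift hI f)
    (hW₁ : DirectSum.IsInternal W₁.wt) (hW₂ : DirectSum.IsInternal W₂.wt) :
    ∃ 𝒴 : W₁ →ₗ[ℂ] W₂ →ₗ[ℂ] LogSeries (boxProd C z g₁ g₂ W₁ W₂),
      (∀ x₁ x₂ n, ∃ K : ℕ, ∀ k, K < k → 𝒴 x₁ x₂ n k = 0) ∧
      ∀ x₁ x₂ n k, IsBoxCoeff C z g₁ g₂ x₁ x₂ n k (𝒴 x₁ x₂ n k) := by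
  choose Y hlog hY using fun (x₁ : W₁) (x₂ : W₂) (n : ℂ) =>
    exists_isBoxCoeff hC hX hfd hW₁ hW₂ x₁ x₂ n
  refine ⟨LinearMap.mk₂ ℂ (fun x₁ x₂ n k => Y x₁ x₂ n k) ?_ ?_ ?_ ?_, hlog, hY⟩
  · intro a b x₂
    funext n k
    exact (hY _ _ n k).unique hlift ((hY a x₂ n k).add_left (hY b x₂ n k))
  · intro c a x₂
    funext n k
    exact (hY _ _ n k).unique hlift ((hY a x₂ n k).smul_left c)
  · intro x₁ a b
    funext n k
    exact (hY _ _ n k).unique hlift ((hY x₁ a n k).add_right (hY x₁ b n k))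
  · intro c x₁ a
    funext n k
    exact (hY _ _ n k).unique hlift ((hY x₁ a n k).smul_right c)

end BoxOperator

/-! ## The axioms of intertwining operators for sums and pullbacks of functionals -/

section Transport

variable {V : Type u} [AddCommGroup V] [Module ℂ V] {𝒱 : VOA V} {W₁ W₂ P W₃ : VData.{u, w} 𝒱}

/-- The duality property for the functional `φ`. -/
def DualityAt (𝒴 : W₁ →ₗ[ℂ] W₂ →ₗ[ℂ] LogSeries W₃) (a : V) (x₁ : W₁) (x₂ : W₂)
    (φ : W₃.gdual) : Prop :=
  ∃ (f : MultiFun 2 (Mspace 2)) (F : (Fin 2 → ℂ) → ℂ),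
    f.IsBranchOn (Mspace 2) cutsM2 F ∧ ∀ z₁ z₂ : ℂ,
    (‖z₂‖ < ‖z₁‖ → 0 < ‖z₂‖ →
      Summable (fun r : ℂ => W₃.pairing φ (W₃.eval (lBranch 0 z₁)
        (W₃.Y a (W₃.eval (lBranch 0 z₂) (𝒴 x₁ x₂) r)))) ∧
      (|argPos (z₁ - z₂) - argPos z₁| < Real.pi / 2 →
        ∑' r : ℂ, W₃.pairing φ (W₃.eval (lBranch 0 z₁)
          (W₃.Y a (W₃.eval (lBranch 0 z₂) (𝒴 x₁ x₂) r))) = F ![z₁, z₂])) ∧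
    (‖z₁‖ < ‖z₂‖ → 0 < ‖z₁‖ →
      Summable (fun r : ℂ => W₃.pairing φ (W₃.eval (lBranch 0 z₂)
        (𝒴 x₁ (W₂.eval (lBranch 0 z₁) (W₂.Y a x₂) r)))) ∧
      (-(3 * Real.pi / 2) < argPos (z₁ - z₂) - argPos z₂ →
        argPos (z₁ - z₂) - argPos z₂ < -(Real.pi / 2) →
        ∑' r : ℂ, W₃.pairing φ (W₃.eval (lBranch 0 z₂)
          (𝒴 x₁ (W₂.eval (lBranch 0 z₁) (W₂.Y a x₂) r))) = F ![z₁, z₂])) ∧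
    (‖z₁ - z₂‖ < ‖z₂‖ → 0 < ‖z₁ - z₂‖ →
      Summable (fun r : ℂ => W₃.pairing φ (W₃.eval (lBranch 0 z₂)
        (𝒴 (W₁.eval (lBranch 0 (z₁ - z₂)) (W₁.Y a x₁) r) x₂))) ∧
      (|argPos z₁ - argPos z₂| < Real.pi / 2 →
        ∑' r : ℂ, W₃.pairing φ (W₃.eval (lBranch 0 z₂)
          (𝒴 (W₁.eval (lBranch 0 (z₁ - z₂)) (W₁.Y a x₁) r) x₂)) = F ![z₁, z₂]))

/-- The convergence and extension property of products for the functional `φ`. -/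
def ProductsAt (𝒴 : W₁ →ₗ[ℂ] W₂ →ₗ[ℂ] LogSeries W₃) (r : ℕ) (a : Fin r → V) (x₁ : W₁) (x₂ : W₂)
    (φ : W₃.gdual) : Prop :=
  (∀ z : Fin (r + 1) → ℂ, StrictAnti (fun i => ‖z i‖) → 0 < ‖z (Fin.last r)‖ →
    Summable fun n : Fin r → ℂ => W₃.pairing φ
      (nestedProd W₃ r a (Fin.init z) n (W₃.eval (lBranch 0 (z (Fin.last r))) (𝒴 x₁ x₂)))) ∧
  ∃ f : MultiFun (r + 1) (Mspace (r + 1)),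
    f.IsBranchOn {z | StrictAnti (fun i => ‖z i‖) ∧ 0 < ‖z (Fin.last r)‖} (fun i z => z i)
      (fun z => ∑' n : Fin r → ℂ, W₃.pairing φ (nestedProd W₃ r a (Fin.init z) n
        (W₃.eval (lBranch 0 (z (Fin.last r))) (𝒴 x₁ x₂)))) ∧
    ∀ (A : GL (Fin (r + 1)) ℂ) (β : Fin (r + 1) → ℂ) (δ : Fin (r + 1) → Bool),
      MultiFun.IsComponentIsolated (Mspace (r + 1)) A β δ → f.IsRegularSingularity A β δ

theorem dualityAt_zero (𝒴 : W₁ →ₗ[ℂ] W₂ →ₗ[ℂ] LogSeries W₃) (a : V) (x₁ : W₁) (x₂ : W₂) :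
    DualityAt 𝒴 a x₁ x₂ 0 := by
  refine ⟨_, 0, MultiFun.isBranchOn_zero MultiFun.isCutStar_mspace_two subset_rfl
    MultiFun.mem_mspace_two, fun z₁ z₂ => ?_⟩
  simp only [VData.pairing_zero, tsum_zero, Pi.zero_apply, summable_zero, implies_true, and_self]

/-- The preferred branches are matched at one base point of the cut space, so their sum is a branch
of one multivalued function for all three series. -/
theorem DualityAt.add {𝒴 : W₁ →ₗ[ℂ] W₂ →ₗ[ℂ] LogSeries W₃} {a : V} {x₁ : W₁} {x₂ : W₂}
    {φ ψ : W₃.gdual} (hφ : DualityAt 𝒴 a x₁ x₂ φ) (hψ : DualityAt 𝒴 a x₁ x₂ ψ) :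
    DualityAt 𝒴 a x₁ x₂ (φ + ψ) := by
  obtain ⟨f, F, hF, hf⟩ := hφ
  obtain ⟨g, G, hG, hg⟩ := hψ
  obtain ⟨_, _, hFG⟩ := MultiFun.exists_isBranchOn_add MultiFun.isCutStar_mspace_two subset_rfl
    MultiFun.mem_mspace_two hF hG
  refine ⟨_, _, hFG, fun z₁ z₂ => ⟨fun h1 h2 => ?_, fun h1 h2 => ?_, fun h1 h2 => ?_⟩⟩
  · obtain ⟨s1, e1⟩ := (hf z₁ z₂).1 h1 h2
    obtain ⟨s2, e2⟩ := (hg z₁ z₂).1 h1 h2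
    simp only [VData.pairing_add]
    exact ⟨s1.add s2, fun h => by rw [s1.tsum_add s2, e1 h, e2 h]; rfl⟩
  · obtain ⟨s1, e1⟩ := (hf z₁ z₂).2.1 h1 h2
    obtain ⟨s2, e2⟩ := (hg z₁ z₂).2.1 h1 h2
    simp only [VData.pairing_add]
    exact ⟨s1.add s2, fun h h' => by rw [s1.tsum_add s2, e1 h h', e2 h h']; rfl⟩
  · obtain ⟨s1, e1⟩ := (hf z₁ z₂).2.2 h1 h2
    obtain ⟨s2, e2⟩ := (hg z₁ z₂).2.2 h1 h2
    simp only [VData.pairing_add]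
    exact ⟨s1.add s2, fun h => by rw [s1.tsum_add s2, e1 h, e2 h]; rfl⟩

theorem productsAt_zero (𝒴 : W₁ →ₗ[ℂ] W₂ →ₗ[ℂ] LogSeries W₃) (r : ℕ) (a : Fin r → V) (x₁ : W₁)
    (x₂ : W₂) : ProductsAt 𝒴 r a x₁ x₂ 0 := by
  obtain ⟨b, hb, hstar⟩ := MultiFun.exists_isCutStar_radialRegion r
  unfold ProductsAt
  simp only [VData.pairing_zero, tsum_zero, summable_zero, implies_true, true_and]
  exact ⟨_, MultiFun.isBranchOn_zero hstar (MultiFun.radialRegion_subset r) hb,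
    fun A β δ _ => MultiFun.isRegularSingularity_zero _ A β δ⟩

theorem MultiFun.IsBranchOn.congr {n : ℕ} {Ω : Set (Fin n → ℂ)} {f : MultiFun n Ω} {ι : Type*}
    {R : Set (Fin n → ℂ)} {c : ι → (Fin n → ℂ) → ℂ} {F F' : (Fin n → ℂ) → ℂ}
    (hF : f.IsBranchOn R c F) (hR : IsOpen R) (h : ∀ z ∈ R, F z = F' z) : f.IsBranchOn R c F' := by
  intro z hz
  obtain ⟨ψ, hψ, h1⟩ := hF z hz
  refine ⟨ψ, hψ, ?_⟩
  filter_upwards [h1, hR.mem_nhds hz] with z' h2 h3 h4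
  rw [← h z' h3, h2 h4]

/-- The branches are matched inside the region of convergence. Regularity survives the change of
base point and then the sum. -/
theorem ProductsAt.add {𝒴 : W₁ →ₗ[ℂ] W₂ →ₗ[ℂ] LogSeries W₃} {r : ℕ} {a : Fin r → V} {x₁ : W₁}
    {x₂ : W₂} {φ ψ : W₃.gdual} (hφ : ProductsAt 𝒴 r a x₁ x₂ φ)
    (hψ : ProductsAt 𝒴 r a x₁ x₂ ψ) : ProductsAt 𝒴 r a x₁ x₂ (φ + ψ) := by
  obtain ⟨s1, f, hF, hf⟩ := hφ
  obtain ⟨s2, g, hG, hg⟩ := hψ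
  obtain ⟨b, hb, hstar⟩ := MultiFun.exists_isCutStar_radialRegion r
  obtain ⟨_, _, hFG⟩ := MultiFun.exists_isBranchOn_add hstar (MultiFun.radialRegion_subset r) hb
    hF hG
  refine ⟨fun z h1 h2 => ?_, _, hFG.congr (MultiFun.isLogConvex_radialRegion r).isOpen
    fun z hz => ?_, fun A β δ h => ?_⟩
  · simp only [VData.pairing_add]
    exact (s1 z h1 h2).add (s2 z h1 h2)
  · simp only [VData.pairing_add, Pi.add_apply]
    exact ((s1 z hz.1 hz.2).tsum_add (s2 z hz.1 hz.2)).symm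
  · exact (MultiFun.isRegularSingularity_rebase_iff.mpr (hf A β δ h)).sum
      (MultiFun.isRegularSingularity_rebase_iff.mpr (hg A β δ h))

/-! ### Pulling the axioms back along a module map -/

variable {f : P →ₗ[ℂ] W₃}

theorem VData.IsGraded.map_eval_Y (hf : VData.IsGraded f) (hfm : IsModuleMap P W₃ f)
    {g g' : V ≃ₗ[ℂ] V} (hP : IsTwistedModule g P) (hW : IsTwistedModule g' W₃) (ℓ : ℂ) (a : V)
    (y : P) : hf.completion (P.eval ℓ (P.Y a y)) = W₃.eval ℓ (W₃.Y a (f y)) := by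
  rw [hf.map_eval hP.internal hW.internal ℓ
    (VData.Y_isLocallyFinite hP.internal hP.log_bounded a y)]
  congr 1
  funext n k
  exact hfm a y n k

theorem VData.IsGraded.map_nestedProd (hf : VData.IsGraded f) (hfm : IsModuleMap P W₃ f)
    {g g' : V ≃ₗ[ℂ] V} (hP : IsTwistedModule g P) (hW : IsTwistedModule g' W₃) (r : ℕ)
    (a : Fin r → V) (z n : Fin r → ℂ) (y : P.Completion) :
    hf.completion (nestedProd P r a z n y) = nestedProd W₃ r a z n (hf.completion y) := by
  induction r with
  | zero => rfl
  | succ r ih =>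
    rw [nestedProd, nestedProd, hf.map_eval_Y hfm hP hW]
    congr 2
    exact congrArg (fun y : W₃.Completion => (y (n 0) : W₃))
      (ih (Fin.tail a) (Fin.tail z) (Fin.tail n))

variable {𝒴P : W₁ →ₗ[ℂ] W₂ →ₗ[ℂ] LogSeries P} {𝒴 : W₁ →ₗ[ℂ] W₂ →ₗ[ℂ] LogSeries W₃}

theorem VData.IsGraded.map_eval_operator (hf : VData.IsGraded f) {g g' : V ≃ₗ[ℂ] V}
    (hP : IsTwistedModule g P) (hW : IsTwistedModule g' W₃)
    (hloc : ∀ x₁ x₂, VData.IsLocallyFinite (𝒴P x₁ x₂))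
    (hf𝒴 : ∀ x₁ x₂ n k, f (𝒴P x₁ x₂ n k) = 𝒴 x₁ x₂ n k) (ℓ : ℂ) (x₁ : W₁) (x₂ : W₂) :
    hf.completion (P.eval ℓ (𝒴P x₁ x₂)) = W₃.eval ℓ (𝒴 x₁ x₂) := by
  rw [hf.map_eval hP.internal hW.internal ℓ (hloc x₁ x₂)]
  congr 1
  funext n k
  exact hf𝒴 x₁ x₂ n k

/-- Moving `f` inwards through the vertex operators and the intertwining operator identifies every
series term by term with one for φ, so the same analytic function serves. -/
theorem DualityAt.pullback (hf : VData.IsGraded f) (hfm : IsModuleMap P W₃ f)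
    {g g' : V ≃ₗ[ℂ] V} (hP : IsTwistedModule g P) (hW : IsTwistedModule g' W₃)
    (hloc : ∀ x₁ x₂, VData.IsLocallyFinite (𝒴P x₁ x₂))
    (hf𝒴 : ∀ x₁ x₂ n k, f (𝒴P x₁ x₂ n k) = 𝒴 x₁ x₂ n k) {a : V} {x₁ : W₁} {x₂ : W₂}
    {φ : W₃.gdual} (h : DualityAt 𝒴 a x₁ x₂ φ) : DualityAt 𝒴P a x₁ x₂ (hf.pullback φ) := by
  have e1 := fun ℓ x₁ x₂ => hf.map_eval_operator hP hW hloc hf𝒴 ℓ x₁ x₂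
  have e2 : ∀ ℓ r x₁ x₂, f (P.eval ℓ (𝒴P x₁ x₂) r : P) = (W₃.eval ℓ (𝒴 x₁ x₂) r : W₃) :=
    fun ℓ r x₁ x₂ => congrArg (fun y : W₃.Completion => (y r : W₃)) (e1 ℓ x₁ x₂)
  unfold DualityAt
  simp only [hf.pairing_pullback, hf.map_eval_Y hfm hP hW, e1, e2]
  exact h

theorem ProductsAt.pullback (hf : VData.IsGraded f) (hfm : IsModuleMap P W₃ f)
    {g g' : V ≃ₗ[ℂ] V} (hP : IsTwistedModule g P) (hW : IsTwistedModule g' W₃)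
    (hloc : ∀ x₁ x₂, VData.IsLocallyFinite (𝒴P x₁ x₂))
    (hf𝒴 : ∀ x₁ x₂ n k, f (𝒴P x₁ x₂ n k) = 𝒴 x₁ x₂ n k) {r : ℕ} {a : Fin r → V} {x₁ : W₁}
    {x₂ : W₂} {φ : W₃.gdual} (h : ProductsAt 𝒴 r a x₁ x₂ φ) :
    ProductsAt 𝒴P r a x₁ x₂ (hf.pullback φ) := by
  unfold ProductsAt
  simp only [hf.pairing_pullback, hf.map_nestedProd hfm hP hW,
    hf.map_eval_operator hP hW hloc hf𝒴]
  exact h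

end Transport

/-! ## The tensor product theorem -/

section Main

variable {V : Type u} [AddCommGroup V] [Module ℂ V] {𝒱 : VOA V} {C : TwClass.{u, w} 𝒱} {z : ℂ}
  {g₁ g₂ : V ≃ₗ[ℂ] V} {W₁ W₂ : VData.{u, w} 𝒱}

theorem isLocallyFinite_operator {P : VData.{u, w} 𝒱} (hW₁ : DirectSum.IsInternal W₁.wt)
    (hW₂ : DirectSum.IsInternal W₂.wt) {𝒴 : W₁ →ₗ[ℂ] W₂ →ₗ[ℂ] LogSeries P}
    (homog : ∀ (m₁ m₂ : ℂ), ∀ x₁ ∈ W₁.wt m₁, ∀ x₂ ∈ W₂.wt m₂, ∀ (n : ℂ) (k : ℕ),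
      𝒴 x₁ x₂ n k ∈ P.wt (m₁ + m₂ - n - 1))
    (hlog : ∀ (x₁ : W₁) (x₂ : W₂) (n : ℂ), ∃ K : ℕ, ∀ k : ℕ, K < k → 𝒴 x₁ x₂ n k = 0)
    (x₁ : W₁) (x₂ : W₂) : VData.IsLocallyFinite (𝒴 x₁ x₂) := by
  induction x₁ using VData.induction_homogeneous hW₁ with
  | hwt m₁ x₁ hx₁ =>
    induction x₂ using VData.induction_homogeneous hW₂ with
    | hwt m₂ x₂ hx₂ =>
      exact VData.isLocallyFinite_of_homog (homog m₁ m₂ x₁ hx₁ x₂ hx₂) (hlog x₁ x₂)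
    | h0 => rw [map_zero]; exact VData.isLocallyFinite_zero
    | hadd a b ha hb => rw [map_add]; exact ha.add hb
  | h0 => rw [map_zero, LinearMap.zero_apply]; exact VData.isLocallyFinite_zero
  | hadd a b ha hb => rw [map_add, LinearMap.add_apply]; exact ha.add hb

/-- Raising n by l lowers the weight by l, which eventually falls below the lower bound for P. -/
theorem lower_truncation_operator {P : VData.{u, w} 𝒱} {g : V ≃ₗ[ℂ] V} (hP : IsTwistedModule g P)
    (hW₁ : DirectSum.IsInternal W₁.wt)
    (hW₂ : DirectSum.IsInternal W₂.wt) {𝒴 : W₁ →ₗ[ℂ] W₂ →ₗ[ℂ] LogSeries P}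
    (homog : ∀ (m₁ m₂ : ℂ), ∀ x₁ ∈ W₁.wt m₁, ∀ x₂ ∈ W₂.wt m₂, ∀ (n : ℂ) (k : ℕ),
      𝒴 x₁ x₂ n k ∈ P.wt (m₁ + m₂ - n - 1))
    (x₁ : W₁) (x₂ : W₂) (n : ℂ) (k : ℕ) : ∃ N : ℕ, ∀ l : ℕ, N ≤ l → 𝒴 x₁ x₂ (n + l) k = 0 := by
  induction x₁ using VData.induction_homogeneous hW₁ with
  | hwt m₁ x₁ hx₁ =>
    induction x₂ using VData.induction_homogeneous hW₂ with
    | hwt m₂ x₂ hx₂ =>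
      obtain ⟨R, hR⟩ := hP.lower_bounded (m₁ + m₂ - n - 1)
      obtain ⟨N, hN⟩ := exists_nat_gt (-R)
      refine ⟨N, fun l hl => ?_⟩
      have h1 := homog m₁ m₂ x₁ hx₁ x₂ hx₂ (n + l) k
      have hNl : (N : ℝ) ≤ l := by exact_mod_cast hl
      have e : m₁ + m₂ - (n + l) - 1 = m₁ + m₂ - n - 1 + ((-(l : ℝ) : ℝ) : ℂ) := by
        push_cast; ring
      rw [e, hR _ (by linarith), Submodule.mem_bot] at h1
      exact h1
    | h0 => exact ⟨0, fun l _ => by simp⟩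
    | hadd a b ha hb =>
      obtain ⟨N, hN⟩ := ha
      obtain ⟨M, hM⟩ := hb
      refine ⟨max N M, fun l hl => ?_⟩
      rw [map_add, Pi.add_apply, Pi.add_apply, hN l ((le_max_left _ _).trans hl),
        hM l ((le_max_right _ _).trans hl), add_zero]
  | h0 => exact ⟨0, fun l _ => by simp⟩
  | hadd a b ha hb =>
    obtain ⟨N, hN⟩ := ha
    obtain ⟨M, hM⟩ := hb
    refine ⟨max N M, fun l hl => ?_⟩
    rw [map_add, LinearMap.add_apply, Pi.add_apply, Pi.add_apply,
      hN l ((le_max_left _ _).trans hl), hM l ((le_max_right _ _).trans hl), add_zero]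

/-- The canonical map to `W₁ ⊠ W₂` is an intertwining map. -/
theorem isPzIntertwiningMap_boxMap (hC : ∀ g W, C g W → IsTwistedModule g W)
    (hT : TensorAssumption C z) (h₁ : C g₁ W₁) (h₂ : C g₂ W₂)
    (hP : IsTwistedModule (g₁ * g₂) (boxProd C z g₁ g₂ W₁ W₂)) :
    IsPzIntertwiningMap z W₁ W₂ (boxProd C z g₁ g₂ W₁ W₂) (boxMap C z g₁ g₂ W₁ W₂) := by
  have hXC := hT.hbox_mem g₁ g₂ W₁ W₂ h₁ h₂
  have hX := (hC _ _ hXC).internal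
  have hfd := fun n => hT.finiteDimensional hC hXC n
  have hW₁ := (hC _ _ h₁).internal
  have hW₂ := (hC _ _ h₂).internal
  have hlift : ∀ (W₃ : VData.{u, w} 𝒱) (I : W₁ ⊗[ℂ] W₂ →ₗ[ℂ] W₃.Completion)
      (hI : IsPzProduct C z g₁ g₂ W₁ W₂ W₃ I), ∃ f, IsBoxLift hI f :=
    fun W₃ I hI => exists_isBoxLift hT hC h₁ h₂ hI
  obtain ⟨𝒴, hlog, hcoeff⟩ := exists_boxOperator hC hX hfd hlift hW₁ hW₂
  have homog : ∀ (m₁ m₂ : ℂ), ∀ x₁ ∈ W₁.wt m₁, ∀ x₂ ∈ W₂.wt m₂, ∀ (n : ℂ) (k : ℕ),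
      𝒴 x₁ x₂ n k ∈ (boxProd C z g₁ g₂ W₁ W₂).wt (m₁ + m₂ - n - 1) := by
    intro m₁ m₂ x₁ hx₁ x₂ hx₂ n k
    -- Homogeneity as equality with the own projection can be tested through the lifts, which
    -- commute with projections.
    have e : 𝒴 x₁ x₂ n k =
        (boxProd C z g₁ g₂ W₁ W₂).proj (m₁ + m₂ - n - 1) (𝒴 x₁ x₂ n k) := by
      refine boxProd_ext hlift fun W₃ I hI f hf => ?_
      obtain ⟨𝒴₃, h𝒴₃, hI𝒴⟩ := hI.2
      have hW := (hC _ _ hI.1).internal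
      rw [hf.isGraded.map_proj hP.internal hW, hcoeff x₁ x₂ n k W₃ I hI f hf 𝒴₃ h𝒴₃ hI𝒴,
        VData.proj_of_mem hW (h𝒴₃.homog m₁ m₂ x₁ hx₁ x₂ hx₂ n k)]
    rw [e]
    exact Subtype.property _
  have hloc := isLocallyFinite_operator hW₁ hW₂ homog hlog
  refine ⟨𝒴, ⟨homog, hlog, lower_truncation_operator hP hW₁ hW₂ homog, ?_, ?_, ?_⟩, ?_⟩
  · intro a x₁ x₂ φ
    change DualityAt 𝒴 a x₁ x₂ φ
    induction φ using boxProd_gdual_induction hX hfd hlift with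
    | hp W₃ I hI f hf φ =>
      obtain ⟨𝒴₃, h𝒴₃, hI𝒴⟩ := hI.2
      exact DualityAt.pullback hf.isGraded hf.isModuleMap hP (hC _ _ hI.1) hloc
        (fun x₁ x₂ n k => hcoeff x₁ x₂ n k W₃ I hI f hf 𝒴₃ h𝒴₃ hI𝒴) (h𝒴₃.duality a x₁ x₂ φ)
    | h0 => exact dualityAt_zero 𝒴 a x₁ x₂
    | hadd φ ψ hφ hψ => exact hφ.add hψ
  · intro r hr a x₁ x₂ φ
    change ProductsAt 𝒴 r a x₁ x₂ φ
    induction φ using boxProd_gdual_induction hX hfd hlift with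
    | hp W₃ I hI f hf φ =>
      obtain ⟨𝒴₃, h𝒴₃, hI𝒴⟩ := hI.2
      exact ProductsAt.pullback hf.isGraded hf.isModuleMap hP (hC _ _ hI.1) hloc
        (fun x₁ x₂ n k => hcoeff x₁ x₂ n k W₃ I hI f hf 𝒴₃ h𝒴₃ hI𝒴)
        (h𝒴₃.products r hr a x₁ x₂ φ)
    | h0 => exact productsAt_zero 𝒴 r a x₁ x₂
    | hadd φ ψ hφ hψ => exact hφ.add hψ
  · intro x₁ x₂ n k
    refine boxProd_ext hlift fun W₃ I hI f hf => ?_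
    obtain ⟨𝒴₃, h𝒴₃, hI𝒴⟩ := hI.2
    have e := fun x₁ x₂ n k => hcoeff x₁ x₂ n k W₃ I hI f hf 𝒴₃ h𝒴₃ hI𝒴
    rw [map_add, map_smul, map_smul, e, e, e, h𝒴₃.L_neg_one_derivative]
  · intro x₁ x₂
    funext n
    apply Subtype.ext
    refine boxProd_ext hlift fun W₃ I hI f hf => ?_
    obtain ⟨𝒴₃, h𝒴₃, hI𝒴⟩ := hI.2
    have hW := hC _ _ hI.1
    rw [hf.map_boxMap hX hW.internal, hI𝒴]
    exact (congrArg (fun y : W₃.Completion => (y n : W₃))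
      (hf.isGraded.map_eval_operator hP hW hloc
        (fun x₁ x₂ n k => hcoeff x₁ x₂ n k W₃ I hI f hf 𝒴₃ h𝒴₃ hI𝒴) _ x₁ x₂)).symm

/-- The contragredient of `W₁ ⊠̃ W₂` is a tensor product. -/
theorem isPzTensorProduct_boxProd (hC : ∀ g W, C g W → IsTwistedModule g W)
    (hT : TensorAssumption C z) (h₁ : C g₁ W₁) (h₂ : C g₂ W₂) :
    IsPzTensorProduct C z g₁ g₂ W₁ W₂ (boxProd C z g₁ g₂ W₁ W₂) (boxMap C z g₁ g₂ W₁ W₂) := by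
  have hXC := hT.hbox_mem g₁ g₂ W₁ W₂ h₁ h₂
  have hX := (hC _ _ hXC).internal
  have hPC := hT.contra_mem _ _ hXC
  rw [inv_inv] at hPC
  refine ⟨⟨hPC, isPzIntertwiningMap_boxMap hC hT h₁ h₂ (hC _ _ hPC)⟩, fun W₃ I hI => ?_⟩
  obtain ⟨f, hf⟩ := exists_isBoxLift hT hC h₁ h₂ hI
  have hfI := hf.map_boxMap hX (hC _ _ hI.1).internal
  refine ⟨f, ⟨hf.isModuleMap, hfI⟩, fun f' hf' => ?_⟩
  exact boxProd_hom_ext hX (fun n => hT.finiteDimensional hC hXC n) fun t n => by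
    rw [hf'.2, hfI]

end Main

theorem mainTheorem4 {V : Type u} [AddCommGroup V] [Module ℂ V] (𝒱 : VOA V)
    (G : Subgroup (V ≃ₗ[ℂ] V)) (hG : G ≤ 𝒱.Aut) (z : ℂ) (hz : z ≠ 0) :
    (∀ C : TwClass.{u, w} 𝒱, IsCategoryWithoutAction G C → TensorAssumption C z →
      ∀ (g₁ g₂ : V ≃ₗ[ℂ] V) (W₁ W₂ : VData.{u, w} 𝒱), C g₁ W₁ → C g₂ W₂ →
        IsPzTensorProduct C z g₁ g₂ W₁ W₂ (boxProd C z g₁ g₂ W₁ W₂)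
          (boxMap C z g₁ g₂ W₁ W₂)) ∧
    (∀ C : TwClassWithAction.{u, w} 𝒱 G, IsCategoryWithAction G C →
      TensorAssumption C.underlying z →
      ∀ (g₁ g₂ : G) (W₁ W₂ : VData.{u, w} 𝒱) (ρ₁ : Representation ℂ G W₁)
        (ρ₂ : Representation ℂ G W₂), C g₁ W₁ ρ₁ → C g₂ W₂ ρ₂ →
        IsPzTensorProduct C.underlying z g₁ g₂ W₁ W₂ (boxProd C.underlying z g₁ g₂ W₁ W₂)
          (boxMap C.underlying z g₁ g₂ W₁ W₂)) := by
  refine ⟨fun C hC hT g₁ g₂ W₁ W₂ h₁ h₂ => ?_, fun C hC hT g₁ g₂ W₁ W₂ ρ₁ ρ₂ h₁ h₂ => ?_⟩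
  · exact isPzTensorProduct_boxProd (fun g W h => (hC g W h).2) hT h₁ h₂
  -- Module maps and intertwining maps ignore the G-action, so the case with actions is the same
  -- statement for the class of underlying modules.
  · exact isPzTensorProduct_boxProd (fun g W ⟨hg, ρ, h⟩ => (hC ⟨g, hg⟩ W ρ h).1) hT
      ⟨g₁.2, ρ₁, h₁⟩ ⟨g₂.2, ρ₂, h₂⟩
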